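/- **Conventions.** Vector spaces are over $\mathbb C$; $x,x_0,x_1,x_2,\dots$ are commuting formal variables. $U((x_1,\dots,x_r))=U[[x_1,\dots,x_r]][x_1^{-1},\dots,x_r^{-1}]$. For a vector space $W$ put $\mathcal E(W)=\mathrm{Hom}(W,W((x)))$, let $1_W\in\mathcal E(W)$ be the identity operator of $W$, and let $\mathbb C^\times$ act on $\mathcal E(W)$ by $R_\alpha a(x)=a(\alpha x)$. Powers $(x_0+x_2)^m$ are expanded in nonnegative powers of $x_2$, and powers $(\alpha x+x_0)^m$ in nonnegative powers of $x_0$. A sequence $(\psi^{(1)},\dots,\psi^{(r)})$ in $\mathcal E(W)$ is *quasi compatible* if there is a nonzero polynomial $p(x,y)\in\mathbb C[x,y]$ with $\big(\prod_{i<j}p(x_i,x_j)\big)\psi^{(1)}(x_1)\cdots\psi^{(r)}(x_r)\in\mathrm{Hom}(W,W((x_1,\dots,x_r)))$. A subset (or subspace) of $\mathcal E(W)$ is *quasi compatible* if every finite sequence in it is. For a quasi compatible pair $(a(x),b(x))$ and $\alpha\in\mathbb C^\times$ define $a(x)_{(\alpha,n)}b(x)\in\mathcal E(W)$, $n\in\mathbb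 Z$, by $$Y_{\mathcal E}^{(\alpha)}(a(x),x_0)b(x)=\sum_{n\in\mathbb Z}\big(a(x)_{(\alpha,n)}b(x)\big)x_0^{-n-1}=\iota_{x,x_0}\big(p(x_0+\alpha x,x)^{-1}\big)\,\big(p(x_1,x)a(x_1)b(x)\big)\big|_{x_1=\alpha x+x_0},$$ where $p$ is any nonzero polynomial with $p(x_1,x_2)a(x_1)b(x_2)\in\mathrm{Hom}(W,W((x_1,x_2)))$ and $\iota_{x,x_0}:\mathbb C(x,x_0)\to\mathbb C((x))((x_0))$ is the canonical embedding (the result does not depend on $p$). Write $Y_{\mathcal E}=Y_{\mathcal E}^{(1)}$ and $a(x)_nb(x)=a(x)_{(1,n)}b(x)$. A quasi compatible subspace $U\subseteq\mathcal E(W)$ is *closed* if $a(x)_nb(x)\in U$ for all $a(x),b(x)\in U$, $n\in\mathbb Z$. A *nonlocal vertex algebra* $(V,Y,\mathbf 1)$ is a vector space $V$ with a linear map $Y(\cdot,x):V\to\mathrm{Hom}(V,V((x)))$ and a vector $\mathbf 1\in V$ such that, for all $u,v,w\in V$: $Y(\mathbf 1,x)v=v$; $Y(v,x)\mathbf 1\in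 V[[x]]$ with constant term $v$; and for some $l\in\mathbb N$, $(x_0+x_2)^lY(u,x_0+x_2)Y(v,x_2)w=(x_0+x_2)^lY(Y(u,x_0)v,x_2)w$. A *quasi $V$-module* is a vector space $W$ with a linear map $Y_W:V\to\mathcal E(W)$ such that $Y_W(\mathbf 1,x)=1_W$ and for all $u,v\in V$, $w\in W$ there is a nonzero polynomial $f(x_1,x_2)$ with $f(x_0+x_2,x_2)Y_W(u,x_0+x_2)Y_W(v,x_2)w=f(x_0+x_2,x_2)Y_W(Y(u,x_0)v,x_2)w$; it is *faithful* if $Y_W$ is injective. **Theorem.** Let $W$ be a vector space, $S$ any quasi compatible subset of $\mathcal E(W)$ and $\Gamma$ any subgroup of $\mathbb C^\times$. There is a unique smallest closed quasi compatible subspace $\langle S\rangle_\Gamma$ of $\mathcal E(W)$ which contains $S\cup\{1_W\}$ and is stable under $R_\alpha$ for all $\alpha\in\Gamma$. The triple $(\langle S\rangle_\Gamma,Y_{\mathcal E},1_W)$ is a nonlocal vertex algebra, and $W$ is a faithful quasi $\langle S\rangle_\Gamma$-module with $Y_W(\psi(x),x_0)=\psi(x_0)$. Furthermore, $$\langle S\rangle_\Gamma=\mathrm{span}\{a^{(1)}(x)_{n_1}\cdots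 a^{(r)}(x)_{n_r}1_W\mid r\ge 0,\ a^{(i)}(x)\in R_\Gamma(S),\ n_i\in\mathbb Z\},$$ where $R_\Gamma(S)=\{R_\alpha a(x)\mid\alpha\in\Gamma,\ a(x)\in S\}$ and the products are associated to the right. For all $a(x),b(x)\in\langle S\rangle_\Gamma$, $\alpha\in\Gamma$, $n\in\mathbb Z$: $$a(x)_{(\alpha,n)}b(x)\in\langle S\rangle_\Gamma,$$ $$Y_{\mathcal E}^{(\alpha)}(a(x),x_0)b(x)=R_\alpha Y_{\mathcal E}(a(x),x_0)R_{\alpha^{-1}}b(x),$$ $$R_\alpha Y_{\mathcal E}(a(x),x_0)R_{\alpha^{-1}}b(x)=Y_{\mathcal E}(R_\alpha a(x),\alpha^{-1}x_0)b(x).$$ -/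

import Mathlib

namespace FormalCalculus

noncomputable section

/-- `calE W` is the space `ℰ(W) = Hom(W, W((x)))` over `ℂ`; `LaurentSeries W` is `W((x))`. -/
abbrev calE (W : Type*) [AddCommGroup W] [Module ℂ W] : Type _ := W →ₗ[ℂ] LaurentSeries W

/-- The coefficient of `x ^ k` in `a(x)`, an endomorphism of `W`. -/
def coeffOp {W : Type*} [AddCommGroup W] [Module ℂ W] (a : calE W) (k : ℤ) : Module.End ℂ W :=
  HahnSeries.coeff.linearMap k ∘ₗ a

/-- The field `1_W`, i.e. the map `w ↦ w x ^ 0`. -/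
def idField (W : Type*) [AddCommGroup W] [Module ℂ W] : calE W :=
  HahnSeries.single.linearMap 0

/-- The rescaling `R_α a(x) = a(α x)`. -/
def rescale {W : Type*} [AddCommGroup W] [Module ℂ W] (α : ℂˣ) (a : calE W) : calE W where
  toFun w :=
    { coeff := fun k => ((α : ℂ) ^ k) • (a w).coeff k
      isPWO_support' := (a w).isPWO_support.mono fun k hk hk' => hk (by
        simp only [hk', smul_zero]) }
  map_add' v w := by ext k; simp
  map_smul' c w := by ext k; simp [smul_comm c]

/-- `U[[x_1^{±1}, …, x_r^{±1}]]`: the value at `m` is the coefficient of `∏ x_i ^ (m i)`. -/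
abbrev FormalSeries (r : ℕ) (U : Type*) : Type _ := (Fin r → ℤ) → U

/-- The product of a polynomial with a doubly infinite formal series. -/
def polyMul {r : ℕ} {U : Type*} [AddCommGroup U] [Module ℂ U]
    (f : MvPolynomial (Fin r) ℂ) (A : FormalSeries r U) : FormalSeries r U :=
  fun m => ∑ d ∈ f.support, f.coeff d • A (fun i => m i - d i)

/-- `U((x_1, …, x_r)) = U[[x_1, …, x_r]][x_1⁻¹, …, x_r⁻¹]`. -/
def lowerTruncated (r : ℕ) (U : Type*) [AddCommGroup U] [Module ℂ U] :
    Submodule ℂ (FormalSeries r U) where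
  carrier := {A | ∃ N : ℤ, ∀ m, A m ≠ 0 → ∀ i, N ≤ m i}
  zero_mem' := ⟨0, fun m h => absurd rfl h⟩
  add_mem' := by
    rintro A B ⟨N, hN⟩ ⟨M, hM⟩
    refine ⟨min N M, fun m h i => ?_⟩
    by_cases hA : A m = 0
    · have hB : B m ≠ 0 := fun hB => h (by simp [hA, hB])
      exact (min_le_right _ _).trans (hM m hB i)
    · exact (min_le_left _ _).trans (hN m hA i)
  smul_mem' := by
    rintro c A ⟨N, hN⟩
    exact ⟨N, fun m h i => hN m (fun hA => h (by simp [hA])) i⟩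

section Compatibility

variable {W : Type*} [AddCommGroup W] [Module ℂ W]

/-- `ψ_1(x_1) ⋯ ψ_r(x_r) w` as a formal series in `x_1, …, x_r`. -/
def fieldProduct {r : ℕ} (ψ : Fin r → calE W) (w : W) : FormalSeries r W :=
  fun m => (List.ofFn fun i => coeffOp (ψ i) (m i)).prod w

/-- `∏_{i < j} p(x_i, x_j)`. -/
def pairProduct (p : MvPolynomial (Fin 2) ℂ) (r : ℕ) : MvPolynomial (Fin r) ℂ :=
  ∏ ij ∈ (Finset.univ : Finset (Fin r × Fin r)).filter (fun ij => ij.1 < ij.2),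
    MvPolynomial.rename ![ij.1, ij.2] p

/-- Quasi compatibility of a finite ordered sequence of fields. -/
def QuasiCompatibleSeq {r : ℕ} (ψ : Fin r → calE W) : Prop :=
  ∃ p : MvPolynomial (Fin 2) ℂ, p ≠ 0 ∧
    ∀ w : W, polyMul (pairProduct p r) (fieldProduct ψ w) ∈ lowerTruncated r W

/-- A set of fields is quasi compatible if every finite sequence in it is. -/
def QuasiCompatible (S : Set (calE W)) : Prop :=
  ∀ (r : ℕ) (ψ : Fin r → calE W), (∀ i, ψ i ∈ S) → QuasiCompatibleSeq ψ

/-- `p ≠ 0` and `p(x_1, x_2) a(x_1) b(x_2) ∈ Hom(W, W((x_1, x_2)))`. -/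
structure IsAnnihilator (p : MvPolynomial (Fin 2) ℂ) (a b : calE W) : Prop where
  ne_zero : p ≠ 0
  mem : ∀ w : W, polyMul p (fieldProduct ![a, b] w) ∈ lowerTruncated 2 W

theorem pairProduct_two (p : MvPolynomial (Fin 2) ℂ) : pairProduct p 2 = p := by
  have h : (Finset.univ : Finset (Fin 2 × Fin 2)).filter (fun ij => ij.1 < ij.2) = {(0, 1)} := by
    decide
  have h' : (![0, 1] : Fin 2 → Fin 2) = id := by
    funext i; fin_cases i <;> rfl
  simp [pairProduct, h, h', MvPolynomial.rename_id]

theorem quasiCompatibleSeq_pair_iff (a b : calE W) :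
    QuasiCompatibleSeq ![a, b] ↔ ∃ p, IsAnnihilator p a b := by
  simp only [QuasiCompatibleSeq, pairProduct_two]
  exact ⟨fun ⟨p, h0, h⟩ => ⟨p, h0, h⟩, fun ⟨p, h⟩ => ⟨p, h.ne_zero, h.mem⟩⟩

end Compatibility

section Substitution

variable {W : Type*} [AddCommGroup W] [Module ℂ W]

/-- The field `ℂ((x))((x_0))`. The outer exponent is the one of `x_0`, the inner exponent that
of `x`. -/
def BiLaurent : Type := LaurentSeries (LaurentSeries ℂ)

instance : Field BiLaurent := inferInstanceAs (Field (LaurentSeries (LaurentSeries ℂ)))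

/-- The inclusion of `ℂ` into `ℂ((x))((x_0))`. -/
def BiLaurent.C : ℂ →+* BiLaurent :=
  (HahnSeries.C : LaurentSeries ℂ →+* LaurentSeries (LaurentSeries ℂ)).comp HahnSeries.C

/-- The element `x_0` of `ℂ((x))((x_0))`. -/
def BiLaurent.X₀ : BiLaurent :=
  (HahnSeries.single 1 1 : LaurentSeries (LaurentSeries ℂ))

/-- The element `x` of `ℂ((x))((x_0))`. -/
def BiLaurent.X : BiLaurent :=
  (HahnSeries.C (HahnSeries.single 1 1) : LaurentSeries (LaurentSeries ℂ))

/-- `W((x))((x_0))`, a vector space over the field `ℂ((x))((x_0))`. The outer exponent is the one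
of `x_0`, the inner exponent that of `x`. -/
def IteratedLaurent (W : Type*) [AddCommGroup W] [Module ℂ W] : Type _ :=
  HahnModule ℤ (LaurentSeries ℂ) (HahnModule ℤ ℂ W)

instance : AddCommGroup (IteratedLaurent W) :=
  inferInstanceAs (AddCommGroup (HahnModule ℤ (LaurentSeries ℂ) (HahnModule ℤ ℂ W)))

instance : Module BiLaurent (IteratedLaurent W) :=
  inferInstanceAs (Module (HahnSeries ℤ (LaurentSeries ℂ))
    (HahnModule ℤ (LaurentSeries ℂ) (HahnModule ℤ ℂ W)))

/-- The coefficient of `x_0 ^ j x ^ k`. -/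
def IteratedLaurent.coeff (F : IteratedLaurent W) (j k : ℤ) : W :=
  ((HahnModule.of ℂ).symm (((HahnModule.of (LaurentSeries ℂ)).symm F).coeff j)).coeff k

/-- The coefficient of `x_0 ^ i x ^ k` in `A(α x + x_0, x)` for `A ∈ W((x_1, x))`, where
`(α x + x_0) ^ m` is expanded in nonnegative powers of `x_0`. -/
def substCoeff (α : ℂˣ) (A : FormalSeries 2 W) (i : ℕ) (k : ℤ) : W :=
  ∑ᶠ m : ℤ, (((Ring.choose m i : ℤ) : ℂ) * (α : ℂ) ^ (m - i)) • A ![m, k + i - m]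

theorem substCoeff_finite (α : ℂˣ) {A : FormalSeries 2 W} (hA : A ∈ lowerTruncated 2 W)
    (i : ℕ) (k : ℤ) :
    (Function.support fun m : ℤ =>
      (((Ring.choose m i : ℤ) : ℂ) * (α : ℂ) ^ (m - i)) • A ![m, k + i - m]).Finite := by
  obtain ⟨N, hN⟩ := hA
  refine (Set.finite_Icc N (k + i - N)).subset fun m hm => ?_
  have h := hN ![m, k + i - m] fun h0 => hm (by simp only [h0, smul_zero])
  have h0 := h 0
  have h1 := h 1
  simp only [Matrix.cons_val_zero, Matrix.cons_val_one] at h0 h1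
  exact ⟨h0, by lia⟩

theorem substCoeff_add (α : ℂˣ) {A B : FormalSeries 2 W} (hA : A ∈ lowerTruncated 2 W)
    (hB : B ∈ lowerTruncated 2 W) (i : ℕ) (k : ℤ) :
    substCoeff α (A + B) i k = substCoeff α A i k + substCoeff α B i k := by
  simp only [substCoeff, Pi.add_apply, smul_add]
  exact finsum_add_distrib (substCoeff_finite α hA i k) (substCoeff_finite α hB i k)

theorem substCoeff_smul (α : ℂˣ) (c : ℂ) (A : FormalSeries 2 W) (i : ℕ) (k : ℤ) :
    substCoeff α (c • A) i k = c • substCoeff α A i k := by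
  simp only [substCoeff, Pi.smul_apply, smul_finsum]
  exact finsum_congr fun m => smul_comm _ _ _

theorem substCoeff_bddBelow (α : ℂˣ) {A : FormalSeries 2 W} (hA : A ∈ lowerTruncated 2 W)
    (i : ℕ) : BddBelow (Function.support (substCoeff α A i)) := by
  obtain ⟨N, hN⟩ := hA
  refine ⟨2 * N - i, fun k hk => ?_⟩
  obtain ⟨m, hm⟩ : ∃ m : ℤ,
      (((Ring.choose m i : ℤ) : ℂ) * (α : ℂ) ^ (m - i)) • A ![m, k + i - m] ≠ 0 := by
    by_contra hcon
    push Not at hcon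
    exact hk (finsum_eq_zero_of_forall_eq_zero hcon)
  have h := hN ![m, k + i - m] fun h0 => hm (by simp only [h0, smul_zero])
  have h0 := h 0
  have h1 := h 1
  simp only [Matrix.cons_val_zero, Matrix.cons_val_one] at h0 h1
  lia

/-- The substitution `A(x_1, x) ↦ A(α x + x_0, x)` from `W((x_1, x))` to
`W((x))[[x_0]] ⊆ W((x))((x_0))`. -/
def subst (α : ℂˣ) (A : lowerTruncated 2 W) : IteratedLaurent W :=
  HahnModule.of (LaurentSeries ℂ) (HahnSeries.ofSuppBddBelow
    (fun j : ℤ => if 0 ≤ j then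
        HahnModule.of ℂ (HahnSeries.ofSuppBddBelow (substCoeff α A.1 j.toNat)
          (substCoeff_bddBelow α A.2 j.toNat))
      else 0)
    ⟨0, fun j hj => by
      by_contra h
      exact hj (if_neg h)⟩)

theorem coeff_subst (α : ℂˣ) (A : lowerTruncated 2 W) (j k : ℤ) :
    (subst α A).coeff j k = if 0 ≤ j then substCoeff α A.1 j.toNat k else 0 := by
  by_cases h : 0 ≤ j
  · have h1 : (if 0 ≤ j then substCoeff α A.1 j.toNat k else 0) = substCoeff α A.1 j.toNat k :=
      if_pos h
    rw [h1]
    change ((HahnModule.of ℂ).symm (if 0 ≤ j then _ else 0)).coeff k = _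
    rw [if_pos h]
    rfl
  · rw [if_neg h]
    change ((HahnModule.of ℂ).symm (if 0 ≤ j then _ else 0)).coeff k = _
    rw [if_neg h]
    rfl

theorem IteratedLaurent.ext' {F G : IteratedLaurent W} (h : ∀ j k, F.coeff j k = G.coeff j k) :
    F = G := by
  apply HahnModule.ext
  funext j
  apply HahnModule.ext
  funext k
  exact h j k

theorem coeff_C_smul (c : ℂ) (F : IteratedLaurent W) (j k : ℤ) :
    (BiLaurent.C c • F).coeff j k = c • F.coeff j k := by
  have h : ((HahnModule.of (LaurentSeries ℂ)).symm (BiLaurent.C c • F)).coeff j =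
      (HahnSeries.C c : LaurentSeries ℂ) • ((HahnModule.of (LaurentSeries ℂ)).symm F).coeff j :=
    HahnModule.coeff_single_zero_smul (Γ := ℤ) (Γ' := ℤ) (R := LaurentSeries ℂ)
      (V := HahnModule ℤ ℂ W)
  unfold IteratedLaurent.coeff
  rw [h]
  exact HahnModule.coeff_single_zero_smul (Γ := ℤ) (Γ' := ℤ) (R := ℂ) (V := W)

theorem coeff_add (F G : IteratedLaurent W) (j k : ℤ) :
    (F + G).coeff j k = F.coeff j k + G.coeff j k := rfl

theorem subst_add (α : ℂˣ) (A B : lowerTruncated 2 W) :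
    subst α (A + B) = subst α A + subst α B := by
  refine IteratedLaurent.ext' fun j k => ?_
  rw [coeff_add, coeff_subst, coeff_subst, coeff_subst]
  split_ifs
  · exact substCoeff_add α A.2 B.2 _ _
  · simp

theorem subst_smul (α : ℂˣ) (c : ℂ) (A : lowerTruncated 2 W) :
    subst α (c • A) = BiLaurent.C c • subst α A := by
  refine IteratedLaurent.ext' fun j k => ?_
  rw [coeff_C_smul, coeff_subst, coeff_subst]
  split_ifs
  · exact substCoeff_smul α c A.1 _ _
  · simp

/-- `p(x_0 + α x, x)` as an element of the field `ℂ((x))((x_0))`. Its inverse in that field is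
`ι_{x, x_0}(p(x_0 + α x, x)⁻¹)`. -/
def shiftedPoly (α : ℂˣ) (p : MvPolynomial (Fin 2) ℂ) : BiLaurent :=
  MvPolynomial.eval₂ BiLaurent.C
    ![BiLaurent.X₀ + BiLaurent.C α * BiLaurent.X, BiLaurent.X] p

theorem fieldProduct_add {r : ℕ} (ψ : Fin r → calE W) (v w : W) :
    fieldProduct ψ (v + w) = fieldProduct ψ v + fieldProduct ψ w := by
  funext m; simp [fieldProduct]

theorem fieldProduct_smul {r : ℕ} (ψ : Fin r → calE W) (c : ℂ) (w : W) :
    fieldProduct ψ (c • w) = c • fieldProduct ψ w := by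
  funext m; simp [fieldProduct]

theorem polyMul_add {r : ℕ} (f : MvPolynomial (Fin r) ℂ) (A B : FormalSeries r W) :
    polyMul f (A + B) = polyMul f A + polyMul f B := by
  funext m; simp [polyMul, Finset.sum_add_distrib]

theorem polyMul_smul {r : ℕ} (f : MvPolynomial (Fin r) ℂ) (c : ℂ) (A : FormalSeries r W) :
    polyMul f (c • A) = c • polyMul f A := by
  funext m
  simp only [polyMul, Pi.smul_apply, Finset.smul_sum]
  exact Finset.sum_congr rfl fun d _ => smul_comm _ _ _

/-- `ι_{x, x_0}(p(x_0 + α x, x)⁻¹) (p(x_1, x) a(x_1) b(x) w)|_{x_1 = α x + x_0}`. -/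
def vertexSeries (α : ℂˣ) {p : MvPolynomial (Fin 2) ℂ} {a b : calE W}
    (hp : IsAnnihilator p a b) (w : W) : IteratedLaurent W :=
  (shiftedPoly α p)⁻¹ • subst α ⟨polyMul p (fieldProduct ![a, b] w), hp.mem w⟩

theorem vertexSeries_add (α : ℂˣ) {p : MvPolynomial (Fin 2) ℂ} {a b : calE W}
    (hp : IsAnnihilator p a b) (v w : W) :
    vertexSeries α hp (v + w) = vertexSeries α hp v + vertexSeries α hp w := by
  have h : (⟨polyMul p (fieldProduct ![a, b] (v + w)), hp.mem (v + w)⟩ : lowerTruncated 2 W) =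
      ⟨polyMul p (fieldProduct ![a, b] v), hp.mem v⟩ +
        ⟨polyMul p (fieldProduct ![a, b] w), hp.mem w⟩ :=
    Subtype.ext (by simp only [fieldProduct_add, polyMul_add, Submodule.coe_add])
  simp only [vertexSeries]
  rw [h, subst_add]
  exact smul_add (shiftedPoly α p)⁻¹ _ _

theorem vertexSeries_smul (α : ℂˣ) {p : MvPolynomial (Fin 2) ℂ} {a b : calE W}
    (hp : IsAnnihilator p a b) (c : ℂ) (w : W) :
    vertexSeries α hp (c • w) = BiLaurent.C c • vertexSeries α hp w := by
  have h : (⟨polyMul p (fieldProduct ![a, b] (c • w)), hp.mem (c • w)⟩ : lowerTruncated 2 W) =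
      c • ⟨polyMul p (fieldProduct ![a, b] w), hp.mem w⟩ :=
    Subtype.ext (by simp only [fieldProduct_smul, polyMul_smul, Submodule.coe_smul])
  simp only [vertexSeries]
  rw [h, subst_smul]
  rw [smul_smul, smul_smul, mul_comm]

theorem polyMul_eq_sum {r : ℕ} (f : MvPolynomial (Fin r) ℂ) (A : FormalSeries r W)
    (s : Finset (Fin r →₀ ℕ)) (hs : f.support ⊆ s) (m : Fin r → ℤ) :
    polyMul f A m = ∑ d ∈ s, f.coeff d • A (fun i => m i - d i) :=
  Finset.sum_subset hs fun d _ hd => by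
    rw [MvPolynomial.notMem_support_iff.1 hd, zero_smul]

theorem polyMul_add_left {r : ℕ} (f g : MvPolynomial (Fin r) ℂ) (A : FormalSeries r W) :
    polyMul (f + g) A = polyMul f A + polyMul g A := by
  classical
  funext m
  rw [Pi.add_apply, polyMul_eq_sum (f + g) A (f.support ∪ g.support) MvPolynomial.support_add,
    polyMul_eq_sum f A (f.support ∪ g.support) Finset.subset_union_left,
    polyMul_eq_sum g A (f.support ∪ g.support) Finset.subset_union_right,
    ← Finset.sum_add_distrib]
  exact Finset.sum_congr rfl fun d _ => by rw [MvPolynomial.coeff_add, add_smul]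

theorem polyMul_monomial {r : ℕ} (d : Fin r →₀ ℕ) (c : ℂ) (A : FormalSeries r W) :
    polyMul (MvPolynomial.monomial d c) A = fun m => c • A (fun i => m i - d i) := by
  funext m
  rw [polyMul_eq_sum _ A {d} MvPolynomial.support_monomial_subset]
  simp

theorem polyMul_mul {r : ℕ} (f g : MvPolynomial (Fin r) ℂ) (A : FormalSeries r W) :
    polyMul (f * g) A = polyMul f (polyMul g A) := by
  induction f using MvPolynomial.induction_on' with
  | monomial d c =>
    induction g using MvPolynomial.induction_on' with
    | monomial e c' =>
      simp only [MvPolynomial.monomial_mul, polyMul_monomial, mul_smul]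
      funext m
      simp [sub_sub]
    | add g g' hg hg' => simp only [mul_add, polyMul_add_left, hg, hg', polyMul_add]
  | add f f' hf hf' => simp only [add_mul, polyMul_add_left, hf, hf']

theorem polyMul_mem {r : ℕ} (f : MvPolynomial (Fin r) ℂ) {A : FormalSeries r W}
    (hA : A ∈ lowerTruncated r W) : polyMul f A ∈ lowerTruncated r W := by
  induction f using MvPolynomial.induction_on' with
  | monomial d c =>
    obtain ⟨N, hN⟩ := hA
    rw [polyMul_monomial]
    refine ⟨N, fun m hm i => ?_⟩
    have := hN (fun i => m i - d i) (fun h0 => hm (by simp only [h0, smul_zero])) i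
    lia
  | add f g hf hg =>
    rw [polyMul_add_left]
    exact add_mem hf hg

/-- The coefficient of `x_0 ^ j x ^ k`. -/
def BiLaurent.coeff (F : BiLaurent) (j k : ℤ) : ℂ :=
  HahnSeries.coeff (HahnSeries.coeff (F : LaurentSeries (LaurentSeries ℂ)) j) k

theorem monomial_eq (c : ℂ) (i j : ℕ) : BiLaurent.C c * (BiLaurent.X₀ ^ i * BiLaurent.X ^ j) =
    (HahnSeries.single (i : ℤ) (HahnSeries.single (j : ℤ) c) :
      LaurentSeries (LaurentSeries ℂ)) := by
  have h1 : BiLaurent.X ^ j = (HahnSeries.C (HahnSeries.single (j : ℤ) (1 : ℂ)) :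
      LaurentSeries (LaurentSeries ℂ)) := by
    have h : (HahnSeries.single (1 : ℤ) (1 : ℂ)) ^ j = HahnSeries.single (j : ℤ) (1 : ℂ) := by
      rw [HahnSeries.single_pow]; simp
    exact (map_pow HahnSeries.C (HahnSeries.single (1 : ℤ) (1 : ℂ)) j).symm.trans
      (congrArg HahnSeries.C h)
  have h0 : BiLaurent.X₀ ^ i = (HahnSeries.single (i : ℤ) 1 :
      LaurentSeries (LaurentSeries ℂ)) := by
    have h : (HahnSeries.single (1 : ℤ) (1 : LaurentSeries ℂ)) ^ i =
        HahnSeries.single (i : ℤ) (1 : LaurentSeries ℂ) := by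
      rw [HahnSeries.single_pow]; simp
    exact h
  have h2 : (HahnSeries.single (i : ℤ) (1 : LaurentSeries ℂ)) *
      HahnSeries.single (0 : ℤ) (HahnSeries.single (j : ℤ) (1 : ℂ)) =
        HahnSeries.single (i : ℤ) (HahnSeries.single (j : ℤ) (1 : ℂ)) := by
    rw [HahnSeries.single_mul_single, add_zero, one_mul]
  have h3 : (HahnSeries.single (0 : ℤ) (HahnSeries.single (0 : ℤ) c)) *
      HahnSeries.single (i : ℤ) (HahnSeries.single (j : ℤ) (1 : ℂ)) =
        HahnSeries.single (i : ℤ) (HahnSeries.single (j : ℤ) c) := by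
    rw [HahnSeries.single_mul_single, HahnSeries.single_mul_single, zero_add, zero_add, mul_one]
  rw [h0, h1]
  exact (congrArg (BiLaurent.C c * ·) h2).trans h3

theorem coeff_eval₂ (f : MvPolynomial (Fin 2) ℂ) (d : Fin 2 →₀ ℕ) :
    (MvPolynomial.eval₂ BiLaurent.C ![BiLaurent.X₀, BiLaurent.X] f).coeff (d 0) (d 1) =
      f.coeff d := by
  induction f using MvPolynomial.induction_on' with
  | monomial e c =>
    rw [MvPolynomial.eval₂_monomial, Finsupp.prod_fintype _ _ (by simp), Fin.prod_univ_two]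
    change (BiLaurent.C c * (BiLaurent.X₀ ^ (e 0) * BiLaurent.X ^ (e 1))).coeff _ _ = _
    rw [monomial_eq, MvPolynomial.coeff_monomial]
    change HahnSeries.coeff (HahnSeries.coeff (HahnSeries.single ((e 0 : ℕ) : ℤ)
      (HahnSeries.single ((e 1 : ℕ) : ℤ) c)) (d 0 : ℤ)) (d 1 : ℤ) = _
    by_cases hd : e = d
    · subst hd; simp
    · rw [if_neg hd]
      by_cases h3 : d 0 = e 0
      · have h4 : d 1 ≠ e 1 := fun h4 => hd (by ext i; fin_cases i; exacts [h3.symm, h4.symm])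
        rw [h3, HahnSeries.coeff_single_same,
          HahnSeries.coeff_single_of_ne (by exact_mod_cast h4)]
      · rw [HahnSeries.coeff_single_of_ne (by exact_mod_cast h3), HahnSeries.coeff_zero]
  | add f g hf hg =>
    rw [MvPolynomial.eval₂_add, MvPolynomial.coeff_add, ← hf, ← hg]
    rfl

theorem shiftedPoly_ne_zero (α : ℂˣ) {p : MvPolynomial (Fin 2) ℂ} (hp : p ≠ 0) :
    shiftedPoly α p ≠ 0 := by
  intro h0
  let P : MvPolynomial (Fin 2) ℂ := MvPolynomial.aeval
    ![MvPolynomial.X 0 + MvPolynomial.C (α : ℂ) * MvPolynomial.X 1, MvPolynomial.X 1] p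
  have hP : MvPolynomial.eval₂ BiLaurent.C ![BiLaurent.X₀, BiLaurent.X] P = shiftedPoly α p := by
    change MvPolynomial.eval₂Hom BiLaurent.C ![BiLaurent.X₀, BiLaurent.X] P = _
    simp only [P, MvPolynomial.aeval_def, MvPolynomial.hom_eval₂, shiftedPoly]
    congr 1
    · ext c; simp
    · funext i; fin_cases i <;> simp
  have hinv : MvPolynomial.aeval (![MvPolynomial.X 0 - MvPolynomial.C (α : ℂ) * MvPolynomial.X 1,
      MvPolynomial.X 1] : Fin 2 → MvPolynomial (Fin 2) ℂ) P = p := by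
    simp only [P]
    rw [← AlgHom.comp_apply]
    conv_rhs => rw [← AlgHom.id_apply (R := ℂ) p]
    congr 1
    ext i : 1
    fin_cases i <;> simp
  apply hp
  have hP0 : P = 0 := by
    ext d
    rw [← coeff_eval₂, hP, h0]
    rfl
  rw [← hinv, hP0, map_zero]

theorem coeff_X₀_smul (F : IteratedLaurent W) (j k : ℤ) :
    (BiLaurent.X₀ • F).coeff j k = F.coeff (j - 1) k := by
  have h := HahnModule.coeff_single_smul_vadd (Γ := ℤ) (Γ' := ℤ) (R := LaurentSeries ℂ)
      (V := HahnModule ℤ ℂ W) (r := 1) (x := F) (a := j - 1) (b := 1)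
  rw [vadd_eq_add, add_sub_cancel, one_smul] at h
  exact congrArg (fun G => ((HahnModule.of ℂ).symm G).coeff k) h

theorem coeff_X_smul (F : IteratedLaurent W) (j k : ℤ) :
    (BiLaurent.X • F).coeff j k = F.coeff j (k - 1) := by
  have h : ((HahnModule.of (LaurentSeries ℂ)).symm (BiLaurent.X • F)).coeff j =
      (HahnSeries.single 1 1 : LaurentSeries ℂ) •
        ((HahnModule.of (LaurentSeries ℂ)).symm F).coeff j :=
    HahnModule.coeff_single_zero_smul (Γ := ℤ) (Γ' := ℤ) (R := LaurentSeries ℂ)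
      (V := HahnModule ℤ ℂ W)
  have h' := HahnModule.coeff_single_smul_vadd (Γ := ℤ) (Γ' := ℤ) (R := ℂ) (V := W) (r := 1)
    (x := ((HahnModule.of (LaurentSeries ℂ)).symm F).coeff j) (a := k - 1) (b := 1)
  rw [vadd_eq_add, add_sub_cancel, one_smul] at h'
  unfold IteratedLaurent.coeff
  rw [h]
  exact h'

theorem subst_X_zero (α : ℂˣ) (A B : lowerTruncated 2 W)
    (h : ∀ m n : ℤ, B.1 ![m, n] = A.1 ![m - 1, n]) :
    subst α B = (BiLaurent.X₀ + BiLaurent.C α * BiLaurent.X) • subst α A := by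
  refine IteratedLaurent.ext' fun j k => ?_
  rw [add_smul, mul_smul, coeff_add, coeff_X₀_smul, coeff_C_smul, coeff_X_smul, coeff_subst,
    coeff_subst, coeff_subst]
  rcases lt_trichotomy j 0 with hj | rfl | hj
  · rw [if_neg (by lia), if_neg (by lia), if_neg (by lia)]; simp
  · rw [if_pos le_rfl, if_neg (by lia), if_pos le_rfl, zero_add]
    simp only [substCoeff, Int.toNat_zero, smul_finsum]
    rw [← finsum_comp_equiv (Equiv.addRight (1 : ℤ))]
    refine finsum_congr fun m => ?_
    have hα : (α : ℂ) ^ (m + 1) = α * (α : ℂ) ^ m := by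
      rw [zpow_add_one₀ α.ne_zero, mul_comm]
    have a1 : k - (m + 1) = k - 1 - m := by ring
    simp [h, smul_smul, hα, a1]
  · obtain ⟨i, rfl⟩ : ∃ i : ℕ, j = i + 1 := ⟨(j - 1).toNat, by lia⟩
    rw [if_pos (by lia), if_pos (by lia), if_pos (by lia)]
    have e1 : ((i : ℤ) + 1).toNat = i + 1 := by lia
    have e2 : ((i : ℤ) + 1 - 1).toNat = i := by lia
    rw [e1, e2]
    simp only [substCoeff, smul_finsum]
    rw [← finsum_comp_equiv (Equiv.addRight (1 : ℤ)), ← finsum_add_distrib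
      (substCoeff_finite α A.2 i k)]
    · refine finsum_congr fun m => ?_
      simp only [Equiv.coe_addRight, h, Ring.choose_succ_succ, smul_smul]
      have hα : (α : ℂ) * (α : ℂ) ^ (m - ((i + 1 : ℕ) : ℤ)) = (α : ℂ) ^ (m - (i : ℤ)) := by
        rw [← zpow_one_add₀ α.ne_zero]; congr 1; push_cast; ring
      have a1 : m + 1 - 1 = m := by ring
      have a2 : k + ((i + 1 : ℕ) : ℤ) - (m + 1) = k + i - m := by push_cast; ring
      have a3 : k - 1 + ((i + 1 : ℕ) : ℤ) - m = k + i - m := by push_cast; ring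
      have a4 : m + 1 - ((i + 1 : ℕ) : ℤ) = m - i := by push_cast; ring
      rw [a1, a2, a3, a4, ← add_smul, mul_left_comm, hα]
      push_cast
      rw [add_mul]
    · refine (substCoeff_finite α A.2 (i + 1) (k - 1)).subset fun m hm h0 => hm ?_
      simp only [h0, smul_zero]

theorem subst_X_one (α : ℂˣ) (A B : lowerTruncated 2 W)
    (h : ∀ m n : ℤ, B.1 ![m, n] = A.1 ![m, n - 1]) :
    subst α B = BiLaurent.X • subst α A := by
  refine IteratedLaurent.ext' fun j k => ?_
  rw [coeff_X_smul, coeff_subst, coeff_subst]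
  split_ifs
  · refine finsum_congr fun m => ?_
    rw [h]
    congr 3
    ring_nf
  · rfl

theorem subst_polyMul (α : ℂˣ) (q : MvPolynomial (Fin 2) ℂ) (A : lowerTruncated 2 W) :
    subst α ⟨polyMul q A.1, polyMul_mem q A.2⟩ = shiftedPoly α q • subst α A := by
  induction q using MvPolynomial.induction_on generalizing A with
  | C c =>
    have e : (⟨polyMul (MvPolynomial.C c) A.1, polyMul_mem _ A.2⟩ : lowerTruncated 2 W) =
        c • A := by
      refine Subtype.ext ?_
      funext m
      have := congrFun (polyMul_monomial 0 c A.1) m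
      simpa using this
    rw [e, subst_smul, shiftedPoly, MvPolynomial.eval₂_C]
  | add f g hf hg =>
    have e : (⟨polyMul (f + g) A.1, polyMul_mem _ A.2⟩ : lowerTruncated 2 W) =
        ⟨polyMul f A.1, polyMul_mem _ A.2⟩ + ⟨polyMul g A.1, polyMul_mem _ A.2⟩ :=
      Subtype.ext (polyMul_add_left f g A.1)
    rw [e, subst_add, hf, hg, ← add_smul, shiftedPoly, shiftedPoly, shiftedPoly,
      MvPolynomial.eval₂_add]
  | mul_X f i hf =>
    have e : (⟨polyMul (f * MvPolynomial.X i) A.1, polyMul_mem _ A.2⟩ : lowerTruncated 2 W) =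
        ⟨polyMul f (polyMul (MvPolynomial.X i) A.1), polyMul_mem _ (polyMul_mem _ A.2)⟩ :=
      Subtype.ext (polyMul_mul f _ A.1)
    have hX : subst α ⟨polyMul (MvPolynomial.X i) A.1, polyMul_mem _ A.2⟩ =
        shiftedPoly α (MvPolynomial.X i) • subst α A := by
      rw [shiftedPoly, MvPolynomial.eval₂_X]
      fin_cases i
      · refine subst_X_zero α A _ fun m n => ?_
        have := congrFun (polyMul_monomial (Finsupp.single 0 1) 1 A.1) ![m, n]
        refine this.trans ?_
        rw [one_smul]
        refine congrArg A.1 ?_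
        funext i; fin_cases i <;> simp
      · refine subst_X_one α A _ fun m n => ?_
        have := congrFun (polyMul_monomial (Finsupp.single 1 1) 1 A.1) ![m, n]
        refine this.trans ?_
        rw [one_smul]
        refine congrArg A.1 ?_
        funext i; fin_cases i <;> simp
    rw [e, hf ⟨_, polyMul_mem _ A.2⟩, hX, smul_smul]
    simp only [shiftedPoly]
    rw [MvPolynomial.eval₂_mul]

/-- `vertexSeries` does not depend on the choice of the polynomial. -/
theorem vertexSeries_eq (α : ℂˣ) {p q : MvPolynomial (Fin 2) ℂ} {a b : calE W}
    (hp : IsAnnihilator p a b) (hq : IsAnnihilator q a b) (w : W) :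
    vertexSeries α hp w = vertexSeries α hq w := by
  have h1 := subst_polyMul α q ⟨_, hp.mem w⟩
  have h2 := subst_polyMul α p ⟨_, hq.mem w⟩
  have e : polyMul q (polyMul p (fieldProduct ![a, b] w)) =
      polyMul p (polyMul q (fieldProduct ![a, b] w)) := by
    rw [← polyMul_mul, ← polyMul_mul, mul_comm]
  have h3 : shiftedPoly α q • subst α ⟨_, hp.mem w⟩ =
      shiftedPoly α p • subst α ⟨_, hq.mem w⟩ := by
    rw [← h1, ← h2]
    exact congrArg (subst α) (Subtype.ext e)
  have hp0 := shiftedPoly_ne_zero α hp.ne_zero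
  have hq0 := shiftedPoly_ne_zero α hq.ne_zero
  unfold vertexSeries
  rw [inv_smul_eq_iff₀ hp0, smul_comm, ← h3, inv_smul_smul₀ hq0]

/-- The coefficient of `x_0 ^ j` in `vertexSeries`, as an element of `Hom(W, W((x)))`. -/
def vertexCoeff (α : ℂˣ) {p : MvPolynomial (Fin 2) ℂ} {a b : calE W}
    (hp : IsAnnihilator p a b) (j : ℤ) : calE W where
  toFun w := (HahnModule.of ℂ).symm
    (((HahnModule.of (LaurentSeries ℂ)).symm (vertexSeries α hp w)).coeff j)
  map_add' v w := by rw [vertexSeries_add]; rfl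
  map_smul' c w := by
    ext k
    rw [vertexSeries_smul]
    exact coeff_C_smul c _ j k

open Classical in
/-- `Y_ℰ^{(α)}(a(x), x_0) b(x)` for a quasi compatible pair `(a, b)`: the value at `j` is the
coefficient of `x_0 ^ j`. The polynomial `p` in the definition is any admissible one; the partial
operation is extended by `0` to the other pairs. -/
def YE (α : ℂˣ) (a b : calE W) : ℤ → calE W :=
  if h : ∃ p, IsAnnihilator p a b then vertexCoeff α h.choose_spec else 0

/-- `YE` can be computed with any admissible polynomial. -/
theorem YE_eq (α : ℂˣ) {p : MvPolynomial (Fin 2) ℂ} {a b : calE W} (hp : IsAnnihilator p a b) :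
    YE α a b = vertexCoeff α hp := by
  have h : ∃ p, IsAnnihilator p a b := ⟨p, hp⟩
  rw [YE, dif_pos h]
  funext j
  ext w : 1
  change (HahnModule.of ℂ).symm (((HahnModule.of (LaurentSeries ℂ)).symm
    (vertexSeries α h.choose_spec w)).coeff j) = _
  rw [vertexSeries_eq α h.choose_spec hp w]
  rfl

/-- `a(x)_{(α, n)} b(x)`, the coefficient of `x_0 ^ (-n-1)` in `Y_ℰ^{(α)}(a(x), x_0) b(x)`. -/
def nthProduct (α : ℂˣ) (a : calE W) (n : ℤ) (b : calE W) : calE W := YE α a b (-n - 1)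

/-- A closed quasi compatible subspace: `a(x)_n b(x) = a(x)_{(1, n)} b(x)` stays in `U`. -/
def IsClosedQuasiCompatible (U : Submodule ℂ (calE W)) : Prop :=
  QuasiCompatible (U : Set (calE W)) ∧ ∀ a ∈ U, ∀ b ∈ U, ∀ n : ℤ, nthProduct 1 a n b ∈ U

/-- `R_Γ(S)`. -/
def rescaleSet (Γ : Subgroup ℂˣ) (S : Set (calE W)) : Set (calE W) :=
  {c | ∃ α ∈ Γ, ∃ a ∈ S, c = rescale α a}

/-- `a^{(1)}(x)_{n_1} ⋯ a^{(r)}(x)_{n_r} 1_W` for the list of the pairs `(a^{(i)}, n_i)`,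
associated to the right. -/
def iteratedProduct (L : List (calE W × ℤ)) : calE W :=
  L.foldr (fun an b => nthProduct 1 an.1 an.2 b) (idField W)

/-- `V` is the smallest closed quasi compatible subspace which contains `S ∪ {1_W}` and which is
stable under `R_α` for `α ∈ Γ`, i.e. `V = ⟨S⟩_Γ`. -/
def IsGeneratedBy (S : Set (calE W)) (Γ : Subgroup ℂˣ) (V : Submodule ℂ (calE W)) : Prop :=
  IsLeast {U : Submodule ℂ (calE W) | IsClosedQuasiCompatible U ∧
    S ∪ {idField W} ⊆ (U : Set (calE W)) ∧ ∀ α ∈ Γ, ∀ a ∈ U, rescale α a ∈ U} V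

end Substitution

section VertexAlgebra

/-- `a(x_0 + x_2) b(x_2) w` as a formal series in `x_0, x_2` (the variables `0, 1`), where
powers of `x_0 + x_2` are expanded in nonnegative powers of `x_2`. -/
def shiftedProduct {W : Type*} [AddCommGroup W] [Module ℂ W] (a b : calE W) (w : W) :
    FormalSeries 2 W :=
  fun m => ∑ᶠ i : ℕ, (Ring.choose (m 0 + i) i : ℤ) •
    coeffOp a (m 0 + i) (coeffOp b (m 1 - i) w)

/-- `Y_W(Y(u, x_0) v, x_2) w` as a formal series in `x_0, x_2` (the variables `0, 1`). -/
def iterateSeries {V W : Type*} [AddCommGroup V] [Module ℂ V] [AddCommGroup W] [Module ℂ W]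
    (Y : V →ₗ[ℂ] calE V) (YW : V →ₗ[ℂ] calE W) (u v : V) (w : W) : FormalSeries 2 W :=
  fun m => coeffOp (YW (coeffOp (Y u) (m 0) v)) (m 1) w

/-- Nonlocal vertex algebras `(V, Y, 𝟏)`; the coefficient of `x ^ (-n-1)` in `Y(v, x)` is `v_n`. -/
structure IsNonlocalVertexAlgebra {V : Type*} [AddCommGroup V] [Module ℂ V]
    (Y : V →ₗ[ℂ] calE V) (vac : V) : Prop where
  vacuum : Y vac = idField V
  creation_regular : ∀ (v : V) (k : ℤ), k < 0 → (Y v vac).coeff k = 0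
  creation_limit : ∀ v : V, (Y v vac).coeff 0 = v
  weak_assoc : ∀ u v w : V, ∃ l : ℕ,
    polyMul ((MvPolynomial.X 0 + MvPolynomial.X 1) ^ l) (shiftedProduct (Y u) (Y v) w) =
      polyMul ((MvPolynomial.X 0 + MvPolynomial.X 1) ^ l) (iterateSeries Y Y u v w)

/-- Quasi modules `(W, Y_W)` for a nonlocal vertex algebra `(V, Y, 𝟏)`. -/
structure IsQuasiModule {V W : Type*} [AddCommGroup V] [Module ℂ V] [AddCommGroup W] [Module ℂ W]
    (Y : V →ₗ[ℂ] calE V) (vac : V) (YW : V →ₗ[ℂ] calE W) : Prop where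
  vacuum : YW vac = idField W
  quasi_assoc : ∀ (u v : V) (w : W), ∃ f : MvPolynomial (Fin 2) ℂ, f ≠ 0 ∧
    polyMul (MvPolynomial.aeval ![MvPolynomial.X 0 + MvPolynomial.X 1, MvPolynomial.X 1] f)
        (shiftedProduct (YW u) (YW v) w) =
      polyMul (MvPolynomial.aeval ![MvPolynomial.X 0 + MvPolynomial.X 1, MvPolynomial.X 1] f)
        (iterateSeries Y YW u v w)

end VertexAlgebra

end

end FormalCalculus

open FormalCalculus

/-! A product of fields is an element of W((x_1,…,x_r)) only after multiplication by a nonzero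
polynomial. Identities are therefore proved for the multiplied series, and the polynomial is
cancelled afterwards. Cancellation is allowed in W((x_r))⋯((x_1)), where exponents are bounded below
in a fixed order of the variables: a nonzero series there has a lexicographically least exponent,
and least terms multiply without cancellation (`LexBdd.eq_zero_of_polyMul`). This gives a
division-free description of Y_ℰ^{(α)}(a,x_0)b as the unique B(x_0,x) with p(x_0+αx,x) B = (p a
b)(αx+x_0,x) (`QuasiSubst`, `YE_unique`). Bilinearity, the vacuum properties and the formulas for
R_α follow by exhibiting such a B.

Existence of ⟨S⟩ needs a single closed quasi compatible space that contains S and 1_W and is stable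
under rescaling; the intersection of all such spaces is then the least one. The space consists of
the fields that can be adjoined to every quasi compatible set containing S. It is closed under all
the operations because each result of an operation can itself be adjoined. The hard case is a
coefficient of Y_ℰ(a,x_0)b (`quasiCompatibleSeq_YE`). There ∏p(x_i,x_j), after the substitution, is
x_0^l e, and modulo high powers of x_0 the factor e may be replaced by its value at x_0 = 0, which
is again of the admissible form.

For weak associativity, both nested expressions are substitutions into p(x_1,y)p(x_1,x)p(y,x)
a(x_1)b(y)c(x), along x_1 = y+x_0, y = x+x_2 (`substAt_comp`). The polynomial becomes G x_0^l x_2^l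
(x_0+x_2)^l with G nonzero at x_0 = x_2 = 0. The two sides are bounded below for different orders of
the variables, yet G cancels because the products have no negative powers of x_0. The monomials are
invertible, and (x_0+x_2)^l remains.

The spanning statement follows from weak associativity modulo a subspace. If the coefficients of
Y(a,x_0)Y(b,x_2)c lie in U, then (x_0+x_2)^l annihilates Y(Y(a,x_0)b,x_2)c modulo U, so that series
vanishes modulo U (`YE_YE_mem`). Induction on the length of the left factor shows that the span is
closed. -/

namespace FormalCalculus

noncomputable section

open MvPolynomial

set_option linter.unusedSectionVars false

/-! ### Multiplication of formal series by polynomials. -/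

section PolyMul

variable {W W' : Type*} [AddCommGroup W] [Module ℂ W] [AddCommGroup W'] [Module ℂ W'] {r s : ℕ}

theorem polyMul_C (c : ℂ) (A : FormalSeries r W) : polyMul (C c) A = c • A := by
  funext m
  have := congrFun (polyMul_monomial 0 c A) m
  simpa using this

theorem polyMul_one (A : FormalSeries r W) : polyMul 1 A = A := by
  rw [← C_1, polyMul_C, one_smul]

theorem polyMul_X_pow (i : Fin r) (l : ℕ) (A : FormalSeries r W) :
    polyMul (X i ^ l) A = fun m => A (m - Pi.single i (l : ℤ)) := by
  rw [X_pow_eq_monomial, polyMul_monomial]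
  funext m
  rw [one_smul]
  congr 1
  funext j
  rcases eq_or_ne j i with rfl | h
  · simp
  · simp [Finsupp.single_eq_of_ne h, Pi.single_eq_of_ne h]

theorem polyMul_X (i : Fin r) (A : FormalSeries r W) :
    polyMul (X i) A = fun m => A (m - Pi.single i 1) := by
  simpa using polyMul_X_pow i 1 A

/-- Multiplication by a polynomial as a linear map. -/
@[simps]
def polyMulHom (f : MvPolynomial (Fin r) ℂ) : FormalSeries r W →ₗ[ℂ] FormalSeries r W where
  toFun := polyMul f
  map_add' := polyMul_add f
  map_smul' := polyMul_smul f

theorem polyMul_zero (f : MvPolynomial (Fin r) ℂ) : polyMul f (0 : FormalSeries r W) = 0 :=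
  (polyMulHom f).map_zero

theorem polyMul_sub (f : MvPolynomial (Fin r) ℂ) (A B : FormalSeries r W) :
    polyMul f (A - B) = polyMul f A - polyMul f B :=
  (polyMulHom f).map_sub A B

theorem polyMul_map (f : MvPolynomial (Fin r) ℂ) (φ : W →ₗ[ℂ] W') (A : FormalSeries r W) :
    polyMul f (fun m => φ (A m)) = fun m => φ (polyMul f A m) := by
  funext m; simp [polyMul]

theorem exists_of_polyMul_ne_zero {f : MvPolynomial (Fin r) ℂ} {A : FormalSeries r W}
    {m : Fin r → ℤ} (h : polyMul f A m ≠ 0) : ∃ d ∈ f.support, A (fun i => m i - d i) ≠ 0 := by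
  obtain ⟨d, hd, h⟩ := Finset.exists_ne_zero_of_sum_ne_zero h
  exact ⟨d, hd, fun h0 => h (by rw [h0, smul_zero])⟩

/-- Multiplication by a polynomial in some of the variables, the other exponents being fixed. -/
theorem polyMul_rename {e : Fin s → Fin r} (he : Function.Injective e)
    (f : MvPolynomial (Fin s) ℂ) (A : FormalSeries r W) (m : Fin r → ℤ) :
    polyMul (rename e f) A m =
      polyMul f (fun u => A (Function.extend e u m)) (m ∘ e) := by
  induction f using MvPolynomial.induction_on' with
  | monomial d c =>
    rw [rename_monomial, polyMul_monomial, polyMul_monomial]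
    change c • A _ = c • A _
    congr 2
    funext j
    by_cases hj : ∃ i, e i = j
    · obtain ⟨i, rfl⟩ := hj
      rw [he.extend_apply, Finsupp.mapDomain_apply he, Function.comp_apply]
    · rw [Function.extend_apply' _ _ _ hj, Finsupp.mapDomain_of_notMem_range _ _ hj]
      simp
  | add f g hf hg => simp only [map_add, polyMul_add_left, Pi.add_apply, hf, hg]

end PolyMul

/-! ### Iterated Laurent series and cancellation of polynomials. -/

section LexBdd

variable {W W' : Type*} [AddCommGroup W] [Module ℂ W] [AddCommGroup W'] [Module ℂ W'] {r : ℕ}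

/-- For fixed exponents of the earlier variables, the exponents of each variable are bounded
below: the elements of `W((x_r))⋯((x_1))`. -/
def LexBdd (A : FormalSeries r W) : Prop :=
  ∀ (s : Fin r) (m : Fin r → ℤ), ∃ N : ℤ, ∀ m', A m' ≠ 0 → (∀ t < s, m' t = m t) → N ≤ m' s

theorem LexBdd.mono {A : FormalSeries r W} {B : FormalSeries r W'} (hA : LexBdd A)
    (h : ∀ m, B m ≠ 0 → A m ≠ 0) : LexBdd B := fun s m =>
  let ⟨N, hN⟩ := hA s m
  ⟨N, fun m' hm' => hN m' (h m' hm')⟩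

theorem LexBdd.add {A B : FormalSeries r W} (hA : LexBdd A) (hB : LexBdd B) :
    LexBdd (A + B) := fun s m => by
  obtain ⟨N, hN⟩ := hA s m
  obtain ⟨M, hM⟩ := hB s m
  refine ⟨min N M, fun m' h ht => ?_⟩
  by_cases hA0 : A m' = 0
  · have hB0 : B m' ≠ 0 := fun hB0 => h (by simp [hA0, hB0])
    exact (min_le_right _ _).trans (hM m' hB0 ht)
  · exact (min_le_left _ _).trans (hN m' hA0 ht)

theorem LexBdd.sub {A B : FormalSeries r W} (hA : LexBdd A) (hB : LexBdd B) :
    LexBdd (A - B) := by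
  rw [sub_eq_add_neg]
  exact hA.add (hB.mono fun m h => by simpa using h)

theorem LexBdd.polyMul_left {A : FormalSeries r W} (hA : LexBdd A) (f : MvPolynomial (Fin r) ℂ) :
    LexBdd (polyMul f A) := by
  induction f using MvPolynomial.induction_on' with
  | monomial d c =>
    rw [polyMul_monomial]
    intro s m
    obtain ⟨N, hN⟩ := hA s (fun i => m i - d i)
    refine ⟨N, fun m' h ht => ?_⟩
    have := hN (fun i => m' i - d i) (fun h0 => h (by simp only [h0, smul_zero]))
      (fun t hts => by rw [ht t hts])
    lia
  | add f g hf hg =>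
    rw [polyMul_add_left]
    exact hf.add hg

/-- The lexicographic order on ℤ^r is not well-founded, but `LexBdd` bounds exactly what is
minimised: first the exponent of the first variable, then that of the next one with the earlier
exponents fixed, and so on. -/
theorem LexBdd.exists_min {A : FormalSeries r W} (hA : LexBdd A) (h0 : A ≠ 0) :
    ∃ m, A m ≠ 0 ∧ ∀ m', A m' ≠ 0 → toLex m ≤ toLex m' := by
  induction r with
  | zero =>
    obtain ⟨m, hm⟩ := Function.ne_iff.1 h0
    exact ⟨m, hm, fun m' _ => (congrArg toLex (Subsingleton.elim m m')).le⟩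
  | succ r ih =>
    obtain ⟨m, hm⟩ := Function.ne_iff.1 h0
    obtain ⟨N, hN⟩ := hA 0 m
    obtain ⟨j, ⟨n, hn, hnj⟩, hj⟩ := Int.exists_least_of_bdd
      (P := fun j => ∃ m', A m' ≠ 0 ∧ m' 0 = j)
      ⟨N, by rintro j ⟨m', hm', rfl⟩; exact hN m' hm' fun t ht => absurd ht (Fin.not_lt_zero t)⟩
      ⟨_, m, hm, rfl⟩
    have hB : LexBdd fun u : Fin r → ℤ => A (Fin.cons j u) := fun s u => by
      obtain ⟨M, hM⟩ := hA s.succ (Fin.cons j u)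
      refine ⟨M, fun u' hu' ht => ?_⟩
      have := hM (Fin.cons j u') hu' fun t hts => by
        induction t using Fin.cases with
        | zero => rfl
        | succ t => simpa using ht t (by simpa using hts)
      simpa using this
    obtain ⟨u, hu, hmin⟩ := ih hB (Function.ne_iff.2 ⟨Fin.tail n, by
      rw [← hnj, Fin.cons_self_tail]; exact hn⟩)
    refine ⟨Fin.cons j u, hu, fun m' hm' => ?_⟩
    by_contra hlt
    obtain ⟨i, hi, hlt⟩ := not_le.1 hlt
    induction i using Fin.cases with
    | zero => exact absurd (hj _ ⟨m', hm', rfl⟩) (not_le.2 (by simpa using hlt))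
    | succ i =>
      have h00 : m' 0 = j := by simpa using hi 0 (Fin.succ_pos i)
      have h1 := hmin (Fin.tail m') (by rw [← h00, Fin.cons_self_tail]; exact hm')
      refine absurd h1 (not_le.2 ⟨i, fun t ht => ?_, ?_⟩)
      · simpa [Fin.tail] using hi t.succ (by simpa using ht)
      · simpa [Fin.tail] using hlt

/-- The lexicographically least exponent of a nonzero polynomial. -/
theorem exists_lexMin_support {f : MvPolynomial (Fin r) ℂ} (hf : f ≠ 0) :
    ∃ d ∈ f.support, ∀ e ∈ f.support,
      toLex (fun i => (d i : ℤ)) ≤ toLex (fun i => (e i : ℤ)) :=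
  f.support.exists_min_image (fun d => toLex (fun i => (d i : ℤ))) (support_nonempty.2 hf)

/-- The lexicographic order is compatible with addition, so d and m give the only contribution at m
+ d. Minimality of m is required only against the exponents that meet f in this coefficient, so that
m may be least in just a part of the support. -/
theorem polyMul_lexMin_ne_zero {f : MvPolynomial (Fin r) ℂ} {d : Fin r →₀ ℕ}
    (hd : d ∈ f.support) (hmin : ∀ e ∈ f.support,
      toLex (fun i => (d i : ℤ)) ≤ toLex (fun i => (e i : ℤ)))
    {A : FormalSeries r W} {m : Fin r → ℤ} (hm : A m ≠ 0)
    (hA : ∀ e ∈ f.support, A (fun i => m i + d i - e i) ≠ 0 →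
      toLex m ≤ toLex (fun i => m i + d i - e i)) :
    polyMul f A (fun i => m i + d i) ≠ 0 := by
  have hs : polyMul f A (fun i => m i + d i) = f.coeff d • A m := by
    refine (Finset.sum_eq_single d (fun e he hed => ?_) fun h => absurd hd h).trans (by simp)
    by_cases h0 : A (fun i => m i + d i - e i) = 0
    · rw [h0, smul_zero]
    exfalso
    have h1 := hA e he h0
    have h2 := hmin e he
    have h3 : toLex m + toLex (fun i => (e i : ℤ)) ≤ toLex m + toLex (fun i => (d i : ℤ)) := by
      have : toLex m + toLex (fun i => (d i : ℤ)) =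
          toLex (fun i => m i + d i - e i) + toLex (fun i => (e i : ℤ)) := by
        rw [← toLex_add, ← toLex_add]
        congr 1
        funext i
        simp
      rw [this]
      exact add_le_add_left h1 _
    have h4 := le_antisymm h2 (le_of_add_le_add_left h3)
    refine hed (Finsupp.ext fun i => ?_)
    have := congrFun (toLex.injective h4) i
    simpa using this.symm
  rw [hs]
  exact smul_ne_zero (mem_support_iff.1 hd) hm

/-- If `f A` vanishes in the directions where it should, then `A` vanishes on a downward closed
set `Z` of exponents. -/
theorem LexBdd.eq_zero_on {f : MvPolynomial (Fin r) ℂ} {A : FormalSeries r W} (hA : LexBdd A)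
    (Z : Set (Fin r → ℤ)) {d : Fin r →₀ ℕ} (hd : d ∈ f.support)
    (hmin : ∀ e ∈ f.support, toLex (fun i => (d i : ℤ)) ≤ toLex (fun i => (e i : ℤ)))
    (hZ : ∀ m ∈ Z, ∀ e : Fin r →₀ ℕ, (fun i => m i + d i - e i) ∈ Z)
    (h : ∀ m ∈ Z, polyMul f A (fun i => m i + d i) = 0) : ∀ m ∈ Z, A m = 0 := by
  classical
  intro m hm
  by_contra h0
  -- The least exponent n of the truncation of A to Z gives the contradiction: by `hZ` all
  -- coefficients of A that enter at n + d are indexed by Z, where A and its truncation agree.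
  have hB : LexBdd (fun m => if m ∈ Z then A m else 0) := hA.mono fun m h => by
    intro h0; simp [h0] at h
  obtain ⟨n, hn, hnmin⟩ := hB.exists_min (Function.ne_iff.2 ⟨m, by simpa [hm] using h0⟩)
  have hnZ : n ∈ Z := by by_contra hc; simp [hc] at hn
  rw [if_pos hnZ] at hn
  refine polyMul_lexMin_ne_zero hd hmin hn (fun e he hne => ?_) (h n hnZ)
  exact hnmin _ (by rw [if_pos (hZ n hnZ e)]; exact hne)

theorem LexBdd.eq_zero_of_polyMul {f : MvPolynomial (Fin r) ℂ} (hf : f ≠ 0)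
    {A : FormalSeries r W} (hA : LexBdd A) (h : polyMul f A = 0) : A = 0 := by
  obtain ⟨d, hd, hmin⟩ := exists_lexMin_support hf
  funext m
  exact hA.eq_zero_on Set.univ hd hmin (fun _ _ _ => trivial) (fun m _ => by rw [h]; rfl) m trivial

theorem LexBdd.polyMul_cancel {f : MvPolynomial (Fin r) ℂ} (hf : f ≠ 0)
    {A B : FormalSeries r W} (hA : LexBdd A) (hB : LexBdd B)
    (h : polyMul f A = polyMul f B) : A = B :=
  sub_eq_zero.1 ((hA.sub hB).eq_zero_of_polyMul hf (by rw [polyMul_sub, h, sub_self]))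

end LexBdd

/-! ### The linear substitutions in polynomials. -/

section Shift

variable {r : ℕ}

/-- The substitution `x_i ↦ x_i + α x_k`. -/
def shiftVar (α : ℂ) (i k : Fin r) : MvPolynomial (Fin r) ℂ →ₐ[ℂ] MvPolynomial (Fin r) ℂ :=
  aeval (Function.update X i (X i + C α * X k))

theorem shiftVar_X_self (α : ℂ) (i k : Fin r) : shiftVar α i k (X i) = X i + C α * X k := by
  simp [shiftVar]

theorem shiftVar_X_of_ne (α : ℂ) {i j : Fin r} (k : Fin r) (h : j ≠ i) :
    shiftVar α i k (X j) = X j := by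
  simp [shiftVar, h]

theorem shiftVar_comp_neg (α : ℂ) {i k : Fin r} (h : k ≠ i) (f : MvPolynomial (Fin r) ℂ) :
    shiftVar (-α) i k (shiftVar α i k f) = f := by
  rw [← AlgHom.comp_apply]
  conv_rhs => rw [← AlgHom.id_apply (R := ℂ) f]
  congr 1
  ext j : 1
  rcases eq_or_ne j i with rfl | hj
  · rw [AlgHom.comp_apply, shiftVar_X_self, map_add, map_mul, shiftVar_X_self,
      shiftVar_X_of_ne _ _ h, ← algebraMap_eq, AlgHom.commutes, algebraMap_eq]
    simp
  · simp [shiftVar_X_of_ne _ _ hj]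

theorem shiftVar_ne_zero (α : ℂ) {i k : Fin r} (h : k ≠ i) {f : MvPolynomial (Fin r) ℂ}
    (hf : f ≠ 0) : shiftVar α i k f ≠ 0 := fun h0 => hf (by
  rw [← shiftVar_comp_neg α h f, h0, map_zero])

theorem exists_mem_support_of_not_X_dvd {i : Fin r} {g : MvPolynomial (Fin r) ℂ}
    (h : ¬ X i ∣ g) : ∃ e ∈ g.support, e i = 0 := by
  by_contra! hcon
  refine h ?_
  rw [g.as_sum]
  exact Finset.dvd_sum fun e he => X_dvd_monomial.2 (Or.inr (hcon e he))

theorem exists_eq_X_pow_mul (i : Fin r) {f : MvPolynomial (Fin r) ℂ} (hf : f ≠ 0) :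
    ∃ (l : ℕ) (g : MvPolynomial (Fin r) ℂ), f = X i ^ l * g ∧ ¬ X i ∣ g := by
  have hfin : FiniteMultiplicity (X i) f := by
    -- The total degree of f bounds the multiplicity of x_i.
    refine ⟨f.totalDegree, fun ⟨g, hg⟩ => ?_⟩
    have hg0 : g ≠ 0 := by rintro rfl; exact hf (by rw [hg, mul_zero])
    have h1 := totalDegree_mul_of_isDomain (pow_ne_zero (f.totalDegree + 1) (X_ne_zero (R := ℂ) i))
      hg0
    rw [← hg, totalDegree_X_pow] at h1
    lia
  obtain ⟨g, hg, hn⟩ := hfin.exists_eq_pow_mul_and_not_dvd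
  exact ⟨_, g, hg, hn⟩

end Shift

/-! ### From the field ℂ((x))((x_0)) to families of coefficients. -/

section Bridge

variable {W W' : Type*} [AddCommGroup W] [Module ℂ W] [AddCommGroup W'] [Module ℂ W']

theorem bddBelow_hahnSeries_support {M : Type*} [Zero M] (f : HahnSeries ℤ M) :
    BddBelow f.support := by
  rcases f.support.eq_empty_or_nonempty with h | h
  · rw [h]; exact bddBelow_empty
  · exact ⟨f.isWF_support.min h, fun k hk => f.isWF_support.min_le h hk⟩

/-- The coefficients of an element of `W((x))((x_0))`; the variables are `x_0, x`. -/
def coeffSeries (F : IteratedLaurent W) : FormalSeries 2 W := fun m => F.coeff (m 0) (m 1)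

theorem coeffSeries_add (F G : IteratedLaurent W) :
    coeffSeries (F + G) = coeffSeries F + coeffSeries G := rfl

/-- The dictionary that allows Hahn series to be left behind: scalars from ℂ((x))((x_0)) that are
polynomials act by `polyMul`. -/
theorem coeffSeries_eval₂_smul (q : MvPolynomial (Fin 2) ℂ) (F : IteratedLaurent W) :
    coeffSeries (eval₂ BiLaurent.C ![BiLaurent.X₀, BiLaurent.X] q • F) =
      polyMul q (coeffSeries F) := by
  induction q using MvPolynomial.induction_on generalizing F with
  | C c =>
    rw [eval₂_C, polyMul_C]
    funext m
    exact coeff_C_smul c F _ _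
  | add f g hf hg => rw [eval₂_add, add_smul, coeffSeries_add, hf, hg, polyMul_add_left]
  | mul_X f i hf =>
    rw [eval₂_mul, mul_smul, hf, polyMul_mul, eval₂_X, polyMul_X]
    congr 1
    funext m
    fin_cases i
    · refine (coeff_X₀_smul F _ _).trans ?_
      simp [coeffSeries]
    · refine (coeff_X_smul F _ _).trans ?_
      simp [coeffSeries]

theorem shiftedPoly_eq_eval₂ (α : ℂˣ) (q : MvPolynomial (Fin 2) ℂ) :
    shiftedPoly α q =
      eval₂ BiLaurent.C ![BiLaurent.X₀, BiLaurent.X] (shiftVar (α : ℂ) 0 1 q) := by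
  change _ = eval₂Hom BiLaurent.C ![BiLaurent.X₀, BiLaurent.X] _
  simp only [shiftVar, aeval_def, hom_eval₂, shiftedPoly]
  congr 1
  · ext c; simp
  · funext i; fin_cases i <;> simp [Function.update]

/-- The coefficients of `A(α x + x_0, x)`; the variables are `x_0, x`. -/
def substFn (α : ℂˣ) (A : FormalSeries 2 W) : FormalSeries 2 W := fun m =>
  if 0 ≤ m 0 then substCoeff α A (m 0).toNat (m 1) else 0

theorem coeffSeries_subst (α : ℂˣ) (A : lowerTruncated 2 W) :
    coeffSeries (subst α A) = substFn α A.1 := by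
  funext m
  exact coeff_subst α A _ _

/-- The exponents of x_0 are bounded below, and then those of x for each fixed exponent of x_0; this
is the order of the two variables. -/
theorem lexBdd_coeffSeries (F : IteratedLaurent W) : LexBdd (coeffSeries F) := by
  intro s m
  fin_cases s
  · obtain ⟨N, hN⟩ := bddBelow_hahnSeries_support ((HahnModule.of (LaurentSeries ℂ)).symm F)
    refine ⟨N, fun m' hm' _ => hN fun h0 => hm' ?_⟩
    change ((HahnModule.of ℂ).symm _).coeff _ = _
    change (((HahnModule.of (LaurentSeries ℂ)).symm F).coeff (m' 0)) = 0 at h0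
    rw [h0]
    rfl
  · obtain ⟨N, hN⟩ := bddBelow_hahnSeries_support ((HahnModule.of ℂ).symm
      (((HahnModule.of (LaurentSeries ℂ)).symm F).coeff (m 0)))
    refine ⟨N, fun m' hm' ht => hN fun h0 => hm' ?_⟩
    have h1 := ht 0 (by simp)
    change ((HahnModule.of ℂ).symm _).coeff _ = _
    rw [h1]
    exact h0

theorem substFn_polyMul (α : ℂˣ) (q : MvPolynomial (Fin 2) ℂ) {A : FormalSeries 2 W}
    (hA : A ∈ lowerTruncated 2 W) :
    substFn α (polyMul q A) = polyMul (shiftVar (α : ℂ) 0 1 q) (substFn α A) := by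
  have h := congrArg coeffSeries (subst_polyMul α q ⟨A, hA⟩)
  rwa [coeffSeries_subst, shiftedPoly_eq_eval₂, coeffSeries_eval₂_smul, coeffSeries_subst] at h

theorem substFn_add (α : ℂˣ) {A B : FormalSeries 2 W} (hA : A ∈ lowerTruncated 2 W)
    (hB : B ∈ lowerTruncated 2 W) : substFn α (A + B) = substFn α A + substFn α B := by
  funext m
  simp only [substFn, Pi.add_apply, substCoeff_add α hA hB]
  split_ifs <;> simp

theorem lexBdd_substFn (α : ℂˣ) {A : FormalSeries 2 W} (hA : A ∈ lowerTruncated 2 W) :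
    LexBdd (substFn α A) := by
  rw [← coeffSeries_subst α ⟨A, hA⟩]
  exact lexBdd_coeffSeries _

theorem map_mem_lowerTruncated {r : ℕ} (φ : W →ₗ[ℂ] W') {A : FormalSeries r W}
    (hA : A ∈ lowerTruncated r W) : (fun m => φ (A m)) ∈ lowerTruncated r W' :=
  let ⟨N, hN⟩ := hA
  ⟨N, fun m hm => hN m fun h0 => hm (by simp only [h0, map_zero])⟩

theorem substFn_map (α : ℂˣ) (φ : W →ₗ[ℂ] W') {A : FormalSeries 2 W}
    (hA : A ∈ lowerTruncated 2 W) :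
    substFn α (fun m => φ (A m)) = fun m => φ (substFn α A m) := by
  funext m
  simp only [substFn]
  split_ifs
  · rw [substCoeff, substCoeff, ← LinearMap.toAddMonoidHom_coe φ,
      AddMonoidHom.map_finsum _ (substCoeff_finite α hA _ _)]
    simp only [LinearMap.toAddMonoidHom_coe, map_smul]
  · simp

end Bridge

/-! ### Substitution up to a polynomial factor. -/

section QuasiSubst

variable {W W' : Type*} [AddCommGroup W] [Module ℂ W] [AddCommGroup W'] [Module ℂ W']

/-- `B(x_0, x)` in `W((x))((x_0))` is the image of `A(x_1, x)` under `x_1 = α x + x_0`, where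
`A(x_1, x)` becomes an element of `W((x_1, x))` after multiplication by a nonzero polynomial. -/
def QuasiSubst (α : ℂˣ) (A B : FormalSeries 2 W) : Prop :=
  ∃ p : MvPolynomial (Fin 2) ℂ, p ≠ 0 ∧ polyMul p A ∈ lowerTruncated 2 W ∧
    polyMul (shiftVar (α : ℂ) 0 1 p) B = substFn α (polyMul p A) ∧ LexBdd B

variable {α : ℂˣ} {A B A' B' : FormalSeries 2 W}

theorem polyMul_comm {r : ℕ} (f g : MvPolynomial (Fin r) ℂ) (A : FormalSeries r W) :
    polyMul f (polyMul g A) = polyMul g (polyMul f A) := by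
  rw [← polyMul_mul, mul_comm, polyMul_mul]

/-- Enlarging a witness by an arbitrary factor lets two relations be compared over a common
polynomial. -/
theorem quasiSubst_witness_mul {p q : MvPolynomial (Fin 2) ℂ}
    (h1 : polyMul p A ∈ lowerTruncated 2 W)
    (h2 : polyMul (shiftVar (α : ℂ) 0 1 p) B = substFn α (polyMul p A)) :
    polyMul (q * p) A ∈ lowerTruncated 2 W ∧
      polyMul (shiftVar (α : ℂ) 0 1 (q * p)) B = substFn α (polyMul (q * p) A) := by
  constructor
  · rw [polyMul_mul]
    exact polyMul_mem q h1
  · rw [map_mul, polyMul_mul, h2, polyMul_mul, substFn_polyMul α q h1]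

theorem QuasiSubst.of_mem (α : ℂˣ) (hA : A ∈ lowerTruncated 2 W) :
    QuasiSubst α A (substFn α A) :=
  ⟨1, one_ne_zero, by rwa [polyMul_one], by rw [map_one, polyMul_one, polyMul_one],
    lexBdd_substFn α hA⟩

theorem QuasiSubst.add (h : QuasiSubst α A B) (h' : QuasiSubst α A' B') :
    QuasiSubst α (A + A') (B + B') := by
  obtain ⟨p, hp, h1, h2, h3⟩ := h
  obtain ⟨p', hp', h1', h2', h3'⟩ := h'
  obtain ⟨h4, h5⟩ := quasiSubst_witness_mul (q := p') h1 h2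
  obtain ⟨h4', h5'⟩ := quasiSubst_witness_mul (q := p) h1' h2'
  rw [mul_comm] at h4' h5'
  refine ⟨p' * p, mul_ne_zero hp' hp, ?_, ?_, h3.add h3'⟩
  · rw [polyMul_add]; exact add_mem h4 h4'
  · rw [polyMul_add, polyMul_add, h5, h5', substFn_add α h4 h4']

theorem QuasiSubst.polyMul (h : QuasiSubst α A B) (q : MvPolynomial (Fin 2) ℂ) :
    QuasiSubst α (polyMul q A) (polyMul (shiftVar (α : ℂ) 0 1 q) B) := by
  obtain ⟨p, hp, h1, h2, h3⟩ := h
  refine ⟨p, hp, ?_, ?_, h3.polyMul_left _⟩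
  · rw [polyMul_comm]; exact polyMul_mem q h1
  · rw [polyMul_comm, h2, polyMul_comm p q, substFn_polyMul α q h1]

theorem QuasiSubst.smul (h : QuasiSubst α A B) (c : ℂ) : QuasiSubst α (c • A) (c • B) := by
  have := h.polyMul (C c)
  rwa [← algebraMap_eq, AlgHom.commutes, algebraMap_eq, polyMul_C, polyMul_C] at this

theorem QuasiSubst.map (h : QuasiSubst α A B) (φ : W →ₗ[ℂ] W') :
    QuasiSubst α (fun m => φ (A m)) (fun m => φ (B m)) := by
  obtain ⟨p, hp, h1, h2, h3⟩ := h
  refine ⟨p, hp, ?_, ?_, h3.mono fun m h h0 => h (by rw [h0, map_zero])⟩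
  · rw [polyMul_map]; exact map_mem_lowerTruncated φ h1
  · rw [polyMul_map, polyMul_map, substFn_map α φ h1, h2]

/-- Over a common witness both series satisfy the same equation, and the shifted witness is nonzero
and can be cancelled. -/
theorem QuasiSubst.unique (h : QuasiSubst α A B) (h' : QuasiSubst α A B') : B = B' := by
  obtain ⟨p, hp, h1, h2, h3⟩ := h
  obtain ⟨p', hp', h1', h2', h3'⟩ := h'
  obtain ⟨h4, h5⟩ := quasiSubst_witness_mul (q := p') h1 h2
  obtain ⟨h4', h5'⟩ := quasiSubst_witness_mul (q := p) h1' h2'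
  rw [mul_comm] at h4' h5'
  exact h3.polyMul_cancel (shiftVar_ne_zero (α : ℂ) (by simp) (mul_ne_zero hp' hp)) h3'
    (h5.trans h5'.symm)

theorem QuasiSubst.eq_substFn (h : QuasiSubst α A B) (hA : A ∈ lowerTruncated 2 W) :
    B = substFn α A :=
  h.unique (.of_mem α hA)

end QuasiSubst

/-! ### Characterization, bilinearity and pole order of Y_ℰ^{(α)}. -/

section YE

variable {W : Type*} [AddCommGroup W] [Module ℂ W] {α : ℂˣ} {a a' b b' : calE W}

theorem coeffOp_add (a b : calE W) (k : ℤ) : coeffOp (a + b) k = coeffOp a k + coeffOp b k := by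
  ext w; simp [coeffOp]

theorem coeffOp_smul (c : ℂ) (a : calE W) (k : ℤ) : coeffOp (c • a) k = c • coeffOp a k := by
  ext w; simp [coeffOp]

theorem coeffOp_zero (k : ℤ) : coeffOp (0 : calE W) k = 0 := by
  ext w; simp [coeffOp]

theorem calE_ext (h : ∀ k w, coeffOp a k w = coeffOp b k w) : a = b := by
  ext w k
  exact h k w

theorem exists_coeffOp_eq_zero (a : calE W) (w : W) : ∃ N : ℤ, ∀ k < N, coeffOp a k w = 0 := by
  obtain ⟨N, hN⟩ := bddBelow_hahnSeries_support (a w)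
  exact ⟨N, fun k hk => by_contra fun h => absurd (hN h) (not_le.2 hk)⟩

theorem fieldProduct_pair (a b : calE W) (w : W) :
    fieldProduct ![a, b] w = fun m => coeffOp a (m 0) (coeffOp b (m 1) w) := by
  funext m
  simp [fieldProduct]

/-- The series `∑ C_j(x) w x_0 ^ j`, where the variables are `x_0, x`. -/
def familySeries (c : ℤ → calE W) (w : W) : FormalSeries 2 W := fun m => coeffOp (c (m 0)) (m 1) w

theorem quasiSubst_YE (α : ℂˣ) (h : ∃ p, IsAnnihilator p a b) (w : W) :
    QuasiSubst α (fieldProduct ![a, b] w) (familySeries (YE α a b) w) := by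
  obtain ⟨p, hp⟩ := h
  have hYE : familySeries (YE α a b) w = coeffSeries (vertexSeries α hp w) := by
    rw [YE_eq α hp]; rfl
  refine ⟨p, hp.ne_zero, hp.mem w, ?_, hYE ▸ lexBdd_coeffSeries _⟩
  rw [hYE, ← coeffSeries_eval₂_smul, ← shiftedPoly_eq_eval₂, vertexSeries,
    smul_inv_smul₀ (shiftedPoly_ne_zero α hp.ne_zero), coeffSeries_subst]

/-- All later computations of Y_ℰ^{(α)} rest on this. The polynomial in `QuasiSubst` may vary with
w, although an annihilator of the pair does not. -/
theorem YE_unique (h : ∃ p, IsAnnihilator p a b) {c : ℤ → calE W}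
    (hc : ∀ w, QuasiSubst α (fieldProduct ![a, b] w) (familySeries c w)) : YE α a b = c := by
  funext j
  refine calE_ext fun k w => ?_
  exact congrFun ((quasiSubst_YE α h w).unique (hc w)) ![j, k]

theorem fieldProduct_pair_add_left (a a' b : calE W) (w : W) :
    fieldProduct ![a + a', b] w = fieldProduct ![a, b] w + fieldProduct ![a', b] w := by
  simp only [fieldProduct_pair]
  funext m
  simp [coeffOp_add]

theorem fieldProduct_pair_add_right (a b b' : calE W) (w : W) :
    fieldProduct ![a, b + b'] w = fieldProduct ![a, b] w + fieldProduct ![a, b'] w := by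
  simp only [fieldProduct_pair]
  funext m
  simp [coeffOp_add]

theorem fieldProduct_pair_smul_left (c : ℂ) (a b : calE W) (w : W) :
    fieldProduct ![c • a, b] w = c • fieldProduct ![a, b] w := by
  simp only [fieldProduct_pair]
  funext m
  simp [coeffOp_smul]

theorem fieldProduct_pair_smul_right (c : ℂ) (a b : calE W) (w : W) :
    fieldProduct ![a, c • b] w = c • fieldProduct ![a, b] w := by
  simp only [fieldProduct_pair]
  funext m
  simp [coeffOp_smul]

theorem familySeries_add (c d : ℤ → calE W) (w : W) :
    familySeries (c + d) w = familySeries c w + familySeries d w := by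
  funext m; simp [familySeries, coeffOp_add]

theorem familySeries_smul (z : ℂ) (c : ℤ → calE W) (w : W) :
    familySeries (z • c) w = z • familySeries c w := by
  funext m; simp [familySeries, coeffOp_smul]

theorem YE_add_left (h : ∃ p, IsAnnihilator p a b) (h' : ∃ p, IsAnnihilator p a' b)
    (h'' : ∃ p, IsAnnihilator p (a + a') b) : YE α (a + a') b = YE α a b + YE α a' b :=
  YE_unique h'' fun w => by
    rw [fieldProduct_pair_add_left, familySeries_add]
    exact (quasiSubst_YE α h w).add (quasiSubst_YE α h' w)

theorem YE_add_right (h : ∃ p, IsAnnihilator p a b) (h' : ∃ p, IsAnnihilator p a b')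
    (h'' : ∃ p, IsAnnihilator p a (b + b')) : YE α a (b + b') = YE α a b + YE α a b' :=
  YE_unique h'' fun w => by
    rw [fieldProduct_pair_add_right, familySeries_add]
    exact (quasiSubst_YE α h w).add (quasiSubst_YE α h' w)

theorem YE_smul_left (c : ℂ) (h : ∃ p, IsAnnihilator p a b)
    (h'' : ∃ p, IsAnnihilator p (c • a) b) : YE α (c • a) b = c • YE α a b :=
  YE_unique h'' fun w => by
    rw [fieldProduct_pair_smul_left, familySeries_smul]
    exact (quasiSubst_YE α h w).smul c

theorem YE_smul_right (c : ℂ) (h : ∃ p, IsAnnihilator p a b)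
    (h'' : ∃ p, IsAnnihilator p a (c • b)) : YE α a (c • b) = c • YE α a b :=
  YE_unique h'' fun w => by
    rw [fieldProduct_pair_smul_right, familySeries_smul]
    exact (quasiSubst_YE α h w).smul c

/-- `Y_ℰ^{(α)}(a(x), x_0) b(x)` involves only finitely many negative powers of `x_0`. -/
theorem exists_YE_eq_zero (α : ℂˣ) (h : ∃ p, IsAnnihilator p a b) :
    ∃ l : ℕ, ∀ j < -(l : ℤ), YE α a b j = 0 := by
  obtain ⟨p, hp⟩ := h
  -- The pole order is the multiplicity of x_0 in p(x_0+αx,x). It depends on p only, so one l serves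
  -- all w.
  obtain ⟨l, g, hg, hn⟩ := exists_eq_X_pow_mul (0 : Fin 2)
    (shiftVar_ne_zero (α : ℂ) (i := 0) (k := 1) (by simp) hp.ne_zero)
  have hg0 : g ≠ 0 := by rintro rfl; exact hn (dvd_zero _)
  obtain ⟨e, he, he0⟩ := exists_mem_support_of_not_X_dvd hn
  obtain ⟨d, hd, hmin⟩ := exists_lexMin_support hg0
  -- Since g has a monomial without x_0, so is its lexicographically least one.
  have hd0 : d 0 = 0 := by
    have := Pi.apply_le_of_toLex (i := 0) (hmin e he) (by simp)
    simpa [he0] using this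
  refine ⟨l, fun j hj => calE_ext fun k w => ?_⟩
  have hB : LexBdd (familySeries (YE α a b) w) := by
    rw [YE_eq α hp]; exact lexBdd_coeffSeries (vertexSeries α hp w)
  -- The witness q supplied for w is traded for the fixed p: both sides are multiplied by the
  -- shifted q, which is then cancelled.
  have hp' : polyMul g (polyMul (X 0 ^ l) (familySeries (YE α a b) w)) =
      substFn α (polyMul p (fieldProduct ![a, b] w)) := by
    rw [← polyMul_mul, mul_comm, ← hg]
    have h' : ∃ p, IsAnnihilator p a b := ⟨p, hp⟩
    obtain ⟨q, hq, h1, h2, h3⟩ := quasiSubst_YE α h' w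
    refine LexBdd.polyMul_cancel (shiftVar_ne_zero (α : ℂ) (i := 0) (k := 1) (by simp) hq)
      (hB.polyMul_left _) (lexBdd_substFn α (hp.mem w)) ?_
    rw [polyMul_comm, h2, ← substFn_polyMul α p h1, ← substFn_polyMul α q (hp.mem w),
      polyMul_comm]
  -- The right side of `hp'` has no negative powers of x_0, and the least monomial of g does not
  -- shift the exponent of x_0. Hence x_0^l Y_ℰ^{(α)}(a,x_0)b has no negative powers either.
  have hz := (hB.polyMul_left (X 0 ^ l)).eq_zero_on {m | m 0 < 0} hd hmin
    (fun m hm e => by simp only [Set.mem_ofPred_eq] at hm ⊢; lia)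
    (fun m hm => by
      rw [hp', substFn, if_neg]
      simp only [Set.mem_ofPred_eq] at hm
      simpa [hd0] using hm)
    ![j + l, k] (by simp; lia)
  rw [polyMul_X_pow] at hz
  simpa [familySeries, coeffOp_zero] using hz

end YE

/-! ### The polynomial multipliers that quasi compatibility permits. -/

section Admissible

variable {r s : ℕ} {p q : MvPolynomial (Fin 2) ℂ} {f g : MvPolynomial (Fin r) ℂ}

theorem pairProduct_mul (p q : MvPolynomial (Fin 2) ℂ) (r : ℕ) :
    pairProduct (p * q) r = pairProduct p r * pairProduct q r := by
  simp [pairProduct, Finset.prod_mul_distrib]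

theorem pairProduct_one (r : ℕ) : pairProduct 1 r = 1 := by
  simp [pairProduct]

/-- The divisors of the polynomials `∏_{i < j} p(x_i, x_j)` with `p ≠ 0`. -/
def Admissible (f : MvPolynomial (Fin r) ℂ) : Prop :=
  ∃ p : MvPolynomial (Fin 2) ℂ, p ≠ 0 ∧ f ∣ pairProduct p r

theorem admissible_pairProduct (hp : p ≠ 0) (r : ℕ) : Admissible (pairProduct p r) :=
  ⟨p, hp, dvd_rfl⟩

theorem admissible_one (r : ℕ) : Admissible (1 : MvPolynomial (Fin r) ℂ) :=
  ⟨1, one_ne_zero, one_dvd _⟩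

theorem Admissible.mul (hf : Admissible f) (hg : Admissible g) : Admissible (f * g) := by
  obtain ⟨p, hp, h⟩ := hf
  obtain ⟨q, hq, h'⟩ := hg
  exact ⟨p * q, mul_ne_zero hp hq, by rw [pairProduct_mul]; exact mul_dvd_mul h h'⟩

theorem Admissible.pow (hf : Admissible f) (n : ℕ) : Admissible (f ^ n) := by
  induction n with
  | zero => rw [pow_zero]; exact admissible_one r
  | succ n ih => rw [pow_succ]; exact ih.mul hf

theorem Admissible.prod {ι : Type*} (t : Finset ι) (F : ι → MvPolynomial (Fin r) ℂ)
    (h : ∀ i ∈ t, Admissible (F i)) : Admissible (∏ i ∈ t, F i) :=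
  Finset.prod_induction F Admissible (fun _ _ => Admissible.mul) (admissible_one r) h

theorem admissible_rename_pair (hp : p ≠ 0) {i j : Fin r} (hij : i ≠ j) :
    Admissible (rename ![i, j] p) := by
  have key : ∀ {p : MvPolynomial (Fin 2) ℂ} {i j : Fin r}, p ≠ 0 → i < j →
      Admissible (rename ![i, j] p) := by
    intro p i j hp h
    refine ⟨p, hp, ?_⟩
    rw [pairProduct, ← Finset.mul_prod_erase _ _
      (Finset.mem_filter.2 ⟨Finset.mem_univ (i, j), h⟩)]
    exact dvd_mul_right _ _
  rcases hij.lt_or_gt with h | h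
  · exact key hp h
  -- For i > j the two arguments of p are exchanged first.
  · have h1 : rename ![i, j] p = rename ![j, i] (rename ![1, 0] p) := by
      rw [rename_rename]
      congr 2
      funext t; fin_cases t <;> rfl
    have hinj : Function.Injective (![1, 0] : Fin 2 → Fin 2) := by decide
    rw [h1]
    exact key ((map_ne_zero_iff _ (rename_injective _ hinj)).2 hp) h

theorem admissible_rename_pairProduct (hp : p ≠ 0) {σ : Fin r → Fin s}
    (hσ : Function.Injective σ) : Admissible (rename σ (pairProduct p r)) := by
  rw [pairProduct, map_prod]
  refine Admissible.prod _ _ fun ij hij => ?_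
  have hlt : ij.1 < ij.2 := (Finset.mem_filter.1 hij).2
  have h1 : rename σ (rename ![ij.1, ij.2] p) = rename ![σ ij.1, σ ij.2] p := by
    rw [rename_rename]
    congr 2
    funext t; fin_cases t <;> rfl
  rw [h1]
  exact admissible_rename_pair hp (hσ.ne hlt.ne)

end Admissible

/-! ### Products of fields and their dependence on one factor. -/

section FieldProduct

variable {W : Type*} [AddCommGroup W] [Module ℂ W]

/-- Truncation survives further multiplication, so any divisor of some ∏p(x_i,x_j) may serve as a
multiplier. Such divisors are closed under products and stable under renumbering the variables. -/
theorem quasiCompatibleSeq_iff {r : ℕ} {ψ : Fin r → calE W} :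
    QuasiCompatibleSeq ψ ↔ ∃ f : MvPolynomial (Fin r) ℂ, Admissible f ∧
      ∀ w : W, polyMul f (fieldProduct ψ w) ∈ lowerTruncated r W := by
  constructor
  · rintro ⟨p, hp, h⟩
    exact ⟨_, admissible_pairProduct hp r, h⟩
  · rintro ⟨f, ⟨p, hp, g, hg⟩, h⟩
    refine ⟨p, hp, fun w => ?_⟩
    rw [hg, mul_comm, polyMul_mul]
    exact polyMul_mem g (h w)

theorem fieldProduct_succ {n : ℕ} (ψ : Fin (n + 1) → calE W) (w : W) (m : Fin (n + 1) → ℤ) :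
    fieldProduct ψ w m =
      coeffOp (ψ 0) (m 0) (fieldProduct (Fin.tail ψ) w (Fin.tail m)) := by
  simp [fieldProduct, List.ofFn_succ, Fin.tail]

theorem fieldProduct_cons {n : ℕ} (a : calE W) (ψ : Fin n → calE W) (w : W) (u : ℤ)
    (m : Fin n → ℤ) :
    fieldProduct (Fin.cons a ψ : Fin (n + 1) → calE W) w (Fin.cons u m : Fin (n + 1) → ℤ) =
      coeffOp a u (fieldProduct ψ w m) := by
  rw [fieldProduct_succ]; rfl

theorem update_succ_eq_cons {β : Type*} {n : ℕ} (f : Fin (n + 1) → β) (k : Fin n) (c : β) :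
    Function.update f k.succ c = Fin.cons (f 0) (Function.update (Fin.tail f) k c) := by
  funext t
  induction t using Fin.cases with
  | zero => exact Function.update_of_ne (Fin.succ_ne_zero k).symm _ _
  | succ t =>
    rcases eq_or_ne t k with rfl | h
    · simp
    · simp [h, Fin.tail]

/-- The dependence of `ψ_1(x_1) ⋯ ψ_r(x_r) w` on one of its factors. -/
theorem exists_fieldProduct_eq {n : ℕ} (ψ : Fin (n + 1) → calE W) (w : W) (k : Fin (n + 1))
    (m : Fin (n + 1) → ℤ) : ∃ (φ : W →ₗ[ℂ] W) (v : W),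
      (∀ c u, fieldProduct (Function.update ψ k c) w (Function.update m k u) =
        φ (coeffOp c u v)) ∧
      (∀ a b u u', fieldProduct (Fin.insertNth k.castSucc a (Function.update ψ k b) :
          Fin (n + 2) → calE W) w (Fin.insertNth k.castSucc u (Function.update m k u')) =
        φ (coeffOp a u (coeffOp b u' v))) ∧
      fieldProduct (k.removeNth ψ) w (k.removeNth m) = φ v := by
  -- φ is the product of the coefficients of the fields before place k, and v is the product of
  -- those after k, applied to w.
  induction n with
  | zero =>
    obtain rfl : k = 0 := Fin.fin_one_eq_zero k
    refine ⟨LinearMap.id, fieldProduct (Fin.tail ψ) w (Fin.tail m), fun c u => ?_,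
      fun a b u u' => ?_, rfl⟩
    · rw [fieldProduct_succ, Fin.tail_update_zero, Fin.tail_update_zero]; simp
    · rw [Fin.castSucc_zero, Fin.insertNth_zero', Fin.insertNth_zero', fieldProduct_cons,
        fieldProduct_succ, Fin.tail_update_zero, Fin.tail_update_zero]; simp
  | succ n ih =>
    induction k using Fin.cases with
    | zero =>
      refine ⟨LinearMap.id, fieldProduct (Fin.tail ψ) w (Fin.tail m), fun c u => ?_,
        fun a b u u' => ?_, rfl⟩
      · rw [fieldProduct_succ, Fin.tail_update_zero, Fin.tail_update_zero]; simp
      · rw [Fin.castSucc_zero, Fin.insertNth_zero', Fin.insertNth_zero', fieldProduct_cons,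
          fieldProduct_succ, Fin.tail_update_zero, Fin.tail_update_zero]; simp
    | succ k =>
      obtain ⟨φ, v, h1, h2, h3⟩ := ih (Fin.tail ψ) k (Fin.tail m)
      refine ⟨coeffOp (ψ 0) (m 0) * φ, v, fun c u => ?_, fun a b u u' => ?_, ?_⟩
      · rw [update_succ_eq_cons, update_succ_eq_cons, fieldProduct_cons, h1]; rfl
      · rw [update_succ_eq_cons, update_succ_eq_cons, ← Fin.succ_castSucc, Fin.insertNth_succ_cons, Fin.insertNth_succ_cons,
          fieldProduct_cons, h2]; rfl
      · rw [fieldProduct_succ]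
        refine congrArg (coeffOp (ψ 0) (m 0)) ?_
        rw [← h3]
        congr 1 <;> exact funext fun t => by simp [Fin.tail, Fin.removeNth, Fin.succ_succAbove_succ]

theorem fieldProduct_update_add {n : ℕ} (ψ : Fin n → calE W) (k : Fin n) (a b : calE W)
    (w : W) : fieldProduct (Function.update ψ k (a + b)) w =
      fieldProduct (Function.update ψ k a) w + fieldProduct (Function.update ψ k b) w := by
  obtain _ | n := n
  · exact k.elim0
  funext m
  obtain ⟨φ, v, h, -, -⟩ := exists_fieldProduct_eq ψ w k m
  have h' := fun c => h c (m k)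
  rw [Function.update_eq_self] at h'
  simp [h', coeffOp_add]

theorem fieldProduct_update_smul {n : ℕ} (ψ : Fin n → calE W) (k : Fin n) (z : ℂ) (a : calE W)
    (w : W) : fieldProduct (Function.update ψ k (z • a)) w =
      z • fieldProduct (Function.update ψ k a) w := by
  obtain _ | n := n
  · exact k.elim0
  funext m
  obtain ⟨φ, v, h, -, -⟩ := exists_fieldProduct_eq ψ w k m
  have h' := fun c => h c (m k)
  rw [Function.update_eq_self] at h'
  simp [h', coeffOp_smul]

theorem coeffOp_idField (k : ℤ) (w : W) :
    coeffOp (idField W) k w = if k = 0 then w else 0 := by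
  change (HahnSeries.single (0 : ℤ) w).coeff k = _
  split_ifs with h
  · rw [h, HahnSeries.coeff_single_same]
  · rw [HahnSeries.coeff_single_of_ne h]

end FieldProduct

/-! ### Substitution in two of several variables. -/

section SubstRel

variable {W : Type*} [AddCommGroup W] [Module ℂ W] {r : ℕ}

/-- The series in `x_i, x_k` which results from fixing the exponents of the other variables. -/
def line (i k : Fin r) (n : Fin r → ℤ) (A : FormalSeries r W) : FormalSeries 2 W := fun u =>
  A (Function.update (Function.update n i (u 0)) k (u 1))

/-- `B` results from `A` by the substitution `x_i ↦ x_i + x_k`, expanded in nonnegative powers of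
`x_i`, the other variables being parameters. -/
def SubstRel (i k : Fin r) (A B : FormalSeries r W) : Prop :=
  ∀ n, QuasiSubst 1 (line i k n A) (line i k n B)

/-- The substitution `x_i ↦ x_i + x_k`, expanded in nonnegative powers of `x_i`. -/
def substAt (i k : Fin r) (A : FormalSeries r W) : FormalSeries r W := fun n =>
  substFn 1 (line i k n A) ![n i, n k]

variable {i k : Fin r} {A B A' B' : FormalSeries r W}

theorem line_apply_self (A : FormalSeries r W) (n : Fin r → ℤ) :
    line i k n A ![n i, n k] = A n := by
  simp [line]

theorem SubstRel.eq_substAt (h : SubstRel i k A B)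
    (hA : ∀ n, line i k n A ∈ lowerTruncated 2 W) : B = substAt i k A := by
  funext n
  rw [substAt, ← (h n).eq_substFn (hA n), line_apply_self]

theorem line_mem_lowerTruncated (hik : i ≠ k) (hA : A ∈ lowerTruncated r W) (n : Fin r → ℤ) :
    line i k n A ∈ lowerTruncated 2 W := by
  obtain ⟨N, hN⟩ := hA
  refine ⟨N, fun u hu j => ?_⟩
  have h := hN _ hu
  fin_cases j
  · simpa [hik] using h i
  · simpa using h k

theorem line_polyMul_X_left (hik : i ≠ k) (A : FormalSeries r W) (n : Fin r → ℤ) :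
    line i k n (polyMul (X i) A) = polyMul (X 0) (line i k n A) := by
  rw [polyMul_X, polyMul_X]
  funext u
  simp only [line]
  congr 1
  funext j
  rcases eq_or_ne j k with rfl | hk
  · simp [hik.symm]
  rcases eq_or_ne j i with rfl | hi
  · simp [hk]
  · simp [hk, hi]

theorem line_polyMul_X_right (hik : i ≠ k) (A : FormalSeries r W) (n : Fin r → ℤ) :
    line i k n (polyMul (X k) A) = polyMul (X 1) (line i k n A) := by
  rw [polyMul_X, polyMul_X]
  funext u
  simp only [line]
  congr 1
  funext j
  rcases eq_or_ne j k with rfl | hk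
  · simp
  rcases eq_or_ne j i with rfl | hi
  · simp [hk]
  · simp [hk, hi]

theorem line_polyMul_X_of_ne {j : Fin r} (hji : j ≠ i) (hjk : j ≠ k) (A : FormalSeries r W)
    (n : Fin r → ℤ) :
    line i k n (polyMul (X j) A) = line i k (n - Pi.single j 1) A := by
  rw [polyMul_X]
  funext u
  simp only [line]
  congr 1
  funext t
  rcases eq_or_ne t k with rfl | hk
  · simp [hjk.symm]
  rcases eq_or_ne t i with rfl | hi
  · simp [hk, hji.symm]
  · simp [hk, hi]

theorem SubstRel.add (h : SubstRel i k A B) (h' : SubstRel i k A' B') :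
    SubstRel i k (A + A') (B + B') := fun n => (h n).add (h' n)

/-- Multiplication by x_i or x_k acts within one line, and multiplication by another variable passes
to a neighbouring line. This is why the relation is imposed on all lines at once. -/
theorem SubstRel.polyMul (hik : i ≠ k) (h : SubstRel i k A B) (f : MvPolynomial (Fin r) ℂ) :
    SubstRel i k (polyMul f A) (polyMul (shiftVar 1 i k f) B) := by
  induction f using MvPolynomial.induction_on generalizing A B with
  | C c =>
    rw [← algebraMap_eq, AlgHom.commutes, algebraMap_eq, polyMul_C, polyMul_C]
    exact fun n => (h n).smul c
  | add f g hf hg =>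
    rw [map_add, polyMul_add_left, polyMul_add_left]
    exact (hf h).add (hg h)
  | mul_X f j hf =>
    rw [map_mul, polyMul_mul, polyMul_mul]
    refine hf fun n => ?_
    rcases eq_or_ne j i with rfl | hji
    · rw [shiftVar_X_self, line_polyMul_X_left hik]
      have h1 := (h n).polyMul (X 0)
      have h2 : line j k n (FormalCalculus.polyMul (X j + C 1 * X k) B) =
          FormalCalculus.polyMul (shiftVar ((1 : ℂˣ) : ℂ) 0 1 (X 0)) (line j k n B) := by
        rw [shiftVar_X_self, Units.val_one, C_1, C_1, one_mul, one_mul, polyMul_add_left,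
          polyMul_add_left, ← line_polyMul_X_left hik, ← line_polyMul_X_right hik]
        rfl
      rwa [h2]
    · rw [shiftVar_X_of_ne _ _ hji]
      rcases eq_or_ne j k with rfl | hjk
      · rw [line_polyMul_X_right hik, line_polyMul_X_right hik]
        have h1 := (h n).polyMul (X 1)
        rwa [shiftVar_X_of_ne _ _ (by simp)] at h1
      · rw [line_polyMul_X_of_ne hji hjk, line_polyMul_X_of_ne hji hjk]
        exact h _

/-- The substitution is homogeneous and creates only nonnegative powers of the new variable; every
bound on supports below comes from these two facts. -/
theorem exists_of_substFn_ne_zero {α : ℂˣ} {A : FormalSeries 2 W} {m : Fin 2 → ℤ}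
    (h : substFn α A m ≠ 0) : 0 ≤ m 0 ∧ ∃ s, A ![s, m 1 + m 0 - s] ≠ 0 := by
  simp only [substFn] at h
  split_ifs at h with h0
  · refine ⟨h0, ?_⟩
    by_contra! hcon
    refine h (finsum_eq_zero_of_forall_eq_zero fun s => ?_)
    rw [Int.toNat_of_nonneg h0, hcon, smul_zero]
  · exact absurd rfl h

theorem exists_of_substAt_ne_zero {m : Fin r → ℤ} (h : substAt i k A m ≠ 0) :
    0 ≤ m i ∧ ∃ s, A (Function.update (Function.update m i s) k (m k + m i - s)) ≠ 0 := by
  obtain ⟨h0, s, hs⟩ := exists_of_substFn_ne_zero h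
  exact ⟨by simpa using h0, s, by simpa [line] using hs⟩

end SubstRel

/-! ### Setting a variable to zero, and leading coefficients of shifted polynomials. -/

section Specialize

variable {n : ℕ}

/-- The substitution `x_i ↦ 0`. -/
def specialize (i : Fin (n + 1)) : MvPolynomial (Fin (n + 1)) ℂ →ₐ[ℂ] MvPolynomial (Fin n) ℂ :=
  aeval (Fin.insertNth i 0 X : Fin (n + 1) → MvPolynomial (Fin n) ℂ)

theorem specialize_X_self (i : Fin (n + 1)) : specialize i (X i) = 0 := by
  simp [specialize]

theorem specialize_X_succAbove (i : Fin (n + 1)) (t : Fin n) :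
    specialize i (X (i.succAbove t)) = X t := by
  simp [specialize]

theorem X_dvd_sub_specialize (i : Fin (n + 1)) (f : MvPolynomial (Fin (n + 1)) ℂ) :
    X i ∣ f - rename i.succAbove (specialize i f) := by
  induction f using MvPolynomial.induction_on with
  | C c =>
    have : specialize i (C c) = C c := (specialize i).commutes c
    simp [this]
  | add f g hf hg =>
    rw [map_add, map_add, add_sub_add_comm]
    exact dvd_add hf hg
  | mul_X f j hf =>
    have h : X i ∣ X j - rename i.succAbove (specialize i (X j)) := by
      rcases Fin.eq_self_or_eq_succAbove i j with rfl | ⟨t, rfl⟩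
      · simp [specialize_X_self]
      · simp [specialize_X_succAbove]
    have e : f * X j - rename i.succAbove (specialize i (f * X j)) =
        (f - rename i.succAbove (specialize i f)) * X j +
          rename i.succAbove (specialize i f) *
            (X j - rename i.succAbove (specialize i (X j))) := by
      rw [map_mul, map_mul]; ring
    rw [e]
    exact dvd_add (hf.mul_right _) (h.mul_left _)

theorem specialize_ne_zero {i : Fin (n + 1)} {f : MvPolynomial (Fin (n + 1)) ℂ}
    (h : ¬ X i ∣ f) : specialize i f ≠ 0 := fun h0 => h (by
  simpa [h0] using X_dvd_sub_specialize i f)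

/-- At x_k = 0 the expression x_k + x_{k+1} becomes x_{k+1}: the two variables are identified, and
`predAbove` is the corresponding map of indices. -/
theorem specialize_shiftVar (k : Fin (n + 1)) (f : MvPolynomial (Fin (n + 2)) ℂ) :
    specialize k.castSucc (shiftVar 1 k.castSucc k.succ f) = rename k.predAbove f := by
  rw [← AlgHom.comp_apply]
  congr 1
  ext j : 1
  rw [AlgHom.comp_apply, rename_X]
  rcases Fin.eq_self_or_eq_succAbove k.castSucc j with rfl | ⟨t, rfl⟩
  · rw [shiftVar_X_self, C_1, one_mul, map_add, specialize_X_self, zero_add,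
      ← Fin.succAbove_castSucc_self, specialize_X_succAbove, Fin.predAbove_castSucc_self]
  · rw [shiftVar_X_of_ne _ _ (Fin.succAbove_ne _ _), specialize_X_succAbove,
      Fin.predAbove_succAbove]

/-- The pair k, k+1 is the only one that is merged, so the other factors p(x_i,x_j) remain
polynomials in two distinct variables. -/
theorem predAbove_ne {k : Fin (n + 1)} {i j : Fin (n + 2)} (hij : i < j)
    (h : (i, j) ≠ (k.castSucc, k.succ)) : k.predAbove i ≠ k.predAbove j := by
  rcases Fin.eq_self_or_eq_succAbove k.castSucc i with rfl | ⟨s, rfl⟩ <;>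
  rcases Fin.eq_self_or_eq_succAbove k.castSucc j with rfl | ⟨t, rfl⟩
  · exact absurd hij (lt_irrefl _)
  · rw [Fin.predAbove_castSucc_self, Fin.predAbove_succAbove]
    rintro rfl
    exact h (by rw [Fin.succAbove_castSucc_self])
  · rw [Fin.predAbove_castSucc_self, Fin.predAbove_succAbove]
    rintro rfl
    rw [Fin.succAbove_castSucc_self] at hij
    exact absurd hij (not_lt.2 (Fin.castSucc_lt_succ).le)
  · rw [Fin.predAbove_succAbove, Fin.predAbove_succAbove]
    rintro rfl
    exact absurd hij (lt_irrefl _)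

/-- The leading coefficient of `∏ p(x_i, x_j)` after the substitution `x_k ↦ x_k + x_{k + 1}` is
admissible. -/
theorem exists_shiftVar_pairProduct_eq {p : MvPolynomial (Fin 2) ℂ} (hp : p ≠ 0)
    (k : Fin (n + 2)) : ∃ (l : ℕ) (e : MvPolynomial (Fin (n + 3)) ℂ),
      shiftVar 1 k.castSucc k.succ (pairProduct p (n + 3)) = X k.castSucc ^ l * e ∧
        Admissible (specialize k.castSucc e) := by
  have hik : k.castSucc ≠ k.succ := (Fin.castSucc_lt_succ).ne
  -- Only the factor p(x_k,x_{k+1}) can become divisible by the new x_k, and its power of x_k is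
  -- extracted here.
  obtain ⟨l, g, hg, hn⟩ := exists_eq_X_pow_mul (0 : Fin 2)
    (shiftVar_ne_zero 1 (i := 0) (k := 1) (by simp) hp)
  have hmem : (k.castSucc, k.succ) ∈
      (Finset.univ : Finset (Fin (n + 3) × Fin (n + 3))).filter (fun ij => ij.1 < ij.2) :=
    Finset.mem_filter.2 ⟨Finset.mem_univ _, Fin.castSucc_lt_succ⟩
  have h1 : shiftVar 1 k.castSucc k.succ (rename ![k.castSucc, k.succ] p) =
      rename ![k.castSucc, k.succ] (shiftVar 1 0 1 p) := by
    rw [← AlgHom.comp_apply, ← AlgHom.comp_apply]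
    congr 1
    ext j : 1
    fin_cases j
    · simp [shiftVar]
    · simp [shiftVar, hik.symm]
  refine ⟨l, rename ![k.castSucc, k.succ] g * shiftVar 1 k.castSucc k.succ
    (∏ ij ∈ ((Finset.univ : Finset (Fin (n + 3) × Fin (n + 3))).filter
      (fun ij => ij.1 < ij.2)).erase (k.castSucc, k.succ), rename ![ij.1, ij.2] p), ?_, ?_⟩
  · rw [pairProduct, ← Finset.mul_prod_erase _ _ hmem, map_mul, h1, hg, map_mul, map_pow,
      rename_X, mul_assoc]
    rfl
  · rw [map_mul, specialize_shiftVar, map_prod]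
    refine Admissible.mul ?_ (Admissible.prod _ _ fun ij hij => ?_)
    -- What remains of g is the nonzero one-variable polynomial g(0,x_k). It is read as a polynomial
    -- in x_k and a second variable x_{k'}, which exists because at least two variables are left.
    · obtain ⟨k', hk'⟩ := exists_ne k
      have h2 : specialize k.castSucc (rename ![k.castSucc, k.succ] g) =
          rename ![k, k'] (rename (fun _ : Fin 1 => (0 : Fin 2)) (specialize 0 g)) := by
        rw [rename_rename, ← AlgHom.comp_apply, ← AlgHom.comp_apply]
        congr 1
        ext j : 1
        rw [AlgHom.comp_apply, AlgHom.comp_apply, rename_X]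
        fin_cases j
        · simp [specialize_X_self]
        · have e1 : specialize (0 : Fin 2) (X 1) = X 0 := specialize_X_succAbove 0 0
          have e2 : specialize k.castSucc (X k.succ) = X k := by
            rw [← Fin.succAbove_castSucc_self, specialize_X_succAbove]
          simp [e1, e2]
      rw [h2]
      exact admissible_rename_pair ((map_ne_zero_iff _ (rename_injective _
        (Function.injective_of_subsingleton _))).2 (specialize_ne_zero hn)) hk'.symm
    · obtain ⟨hne, hmem'⟩ := Finset.mem_erase.1 hij
      have hlt := (Finset.mem_filter.1 hmem').2
      have h3 : rename k.predAbove (rename ![ij.1, ij.2] p) =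
          rename ![k.predAbove ij.1, k.predAbove ij.2] p := by
        rw [rename_rename]
        congr 2
        funext t; fin_cases t <;> rfl
      rw [h3]
      exact admissible_rename_pair hp (predAbove_ne hlt hne)

end Specialize

/-! ### Truncation for each coefficient of one variable. -/

section BddBelowUpTo

variable {W : Type*} [AddCommGroup W] [Module ℂ W] {r : ℕ}

/-- All exponents are bounded below as long as the one of `x_i` is bounded above. -/
def BddBelowUpTo (i : Fin r) (A : FormalSeries r W) : Prop :=
  ∀ J : ℤ, ∃ N : ℤ, ∀ m, A m ≠ 0 → m i ≤ J → ∀ t, N ≤ m t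

theorem BddBelowUpTo.polyMul {i : Fin r} {A : FormalSeries r W} (hA : BddBelowUpTo i A)
    (f : MvPolynomial (Fin r) ℂ) : BddBelowUpTo i (polyMul f A) := fun J => by
  obtain ⟨N, hN⟩ := hA J
  refine ⟨N, fun m hm hJ t => ?_⟩
  obtain ⟨d, -, hd⟩ := exists_of_polyMul_ne_zero hm
  have := hN _ hd (by lia) t
  lia

theorem bddBelowUpTo_substAt {i k : Fin r} (hik : i ≠ k) {A : FormalSeries r W}
    (hA : A ∈ lowerTruncated r W) : BddBelowUpTo i (substAt i k A) := fun J => by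
  obtain ⟨N, hN⟩ := hA
  -- The sum of the exponents of x_i and x_k is preserved and is at least 2N, so the exponent of x_k
  -- is at least 2N - J when that of x_i is at most J.
  refine ⟨min (min N 0) (2 * N - J), fun m hm hJ t => ?_⟩
  obtain ⟨h0, s, hs⟩ := exists_of_substAt_ne_zero hm
  have h := hN _ hs
  have hi := h i
  have hk := h k
  have ht := h t
  rw [Function.update_of_ne hik, Function.update_self] at hi
  rw [Function.update_self] at hk
  rcases eq_or_ne t k with rfl | htk
  · lia
  rcases eq_or_ne t i with rfl | hti
  · lia
  rw [Function.update_of_ne htk, Function.update_of_ne hti] at ht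
  lia

end BddBelowUpTo

/-! ### Fields that can be adjoined to a quasi compatible set. -/

section QuasiCompatible

variable {W : Type*} [AddCommGroup W] [Module ℂ W]

theorem quasiCompatibleSeq_one (ψ : Fin 1 → calE W) : QuasiCompatibleSeq ψ := by
  refine ⟨1, one_ne_zero, fun w => ?_⟩
  rw [pairProduct_one, polyMul_one]
  obtain ⟨N, hN⟩ := exists_coeffOp_eq_zero (ψ 0) w
  refine ⟨N, fun m hm i => ?_⟩
  by_contra hlt
  refine hm ?_
  obtain rfl := Fin.fin_one_eq_zero i
  simpa [fieldProduct] using hN _ (not_le.1 hlt)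

/-- The substitution for a(x_1)b(x)v is carried through the fields on the left, which act as a fixed
linear map once their exponents are fixed. The variable x_0 takes the place of the one of a(x_1). -/
theorem substRel_fieldProduct {n : ℕ} (ψ : Fin (n + 1) → calE W) (k : Fin (n + 1))
    {a b : calE W} (hab : ∃ p, IsAnnihilator p a b) (w : W) :
    SubstRel k.castSucc k.succ
      (fieldProduct (Fin.insertNth k.castSucc a (Function.update ψ k b) :
        Fin (n + 2) → calE W) w)
      (fun m => fieldProduct (Function.update ψ k (YE 1 a b (m k.castSucc))) w
        (k.castSucc.removeNth m)) := fun m => by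
  obtain ⟨φ, v, h1, h2, -⟩ := exists_fieldProduct_eq ψ w k (k.castSucc.removeNth m)
  have hik : k.castSucc ≠ k.succ := (Fin.castSucc_lt_succ).ne
  have key : ∀ u : Fin 2 → ℤ,
      Function.update (Function.update m k.castSucc (u 0)) k.succ (u 1) =
        (Fin.insertNth k.castSucc (u 0) (Function.update (k.castSucc.removeNth m) k (u 1)) :
          Fin (n + 2) → ℤ) := fun u => by
    rw [Fin.eq_insertNth_iff]
    refine ⟨by simp [hik], ?_⟩
    funext t
    have hk := Fin.succAbove_castSucc_self k
    rcases eq_or_ne t k with rfl | ht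
    · rw [Fin.removeNth, hk, Function.update_self, Function.update_self]
    · rw [Fin.removeNth, Function.update_of_ne (hk ▸ Fin.succAbove_right_injective.ne ht),
        Function.update_of_ne (Fin.succAbove_ne _ _), Function.update_of_ne ht, Fin.removeNth]
  have := (quasiSubst_YE 1 hab v).map φ
  rw [fieldProduct_pair] at this
  convert this using 1
  · funext u
    rw [line, key, h2]
  · funext u
    rw [line, key, Fin.removeNth_insertNth, h1, Fin.insertNth_apply_same]
    rfl

/-- In a quasi compatible sequence, adjacent fields `a(x), b(x)` may be replaced by a coefficient
of `Y_ℰ(a(x), x_0) b(x)`. -/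
theorem quasiCompatibleSeq_YE {n : ℕ} (ψ : Fin (n + 1) → calE W) (k : Fin (n + 1))
    {a b : calE W} (hab : ∃ p, IsAnnihilator p a b)
    (h : QuasiCompatibleSeq (Fin.insertNth k.castSucc a (Function.update ψ k b) :
      Fin (n + 2) → calE W)) (j : ℤ) :
    QuasiCompatibleSeq (Function.update ψ k (YE 1 a b j)) := by
  -- A single remaining field needs no multiplier. The general argument needs two remaining
  -- variables, since g(0,x) must divide an admissible polynomial.
  obtain _ | n := n
  · exact quasiCompatibleSeq_one _
  obtain ⟨p, hp, hT⟩ := h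
  have hik : k.castSucc ≠ k.succ := (Fin.castSucc_lt_succ).ne
  obtain ⟨l, e, he, hadm⟩ := exists_shiftVar_pairProduct_eq hp k
  obtain ⟨l₀, hl₀⟩ := exists_YE_eq_zero 1 hab
  -- The control is on e F, but only a multiplier free of x_0 can be applied to a single coefficient
  -- of x_0. As x_0 divides e₀ - e, the power e₀^N is a multiple of e up to a multiple of x_0^N. F
  -- has no powers of x_0 below -l₀, so for N = j + l₀ + 1 (or 0 if this is negative) the second
  -- part does not reach x_0^j.
  set e₀ := rename k.castSucc.succAbove (specialize k.castSucc e) with he₀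
  set N := (j + l₀ + 1).toNat with hN
  obtain ⟨Q, hQ⟩ : e ∣ e₀ ^ N - (e₀ - e) ^ N := by
    have := sub_dvd_pow_sub_pow e₀ (e₀ - e) N
    rwa [sub_sub_cancel] at this
  obtain ⟨E, hE⟩ : X k.castSucc ^ N ∣ (e₀ - e) ^ N := by
    refine pow_dvd_pow_of_dvd ?_ N
    rw [dvd_sub_comm]
    exact X_dvd_sub_specialize _ _
  have hEQ : e₀ ^ N = Q * e + E * X k.castSucc ^ N := by
    rw [eq_add_of_sub_eq hQ, hE]; ring
  refine quasiCompatibleSeq_iff.2 ⟨_, hadm.pow N, fun w => ?_⟩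
  set F : FormalSeries (n + 3) W :=
    fun m => fieldProduct (Function.update ψ k (YE 1 a b (m k.castSucc))) w
        (k.castSucc.removeNth m) with hF
  have hrel := (substRel_fieldProduct ψ k hab w).polyMul hik (pairProduct p (n + 3))
  have heq := hrel.eq_substAt (line_mem_lowerTruncated hik (hT w))
  rw [he, polyMul_mul] at heq
  -- This bounds x_0^l Q e F; the coefficient of x_0^j in Q e F is read off at x_0^{j+l}.
  have hbdd := (bddBelowUpTo_substAt hik (hT w)).polyMul Q
  rw [← heq, polyMul_comm, polyMul_X_pow, ← polyMul_mul] at hbdd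
  obtain ⟨M, hM⟩ := hbdd (j + l)
  have h1 : ∀ u : Fin (n + 2) → ℤ,
      polyMul (specialize k.castSucc e ^ N)
        (fieldProduct (Function.update ψ k (YE 1 a b j)) w) u =
      polyMul (e₀ ^ N) F (Fin.insertNth k.castSucc j u : Fin (n + 3) → ℤ) := fun u => by
    rw [he₀, ← map_pow (rename k.castSucc.succAbove), polyMul_rename Fin.succAbove_right_injective, Fin.insertNth_comp_succAbove]
    congr 1
    funext u'
    have : Function.extend k.castSucc.succAbove u' (Fin.insertNth k.castSucc j u) =
        (Fin.insertNth k.castSucc j u' : Fin (n + 3) → ℤ) := by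
      rw [Fin.eq_insertNth_iff]
      constructor
      · rw [Function.extend_apply' _ _ _ (by rintro ⟨t, ht⟩; exact Fin.succAbove_ne _ _ ht),
          Fin.insertNth_apply_same]
      · funext t
        rw [Fin.removeNth, Fin.succAbove_right_injective.extend_apply]
    rw [this, hF]
    simp only [Fin.insertNth_apply_same, Fin.removeNth_insertNth]
  have hF0 : ∀ m, F m ≠ 0 → -(l₀ : ℤ) ≤ m k.castSucc := fun m hm => by
    by_contra hlt
    refine hm ?_
    obtain ⟨φ, v, h, -, -⟩ := exists_fieldProduct_eq ψ w k (k.castSucc.removeNth m)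
    have h' := h 0 (k.castSucc.removeNth m k)
    rw [Function.update_eq_self, coeffOp_zero, LinearMap.zero_apply, map_zero] at h'
    rw [hF]
    simp only [hl₀ _ (not_le.1 hlt), h']
  refine ⟨M, fun u hu t => ?_⟩
  rw [h1, hEQ, polyMul_add_left, Pi.add_apply] at hu
  have h2 : polyMul (E * X k.castSucc ^ N) F
      (Fin.insertNth k.castSucc j u : Fin (n + 3) → ℤ) = 0 := by
    rw [mul_comm, polyMul_mul, polyMul_X_pow]
    by_contra hne
    obtain ⟨d, -, hd⟩ := exists_of_polyMul_ne_zero hne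
    have := hF0 _ hd
    simp only [Pi.sub_apply, Fin.insertNth_apply_same, Pi.single_eq_same] at this
    lia
  rw [h2, add_zero] at hu
  have h3 := hM ((Fin.insertNth k.castSucc j u : Fin (n + 3) → ℤ) + Pi.single k.castSucc (l : ℤ))
    (by simpa using hu) (by simp) (k.castSucc.succAbove t)
  simpa [Fin.succAbove_ne] using h3

theorem QuasiCompatible.mono {K K' : Set (calE W)} (h : K ⊆ K') (hK : QuasiCompatible K') :
    QuasiCompatible K := fun r ψ hψ => hK r ψ fun i => h (hψ i)

theorem QuasiCompatible.exists_isAnnihilator {K : Set (calE W)} (hK : QuasiCompatible K)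
    {a b : calE W} (ha : a ∈ K) (hb : b ∈ K) : ∃ p, IsAnnihilator p a b :=
  (quasiCompatibleSeq_pair_iff a b).1 (hK 2 _ fun i => by fin_cases i <;> assumption)

/-- To adjoin a field to a quasi compatible set, it suffices to remove its last occurrence from a
sequence. -/
theorem QuasiCompatible.insert_of_step {K : Set (calE W)} {c : calE W} (hK : QuasiCompatible K)
    (hstep : ∀ (n : ℕ) (ψ : Fin (n + 1) → calE W) (k : Fin (n + 1)), ψ k = c →
      (∀ i < k, ψ i ∈ insert c K) → (∀ i, k < i → ψ i ∈ K) →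
      (∀ (s : ℕ) (φ : Fin s → calE W), (∀ i : Fin s, (i : ℕ) < k → φ i ∈ insert c K) →
        (∀ i : Fin s, (k : ℕ) ≤ i → φ i ∈ K) → QuasiCompatibleSeq φ) → QuasiCompatibleSeq ψ) :
    QuasiCompatible (insert c K) := by
  -- Induction on N, where c may occur only in the first N places. The length r is arbitrary
  -- throughout, because removing an occurrence of c may lengthen or shorten the sequence.
  have key : ∀ (N r : ℕ) (ψ : Fin r → calE W), (∀ i : Fin r, (i : ℕ) < N → ψ i ∈ insert c K) →
      (∀ i : Fin r, N ≤ (i : ℕ) → ψ i ∈ K) → QuasiCompatibleSeq ψ := by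
    intro N
    induction N with
    | zero => exact fun r ψ _ h => hK r ψ fun i => h i (Nat.zero_le _)
    | succ N ih =>
      intro r ψ h1 h2
      by_cases hr : N < r
      · by_cases hN : ψ ⟨N, hr⟩ ∈ K
        · refine ih r ψ (fun i hi => h1 i (by lia)) fun i hi => ?_
          rcases hi.eq_or_lt with h | h
          · have : i = ⟨N, hr⟩ := Fin.ext h.symm
            rwa [this]
          · exact h2 i h
        · obtain _ | n := r
          · lia
          exact hstep n ψ ⟨N, hr⟩ ((h1 ⟨N, hr⟩ (Nat.lt_succ_self N)).resolve_right hN)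
            (fun i hi => h1 i (Nat.lt_succ_of_lt hi)) (fun i hi => h2 i hi) fun s φ => ih s φ
      · exact ih r ψ (fun i hi => h1 i (by lia)) fun i hi => absurd i.2 (by lia)
  exact fun r ψ h => key r r ψ (fun i _ => h i) fun i hi => absurd i.2 (by lia)

/-- The last occurrence of the coefficient is replaced by the adjacent pair a, b from K. The
sequence grows, but the remaining occurrences all lie before that place. -/
theorem QuasiCompatible.insert_YE {K : Set (calE W)} (hK : QuasiCompatible K) {a b : calE W}
    (ha : a ∈ K) (hb : b ∈ K) (j : ℤ) : QuasiCompatible (insert (YE 1 a b j) K) := by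
  refine hK.insert_of_step fun n ψ k hk h1 h2 h => ?_
  rw [← Function.update_eq_self k ψ, hk]
  refine quasiCompatibleSeq_YE ψ k (hK.exists_isAnnihilator ha hb) (h _ _ ?_ ?_) j
  · intro i hi
    rcases Fin.eq_self_or_eq_succAbove k.castSucc i with rfl | ⟨t, rfl⟩
    · exact absurd hi (lt_irrefl _)
    · have htk : t < k := by
        by_contra hle
        rw [Fin.succAbove_of_le_castSucc _ _ (by simpa using hle)] at hi
        simp at hi; lia
      rw [Fin.insertNth_apply_succAbove, Function.update_of_ne htk.ne]
      exact h1 t htk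
  · intro i hi
    rcases Fin.eq_self_or_eq_succAbove k.castSucc i with rfl | ⟨t, rfl⟩
    · rwa [Fin.insertNth_apply_same]
    · rw [Fin.insertNth_apply_succAbove]
      rcases lt_trichotomy t k with htk | rfl | htk
      · rw [Fin.succAbove_of_castSucc_lt _ _ (by simpa using htk)] at hi
        simp at hi; lia
      · rwa [Function.update_self]
      · rw [Function.update_of_ne htk.ne']
        exact h2 t htk

theorem update_mem_of_lt {n : ℕ} {K K' : Set (calE W)} {ψ : Fin (n + 1) → calE W}
    {k : Fin (n + 1)} {a : calE W} (ha : a ∈ K) (h1 : ∀ i < k, ψ i ∈ K')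
    (h2 : ∀ i, k < i → ψ i ∈ K) :
    (∀ i : Fin (n + 1), (i : ℕ) < k → Function.update ψ k a i ∈ K') ∧
      ∀ i : Fin (n + 1), (k : ℕ) ≤ i → Function.update ψ k a i ∈ K := by
  constructor
  · intro i hi
    have : i < k := hi
    rw [Function.update_of_ne this.ne]
    exact h1 i this
  · intro i hi
    rcases eq_or_ne i k with rfl | hne
    · rwa [Function.update_self]
    · rw [Function.update_of_ne hne]
      exact h2 i (lt_of_le_of_ne hi hne.symm)

theorem QuasiCompatible.insert_add {K : Set (calE W)} (hK : QuasiCompatible K) {a b : calE W}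
    (ha : a ∈ K) (hb : b ∈ K) : QuasiCompatible (insert (a + b) K) := by
  refine hK.insert_of_step fun n ψ k hk h1 h2 h => ?_
  obtain ⟨ha1, ha2⟩ := update_mem_of_lt ha h1 h2
  obtain ⟨hb1, hb2⟩ := update_mem_of_lt hb h1 h2
  obtain ⟨f, hf, hfa⟩ := quasiCompatibleSeq_iff.1 (h _ _ ha1 ha2)
  obtain ⟨g, hg, hgb⟩ := quasiCompatibleSeq_iff.1 (h _ _ hb1 hb2)
  rw [← Function.update_eq_self k ψ, hk]
  refine quasiCompatibleSeq_iff.2 ⟨f * g, hf.mul hg, fun w => ?_⟩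
  rw [fieldProduct_update_add, polyMul_add]
  refine add_mem ?_ ?_
  · rw [mul_comm, polyMul_mul]; exact polyMul_mem g (hfa w)
  · rw [polyMul_mul]; exact polyMul_mem f (hgb w)

theorem QuasiCompatible.insert_smul {K : Set (calE W)} (hK : QuasiCompatible K) {a : calE W}
    (ha : a ∈ K) (z : ℂ) : QuasiCompatible (insert (z • a) K) := by
  refine hK.insert_of_step fun n ψ k hk h1 h2 h => ?_
  obtain ⟨ha1, ha2⟩ := update_mem_of_lt ha h1 h2
  obtain ⟨f, hf, hfa⟩ := quasiCompatibleSeq_iff.1 (h _ _ ha1 ha2)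
  rw [← Function.update_eq_self k ψ, hk]
  refine quasiCompatibleSeq_iff.2 ⟨f, hf, fun w => ?_⟩
  rw [fieldProduct_update_smul, polyMul_smul]
  exact Submodule.smul_mem _ z (hfa w)

/-- The field 1_W contributes only the power 0 of its variable, so it can be deleted and the
multiplier of the shorter sequence reused in the other variables. -/
theorem QuasiCompatible.insert_idField {K : Set (calE W)} (hK : QuasiCompatible K) :
    QuasiCompatible (insert (idField W) K) := by
  refine hK.insert_of_step fun n ψ k hk h1 h2 h => ?_
  obtain ⟨p, hp, hf⟩ := h n (k.removeNth ψ)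
    (fun i hi => h1 _ (by
      rw [Fin.succAbove_of_castSucc_lt _ _ (by simpa [Fin.lt_def] using hi)]
      simpa [Fin.lt_def] using hi))
    (fun i hi => h2 _ (by
      rw [Fin.succAbove_of_le_castSucc _ _ (by simpa [Fin.le_def] using hi)]
      rw [Fin.lt_def, Fin.val_succ]; lia))
  refine quasiCompatibleSeq_iff.2 ⟨_, admissible_rename_pairProduct hp
    (Fin.succAbove_right_injective (p := k)), fun w => ?_⟩
  have hprod : ∀ m, fieldProduct ψ w m =
      if m k = 0 then fieldProduct (k.removeNth ψ) w (k.removeNth m) else 0 := fun m => by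
    obtain ⟨φ, v, h, -, h'⟩ := exists_fieldProduct_eq ψ w k m
    have h'' := h (idField W) (m k)
    rw [Function.update_eq_self, ← hk, Function.update_eq_self, hk, coeffOp_idField] at h''
    rw [h'', h']
    split_ifs <;> simp
  obtain ⟨M, hM⟩ := hf w
  have key : ∀ m, polyMul (rename k.succAbove (pairProduct p n)) (fieldProduct ψ w) m =
      if m k = 0 then polyMul (pairProduct p n) (fieldProduct (k.removeNth ψ) w) (k.removeNth m)
      else 0 := fun m => by
    rw [polyMul_rename Fin.succAbove_right_injective]
    have he : (fun u => fieldProduct ψ w (Function.extend k.succAbove u m)) =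
        if m k = 0 then fieldProduct (k.removeNth ψ) w else 0 := by
      funext u
      have h1 : Function.extend k.succAbove u m k = m k :=
        Function.extend_apply' _ _ _ (by rintro ⟨t, ht⟩; exact Fin.succAbove_ne _ _ ht)
      have h2 : k.removeNth (Function.extend k.succAbove u m) = u := by
        funext t
        rw [Fin.removeNth, Fin.succAbove_right_injective.extend_apply]
      rw [hprod, h1, h2]
      split_ifs <;> rfl
    rw [he]
    split_ifs
    · rfl
    · rw [polyMul_zero]; rfl
  refine ⟨min M 0, fun m hm i => ?_⟩
  rw [key] at hm
  split_ifs at hm with h0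
  · rcases Fin.eq_self_or_eq_succAbove k i with rfl | ⟨t, rfl⟩
    · rw [h0]; exact min_le_right _ _
    · exact (min_le_left _ _).trans (hM _ hm t)
  · exact absurd rfl hm

end QuasiCompatible

/-! ### Rescaling of variables and the operators R_α. -/

section Scale

variable {W : Type*} [AddCommGroup W] [Module ℂ W] {r : ℕ}

/-- The rescaling `x_i ↦ β_i x_i` of formal series. -/
def scaleVars (β : Fin r → ℂˣ) (A : FormalSeries r W) : FormalSeries r W := fun m =>
  (∏ i, (β i : ℂ) ^ m i) • A m

/-- The rescaling `x_i ↦ β_i x_i` of polynomials. -/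
def scaleHom (β : Fin r → ℂˣ) : MvPolynomial (Fin r) ℂ →ₐ[ℂ] MvPolynomial (Fin r) ℂ :=
  aeval fun i => C (β i : ℂ) * X i

theorem scaleHom_X (β : Fin r → ℂˣ) (i : Fin r) : scaleHom β (X i) = C (β i : ℂ) * X i := by
  simp [scaleHom]

theorem scaleHom_C (β : Fin r → ℂˣ) (c : ℂ) : scaleHom β (C c) = C c :=
  (scaleHom β).commutes c

theorem shiftVar_C (α : ℂ) (i k : Fin r) (c : ℂ) : shiftVar α i k (C c) = C c :=
  (shiftVar α i k).commutes c

theorem scaleHom_ne_zero (β : Fin r → ℂˣ) {f : MvPolynomial (Fin r) ℂ} (hf : f ≠ 0) :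
    scaleHom β f ≠ 0 := fun h0 => hf (by
  have : scaleHom (fun i => (β i)⁻¹) (scaleHom β f) = f := by
    rw [← AlgHom.comp_apply]
    conv_rhs => rw [← AlgHom.id_apply (R := ℂ) f]
    congr 1
    ext i : 1
    rw [AlgHom.comp_apply, scaleHom_X, map_mul, scaleHom_C, scaleHom_X, ← mul_assoc, ← C_mul]
    simp
  rw [← this, h0, map_zero])

theorem scaleVars_polyMul (β : Fin r → ℂˣ) (f : MvPolynomial (Fin r) ℂ) (A : FormalSeries r W) :
    scaleVars β (polyMul f A) = polyMul (scaleHom β f) (scaleVars β A) := by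
  induction f using MvPolynomial.induction_on generalizing A with
  | C c =>
    rw [scaleHom_C, polyMul_C, polyMul_C]
    funext m
    exact smul_comm _ _ _
  | add f g hf hg =>
    rw [map_add, polyMul_add_left, polyMul_add_left, ← hf, ← hg]
    funext m
    exact smul_add _ _ _
  | mul_X f i hf =>
    rw [polyMul_mul, hf, map_mul, polyMul_mul, scaleHom_X, polyMul_mul, polyMul_C, polyMul_X,
      polyMul_X]
    congr 1
    funext m
    simp only [scaleVars, Pi.smul_apply, smul_smul]
    congr 1
    have h1 : (∏ j, (β j : ℂ) ^ (Pi.single i 1 : Fin r → ℤ) j) = β i := by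
      rw [Finset.prod_eq_single i (fun j _ hj => by simp [hj]) (by simp)]
      simp
    have h2 : (∏ j, (β j : ℂ) ^ (m - Pi.single i (1 : ℤ) : Fin r → ℤ) j) *
        (∏ j, (β j : ℂ) ^ (Pi.single i 1 : Fin r → ℤ) j) = ∏ j, (β j : ℂ) ^ m j := by
      rw [← Finset.prod_mul_distrib]
      refine Finset.prod_congr rfl fun j _ => ?_
      rw [← zpow_add₀ (β j).ne_zero]
      simp
    rw [← h2, h1, mul_comm]

theorem scaleVars_ne_zero {β : Fin r → ℂˣ} {A : FormalSeries r W} {m : Fin r → ℤ}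
    (h : scaleVars β A m ≠ 0) : A m ≠ 0 := fun h0 => h (by rw [scaleVars, h0, smul_zero])

theorem scaleVars_mem (β : Fin r → ℂˣ) {A : FormalSeries r W} (hA : A ∈ lowerTruncated r W) :
    scaleVars β A ∈ lowerTruncated r W :=
  let ⟨N, hN⟩ := hA
  ⟨N, fun m hm => hN m (scaleVars_ne_zero hm)⟩

theorem coeffOp_rescale (α : ℂˣ) (a : calE W) (k : ℤ) :
    coeffOp (rescale α a) k = (α : ℂ) ^ k • coeffOp a k := rfl

theorem rescale_rescale (α β : ℂˣ) (a : calE W) : rescale α (rescale β a) = rescale (α * β) a :=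
  calE_ext fun k w => by
    simp only [coeffOp_rescale, smul_smul, Units.val_mul, mul_zpow]

theorem rescale_one (a : calE W) : rescale 1 a = a :=
  calE_ext fun k w => by simp [coeffOp_rescale]

theorem rescale_idField (α : ℂˣ) : rescale α (idField W) = idField W :=
  calE_ext fun k w => by
    rw [coeffOp_rescale, LinearMap.smul_apply, coeffOp_idField]
    split_ifs with h
    · simp [h]
    · simp

theorem fieldProduct_rescale (β : Fin r → ℂˣ) (ψ : Fin r → calE W) (w : W) :
    fieldProduct (fun i => rescale (β i) (ψ i)) w = scaleVars β (fieldProduct ψ w) := by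
  induction r with
  | zero => funext m; simp [fieldProduct, scaleVars]
  | succ n ih =>
    funext m
    rw [scaleVars, fieldProduct_succ, fieldProduct_succ]
    have := congrFun (ih (Fin.tail β) (Fin.tail ψ)) (Fin.tail m)
    rw [scaleVars] at this
    have e : Fin.tail (fun i => rescale (β i) (ψ i)) =
        fun i => rescale (Fin.tail β i) (Fin.tail ψ i) := rfl
    rw [e, this, coeffOp_rescale, map_smul, Fin.prod_univ_succ, LinearMap.smul_apply, smul_smul,
      mul_comm]
    rfl

/-- The fields `a(α x)` for `a` in a quasi compatible set and `α ∈ ℂˣ` form a quasi compatible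
set. -/
theorem QuasiCompatible.rescale {K : Set (calE W)} (hK : QuasiCompatible K) :
    QuasiCompatible {c | ∃ (α : ℂˣ), ∃ a ∈ K, c = rescale α a} := by
  intro r ψ hψ
  choose β φ hφ hβ using hψ
  obtain rfl : ψ = fun i => FormalCalculus.rescale (β i) (φ i) := funext hβ
  obtain ⟨p, hp, h⟩ := hK r φ hφ
  refine quasiCompatibleSeq_iff.2 ⟨scaleHom β (pairProduct p r), ?_, fun w => ?_⟩
  · rw [pairProduct, map_prod]
    refine Admissible.prod _ _ fun ij hij => ?_
    have hlt : ij.1 < ij.2 := (Finset.mem_filter.1 hij).2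
    have h1 : scaleHom β (rename ![ij.1, ij.2] p) =
        rename ![ij.1, ij.2] (scaleHom ![β ij.1, β ij.2] p) := by
      rw [← AlgHom.comp_apply, ← AlgHom.comp_apply]
      congr 1
      ext t : 1
      fin_cases t <;> simp [scaleHom_X]
    rw [h1]
    exact admissible_rename_pair (scaleHom_ne_zero _ hp) hlt.ne
  · rw [fieldProduct_rescale, ← scaleVars_polyMul]
    exact scaleVars_mem β (h w)

/-- The condition on the parameters is what makes β_0(γ'x + x_0) = γ(β_1x) + β_0x_0. -/
theorem substFn_scaleVars (γ γ' : ℂˣ) (β : Fin 2 → ℂˣ) (h : γ' * β 0 = γ * β 1)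
    (A : FormalSeries 2 W) :
    substFn γ' (scaleVars β A) = scaleVars β (substFn γ A) := by
  funext m
  simp only [substFn, scaleVars, Fin.prod_univ_two]
  split_ifs with h0
  · rw [substCoeff, substCoeff, smul_finsum]
    refine finsum_congr fun s => ?_
    rw [smul_smul, scaleVars, smul_smul, Fin.prod_univ_two]
    congr 1
    rw [Int.toNat_of_nonneg h0]
    simp only [Matrix.cons_val_zero, Matrix.cons_val_one]
    obtain rfl : γ' = γ * β 1 * (β 0)⁻¹ := by rw [← h, mul_inv_cancel_right]
    have e1 := zpow_add₀ (β 0).ne_zero (m 0) (s - m 0)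
    have e2 := zpow_add₀ (β 1).ne_zero (m 1 + m 0 - s) (s - m 0)
    rw [add_sub_cancel] at e1
    rw [show m 1 + m 0 - s + (s - m 0) = m 1 by ring] at e2
    rw [e1, e2]
    simp only [Units.val_mul, Units.val_inv_eq_inv_val, mul_zpow, inv_zpow]
    have := zpow_ne_zero (s - m 0) (β 0).ne_zero
    field_simp
  · rw [smul_zero]

theorem QuasiSubst.scale {γ : ℂˣ} {A B : FormalSeries 2 W} (h : QuasiSubst γ A B)
    (γ' : ℂˣ) (β : Fin 2 → ℂˣ) (hγ : γ' * β 0 = γ * β 1) :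
    QuasiSubst γ' (scaleVars β A) (scaleVars β B) := by
  obtain ⟨p, hp, h1, h2, h3⟩ := h
  refine ⟨scaleHom β p, scaleHom_ne_zero β hp, ?_, ?_, h3.mono fun m hm => scaleVars_ne_zero hm⟩
  · rw [← scaleVars_polyMul]
    exact scaleVars_mem β h1
  · have e : (shiftVar (γ' : ℂ) 0 1).comp (scaleHom β) =
        (scaleHom β).comp (shiftVar (γ : ℂ) 0 1) := by
      have h0 : (shiftVar (γ' : ℂ) 0 1) (scaleHom β (X 0)) =
          scaleHom β (shiftVar (γ : ℂ) 0 1 (X 0)) := by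
        rw [scaleHom_X, map_mul, shiftVar_X_self, shiftVar_X_self, map_add, map_mul, scaleHom_X,
          scaleHom_X, shiftVar_C, scaleHom_C, mul_add, ← mul_assoc, ← mul_assoc, ← C_mul, ← C_mul,
          ← Units.val_mul, ← Units.val_mul, mul_comm (β 0), hγ]
      have h1 : (shiftVar (γ' : ℂ) 0 1) (scaleHom β (X 1)) =
          scaleHom β (shiftVar (γ : ℂ) 0 1 (X 1)) := by
        rw [scaleHom_X, map_mul, shiftVar_X_of_ne _ _ (by simp), shiftVar_X_of_ne _ _ (by simp),
          scaleHom_X, shiftVar_C]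
      exact MvPolynomial.algHom_ext (Fin.forall_fin_two (p := fun t =>
        (shiftVar (γ' : ℂ) 0 1) (scaleHom β (X t)) =
          scaleHom β (shiftVar (γ : ℂ) 0 1 (X t))).2 ⟨h0, h1⟩)
    have e := AlgHom.congr_fun e p
    simp only [AlgHom.comp_apply] at e
    rw [e, ← scaleVars_polyMul, h2, ← scaleVars_polyMul, substFn_scaleVars γ γ' β hγ]

theorem fieldProduct_pair_rescale (α β : ℂˣ) (a b : calE W) (w : W) :
    fieldProduct ![rescale α a, rescale β b] w = scaleVars ![α, β] (fieldProduct ![a, b] w) := by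
  rw [← fieldProduct_rescale]
  congr 1
  funext i; fin_cases i <;> rfl

/-- `Y_ℰ^{(α)}(a(x), x_0) b(x) = R_α Y_ℰ(a(x), x_0) R_{α⁻¹} b(x)`. -/
theorem YE_eq_rescale {a b : calE W} (α : ℂˣ) (h : ∃ p, IsAnnihilator p a b)
    (h' : ∃ p, IsAnnihilator p a (rescale α⁻¹ b)) :
    YE α a b = fun j => rescale α (YE 1 a (rescale α⁻¹ b) j) :=
  YE_unique h fun w => by
    -- Scaling x by α and leaving x_1 and x_0 alone turns x_1 = x + x_0 into x_1 = αx + x_0.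
    have h1 := (quasiSubst_YE 1 h' w).scale α ![1, α] (by simp)
    rw [← fieldProduct_pair_rescale, rescale_one, rescale_rescale, mul_inv_cancel, rescale_one]
      at h1
    convert h1 using 1
    funext m
    simp [familySeries, scaleVars, coeffOp_rescale, Fin.prod_univ_two]

/-- `R_α Y_ℰ(a(x), x_0) R_{α⁻¹} b(x) = Y_ℰ(R_α a(x), α⁻¹ x_0) b(x)`. -/
theorem YE_rescale {a b : calE W} (α : ℂˣ) (h : ∃ p, IsAnnihilator p (rescale α a) b)
    (h' : ∃ p, IsAnnihilator p a (rescale α⁻¹ b)) :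
    YE 1 (rescale α a) b = fun j => (α : ℂ) ^ j • rescale α (YE 1 a (rescale α⁻¹ b) j) :=
  YE_unique h fun w => by
    -- Scaling x_1, x and x_0 all by α preserves x_1 = x + x_0, and the scaling of x_0 produces the
    -- factor α^j.
    have h1 := (quasiSubst_YE 1 h' w).scale 1 ![α, α] (by simp)
    rw [← fieldProduct_pair_rescale, rescale_rescale, mul_inv_cancel, rescale_one] at h1
    convert h1 using 1
    funext m
    simp [familySeries, scaleVars, coeffOp_rescale, coeffOp_smul, Fin.prod_univ_two, smul_smul]

end Scale

/-! ### The opposite expansion of x_i + x_k. -/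

section ExpandAt

variable {W : Type*} [AddCommGroup W] [Module ℂ W] {r : ℕ} {i k : Fin r}

/-- The substitution `x_i ↦ x_i + x_k`, expanded in nonnegative powers of `x_k`. -/
def expandAt (i k : Fin r) (A : FormalSeries r W) : FormalSeries r W := fun n =>
  ∑ᶠ s : ℕ, (Ring.choose (n i + s) s : ℤ) •
    A (Function.update (Function.update n i (n i + s)) k (n k - s))

/-- The exponents of `x_k` are bounded below. -/
def BddBelowAt (k : Fin r) (A : FormalSeries r W) : Prop := ∃ N : ℤ, ∀ m, A m ≠ 0 → N ≤ m k

theorem BddBelowAt.polyMul {A : FormalSeries r W} (hA : BddBelowAt k A)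
    (f : MvPolynomial (Fin r) ℂ) : BddBelowAt k (polyMul f A) := by
  obtain ⟨N, hN⟩ := hA
  refine ⟨N, fun m hm => ?_⟩
  obtain ⟨d, -, hd⟩ := exists_of_polyMul_ne_zero hm
  have := hN _ hd
  lia

theorem BddBelowAt.exists_forall_ge {A : FormalSeries r W} (hA : BddBelowAt k A)
    (n : Fin r → ℤ) : ∃ M : ℕ, ∀ (m : Fin r → ℤ) (s : ℕ), M ≤ s → m k ≤ n k - s → A m = 0 := by
  obtain ⟨N, hN⟩ := hA
  refine ⟨(n k - N + 1).toNat, fun m s hs hm => ?_⟩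
  by_contra h
  have := hN m h
  lia

theorem expandAt_eq_sum {A : FormalSeries r W} {n : Fin r → ℤ} {M : ℕ}
    (h : ∀ s : ℕ, M ≤ s →
      A (Function.update (Function.update n i (n i + s)) k (n k - s)) = 0) :
    expandAt i k A n = ∑ s ∈ Finset.range M, (Ring.choose (n i + s) s : ℤ) •
      A (Function.update (Function.update n i (n i + s)) k (n k - s)) := by
  refine finsum_eq_sum_of_support_subset _ fun s hs => ?_
  rw [Finset.mem_coe, Finset.mem_range]
  by_contra hle
  exact hs (by simp only [h s (not_lt.1 hle), smul_zero])

theorem expandAt_add {A B : FormalSeries r W} (hA : BddBelowAt k A) (hB : BddBelowAt k B) :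
    expandAt i k (A + B) = expandAt i k A + expandAt i k B := by
  funext n
  obtain ⟨M, hM⟩ := hA.exists_forall_ge n
  obtain ⟨M', hM'⟩ := hB.exists_forall_ge n
  have h1 : ∀ s : ℕ, max M M' ≤ s →
      A (Function.update (Function.update n i (n i + s)) k (n k - s)) = 0 := fun s hs =>
    hM _ s ((le_max_left _ _).trans hs) (by simp)
  have h2 : ∀ s : ℕ, max M M' ≤ s →
      B (Function.update (Function.update n i (n i + s)) k (n k - s)) = 0 := fun s hs =>
    hM' _ s ((le_max_right _ _).trans hs) (by simp)
  rw [Pi.add_apply, expandAt_eq_sum h1, expandAt_eq_sum h2,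
    expandAt_eq_sum (M := max M M') fun s hs => by rw [Pi.add_apply, h1 s hs, h2 s hs, add_zero],
    ← Finset.sum_add_distrib]
  simp only [Pi.add_apply, smul_add]

theorem expandAt_smul (c : ℂ) (A : FormalSeries r W) :
    expandAt i k (c • A) = c • expandAt i k A := by
  funext n
  simp only [expandAt, Pi.smul_apply, smul_finsum]
  exact finsum_congr fun s => smul_comm _ _ _

/-- This is Pascal's rule; boundedness in x_k makes the sums finite. -/
theorem expandAt_X_self (hik : i ≠ k) {A : FormalSeries r W} (hA : BddBelowAt k A) :
    expandAt i k (polyMul (X i) A) = polyMul (X i + X k) (expandAt i k A) := by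
  funext n
  rw [polyMul_add_left, Pi.add_apply, polyMul_X, polyMul_X, polyMul_X]
  change _ = expandAt i k A (n - Pi.single i 1) + expandAt i k A (n - Pi.single k 1)
  obtain ⟨M, hM⟩ := hA.exists_forall_ge n
  set g : ℤ → ℤ → W := fun s t => A (Function.update (Function.update n i s) k t) with hg
  have hg0 : ∀ (s : ℕ) (a b : ℤ), M ≤ s → b ≤ n k - s → g a b = 0 := fun s a b hs hb =>
    hM _ s hs (by simpa using hb)
  have e0 : ∀ s : ℕ, Function.update (Function.update n i (n i + s)) k (n k - s) - Pi.single i 1 =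
      Function.update (Function.update n i (n i + s - 1)) k (n k - s) := fun s => by
    funext j
    rcases eq_or_ne j k with rfl | hk
    · simp [hik.symm]
    rcases eq_or_ne j i with rfl | hi
    · simp [hk]
    · simp [hk, hi]
  have e1 : ∀ s : ℕ, Function.update (Function.update (n - Pi.single i 1) i
      ((n - Pi.single i 1 : Fin r → ℤ) i + s)) k ((n - Pi.single i 1 : Fin r → ℤ) k - s) =
      Function.update (Function.update n i (n i + s - 1)) k (n k - s) := fun s => by
    funext j
    rcases eq_or_ne j k with rfl | hk
    · simp [hik.symm]
    rcases eq_or_ne j i with rfl | hi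
    · simp [hk]; ring
    · simp [hk, hi]
  have e2 : ∀ s : ℕ, Function.update (Function.update (n - Pi.single k 1) i
      ((n - Pi.single k 1 : Fin r → ℤ) i + s)) k ((n - Pi.single k 1 : Fin r → ℤ) k - s) =
      Function.update (Function.update n i (n i + s)) k (n k - 1 - s) := fun s => by
    funext j
    rcases eq_or_ne j k with rfl | hk
    · simp
    rcases eq_or_ne j i with rfl | hi
    · simp [hk]
    · simp [hk, hi]
  -- The ranges have lengths M + 1, M + 1 and M, so that splitting off the term s = 0 from the first
  -- two leaves three sums over the same range.
  rw [expandAt_eq_sum (M := M + 1) fun s hs => by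
      rw [e0]; exact hg0 s _ _ (by lia) le_rfl,
    expandAt_eq_sum (M := M + 1) fun s hs => by
      rw [e1]; exact hg0 s _ _ (by lia) le_rfl,
    expandAt_eq_sum (M := M) fun s hs => by
      rw [e2]; exact hg0 s _ _ hs (by lia),
    Finset.sum_range_succ', Finset.sum_range_succ', add_right_comm, ← Finset.sum_add_distrib]
  simp only [e0, e1, e2]
  congr 1
  · refine Finset.sum_congr rfl fun s _ => ?_
    have h1 : n i + ((s + 1 : ℕ) : ℤ) = n i + s + 1 := by push_cast; ring
    have h2 : n i + s + 1 - 1 = n i + s := by ring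
    have h3 : n k - ((s + 1 : ℕ) : ℤ) = n k - 1 - s := by push_cast; ring
    have h4 : (n - Pi.single i 1 : Fin r → ℤ) i + ((s + 1 : ℕ) : ℤ) = n i + s := by
      simp
    have h5 : (n - Pi.single k 1 : Fin r → ℤ) i + s = n i + s := by simp [hik]
    rw [h1, h2, h3, h4, h5, Ring.choose_succ_succ, add_smul, add_comm]
  · simp

theorem expandAt_X_right (hik : i ≠ k) (A : FormalSeries r W) :
    expandAt i k (polyMul (X k) A) = polyMul (X k) (expandAt i k A) := by
  funext n
  rw [polyMul_X, polyMul_X]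
  refine finsum_congr fun s => ?_
  congr 1
  · simp [hik]
  · refine congrArg A ?_
    funext j
    rcases eq_or_ne j k with rfl | hk
    · simp; ring
    rcases eq_or_ne j i with rfl | hi
    · simp [hk]
    · simp [hk, hi]

theorem expandAt_X_of_ne {j : Fin r} (hji : j ≠ i) (hjk : j ≠ k) (A : FormalSeries r W) :
    expandAt i k (polyMul (X j) A) = polyMul (X j) (expandAt i k A) := by
  funext n
  rw [polyMul_X, polyMul_X]
  refine finsum_congr fun s => ?_
  congr 1
  · simp [hji.symm]
  · refine congrArg A ?_
    funext t
    rcases eq_or_ne t k with rfl | hk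
    · simp [hjk.symm]
    rcases eq_or_ne t i with rfl | hi
    · simp [hk, hji.symm]
    · simp [hk, hi]

theorem expandAt_polyMul (hik : i ≠ k) (f : MvPolynomial (Fin r) ℂ) {A : FormalSeries r W}
    (hA : BddBelowAt k A) :
    expandAt i k (polyMul f A) = polyMul (shiftVar 1 i k f) (expandAt i k A) := by
  induction f using MvPolynomial.induction_on generalizing A with
  | C c => rw [shiftVar_C, polyMul_C, polyMul_C, expandAt_smul]
  | add f g hf hg =>
    rw [polyMul_add_left, expandAt_add (hA.polyMul f) (hA.polyMul g), hf hA, hg hA, map_add,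
      polyMul_add_left]
  | mul_X f j hf =>
    rw [polyMul_mul, hf (hA.polyMul _), map_mul, polyMul_mul]
    congr 1
    rcases eq_or_ne j i with rfl | hji
    · rw [shiftVar_X_self, C_1, one_mul, expandAt_X_self hik hA]
    rw [shiftVar_X_of_ne _ _ hji]
    rcases eq_or_ne j k with rfl | hjk
    · exact expandAt_X_right hik A
    · exact expandAt_X_of_ne hji hjk A

theorem substAt_apply (i k : Fin r) (A : FormalSeries r W) (n : Fin r → ℤ) :
    substAt i k A n = if 0 ≤ n i then ∑ᶠ s : ℤ, (Ring.choose s (n i).toNat : ℤ) •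
      A (Function.update (Function.update n i s) k (n k + n i - s)) else 0 := by
  change (if 0 ≤ n i then substCoeff 1 (line i k n A) (n i).toNat (n k) else 0) = _
  by_cases h : 0 ≤ n i
  · rw [if_pos h, if_pos h]
    refine finsum_congr fun s => ?_
    rw [Units.val_one, one_zpow, mul_one, Int.cast_smul_eq_zsmul, line, Int.toNat_of_nonneg h]
    rfl
  · rw [if_neg h, if_neg h]

/-- The two expansions agree if no negative powers of `x_i` are involved. -/
theorem expandAt_eq_substAt {A : FormalSeries r W} (hA : ∀ m, A m ≠ 0 → 0 ≤ m i)
    (hik : i ≠ k) : expandAt i k A = substAt i k A := by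
  funext n
  have hA' : ∀ a b : ℤ, A (Function.update (Function.update n i a) k b) ≠ 0 → 0 ≤ a :=
    fun a b h => by simpa [hik] using hA _ h
  rw [substAt_apply]
  split_ifs with h
  · obtain ⟨N, hN⟩ := Int.eq_ofNat_of_zero_le h
    have hinj : Function.Injective fun s : ℕ => n i + (s : ℤ) := fun s t hst => by
      simpa using hst
    set f : ℤ → W := fun s => (Ring.choose s (n i).toNat : ℤ) •
      A (Function.update (Function.update n i s) k (n k + n i - s)) with hf
    -- Terms with s < 0 vanish by `hA`, and those with 0 ≤ s < n i because the binomial coefficient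
    -- is zero. The two sums are then termwise equal reindexings, so no finiteness has to be
    -- checked.
    have hsupp : Function.support f ⊆ Set.range fun s : ℕ => n i + (s : ℤ) := fun s hs => by
      have h0 : 0 ≤ s := hA' s (n k + n i - s) fun h0 => hs (by simp only [hf, h0, smul_zero])
      obtain ⟨S, rfl⟩ := Int.eq_ofNat_of_zero_le h0
      by_contra hcon
      refine hs ?_
      have hlt : S < N := by
        by_contra hle
        exact hcon ⟨S - N, by simp only; lia⟩
      simp only [hf, hN, Int.toNat_natCast]
      rw [Ring.choose_natCast, Nat.choose_eq_zero_of_lt hlt]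
      simp
    rw [← finsum_mem_univ f, ← finsum_mem_inter_support_eq' f (Set.range fun s : ℕ => n i + (s : ℤ))
      Set.univ (fun s hs => ⟨fun _ => trivial, fun _ => hsupp hs⟩), finsum_mem_range hinj]
    refine finsum_congr fun s => ?_
    simp only [hf]
    have e1 : n k + n i - (n i + (s : ℤ)) = n k - s := by ring
    rw [e1, hN, Int.toNat_natCast]
    have e2 : (N : ℤ) + s = ((N + s : ℕ) : ℤ) := by push_cast; rfl
    rw [e2, Ring.choose_natCast, Ring.choose_natCast, Nat.choose_symm_add]
  · refine finsum_eq_zero_of_forall_eq_zero fun s => ?_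
    by_cases h0 : A (Function.update (Function.update n i (n i + s)) k (n k - s)) = 0
    · rw [h0, smul_zero]
    obtain ⟨S, hS⟩ := Int.eq_ofNat_of_zero_le (hA' _ _ h0)
    rw [hS, Ring.choose_natCast, Nat.choose_eq_zero_of_lt (by lia)]
    simp

end ExpandAt

/-! ### Compatibility of the iterated substitutions. -/

section Composition

variable {W : Type*} [AddCommGroup W] [Module ℂ W]

/-- Vandermonde's identity for (m - i) + n, combined with binom(m,i) binom(m-i,u) = binom(i+u,i)
binom(m,i+u). -/
theorem choose_add_sub_mul_choose (m n : ℤ) (i j : ℕ) :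
    (Ring.choose (n + m - i) j * Ring.choose m i : ℤ) =
      ∑ u ∈ Finset.range (j + 1), Ring.choose ((i + u : ℕ) : ℤ) i *
        (Ring.choose m (i + u) * Ring.choose n (j - u)) := by
  have e : n + m - i = (m - i) + n := by ring
  rw [e, Ring.add_choose_eq j (Commute.all _ _), Finset.Nat.sum_antidiagonal_eq_sum_range_succ_mk,
    Finset.sum_mul]
  refine Finset.sum_congr rfl fun u _ => ?_
  have := Ring.choose_smul_choose m (Nat.le_add_right i u)
  rw [Nat.add_sub_cancel_left, nsmul_eq_mul] at this
  rw [Ring.choose_natCast, ← mul_assoc, this]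
  ring

end Composition

section Composition

variable {W : Type*} [AddCommGroup W] [Module ℂ W]

theorem substAt_zero_one (A : FormalSeries 3 W) (i j k : ℤ) : substAt 0 1 A ![i, j, k] =
    if 0 ≤ i then ∑ᶠ s : ℤ, (Ring.choose s i.toNat : ℤ) • A ![s, j + i - s, k] else 0 := by
  have h : ∀ s t : ℤ, Function.update (Function.update ![i, j, k] 0 s) 1 t = ![s, t, k] :=
    fun s t => by funext l; fin_cases l <;> rfl
  rw [substAt_apply]
  simp only [h]
  rfl

theorem substAt_zero_two (A : FormalSeries 3 W) (i j k : ℤ) : substAt 0 2 A ![i, j, k] =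
    if 0 ≤ i then ∑ᶠ s : ℤ, (Ring.choose s i.toNat : ℤ) • A ![s, j, k + i - s] else 0 := by
  have h : ∀ s t : ℤ, Function.update (Function.update ![i, j, k] 0 s) 2 t = ![s, j, t] :=
    fun s t => by funext l; fin_cases l <;> rfl
  rw [substAt_apply]
  simp only [h]
  rfl

theorem substAt_one_two (A : FormalSeries 3 W) (i j k : ℤ) : substAt 1 2 A ![i, j, k] =
    if 0 ≤ j then ∑ᶠ s : ℤ, (Ring.choose s j.toNat : ℤ) • A ![i, s, k + j - s] else 0 := by
  have h : ∀ s t : ℤ, Function.update (Function.update ![i, j, k] 1 s) 2 t = ![i, s, t] :=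
    fun s t => by funext l; fin_cases l <;> rfl
  rw [substAt_apply]
  simp only [h]
  rfl

theorem finsum_smul_eq_sum {c : ℤ → ℤ} {F : ℤ → W} {I : Finset ℤ} (h : ∀ s, F s ≠ 0 → s ∈ I) :
    ∑ᶠ s, c s • F s = ∑ s ∈ I, c s • F s :=
  finsum_eq_sum_of_support_subset _ fun s hs => h s fun h0 => hs (by simp only [h0, smul_zero])

/-- `T(x_1, y, x)` becomes the same series under `y = x + x_2`, `x_1 = x + x_0'`,
`x_0' = x_2 + x_0`, and under `x_1 = y + x_0`, `y = x + x_2`. -/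
theorem substAt_comp {T : FormalSeries 3 W} (hT : T ∈ lowerTruncated 3 W) :
    substAt 0 1 (substAt 0 2 (substAt 1 2 T)) = substAt 1 2 (substAt 0 1 T) := by
  obtain ⟨N, hN⟩ := hT
  have hN' : ∀ a b c : ℤ, T ![a, b, c] ≠ 0 → N ≤ a ∧ N ≤ b ∧ N ≤ c := fun a b c h =>
    ⟨hN _ h 0, hN _ h 1, hN _ h 2⟩
  funext n
  obtain ⟨i, j, k, rfl⟩ : ∃ i j k, n = ![i, j, k] :=
    ⟨n 0, n 1, n 2, by funext t; fin_cases t <;> rfl⟩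
  -- All substitutions preserve the total degree K. A monomial of T of degree K has exponents at
  -- least N, hence at most K - 2N, so every sum over exponents of T may run over the fixed interval
  -- I.
  obtain ⟨K, hK⟩ : ∃ K, K = k + i + j := ⟨_, rfl⟩
  obtain ⟨I, hI⟩ : ∃ I, I = Finset.Icc N (K - 2 * N) := ⟨_, rfl⟩
  have hmem : ∀ s, s ∈ I ↔ N ≤ s ∧ s ≤ K - 2 * N := fun s => by rw [hI, Finset.mem_Icc]
  have h12 : ∀ m b c : ℤ, m + b + c = K → substAt 1 2 T ![m, b, c] =
      if 0 ≤ b then ∑ n ∈ I, (Ring.choose n b.toNat : ℤ) • T ![m, n, K - m - n] else 0 := by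
    intro m b c hmbc
    have e : ∀ s, c + b - s = K - m - s := fun s => by lia
    rw [substAt_one_two, finsum_smul_eq_sum (I := I) fun s hs => ?_]
    · simp only [e]
    · obtain ⟨h1, h2, h3⟩ := hN' _ _ _ hs
      rw [hmem]
      constructor <;> lia
  have h12' : ∀ m b c : ℤ, m + b + c = K → substAt 1 2 T ![m, b, c] ≠ 0 → m ∈ I := by
    intro m b c hmbc h
    rw [h12 m b c hmbc] at h
    split_ifs at h
    · obtain ⟨s, hs, h0⟩ := Finset.exists_ne_zero_of_sum_ne_zero h
      obtain ⟨h1, h2, h3⟩ := hN' _ _ _ fun h => h0 (by rw [h, smul_zero])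
      rw [hmem]
      constructor <;> lia
    · exact absurd rfl h
  have h02 : ∀ u b c : ℤ, u + b + c = K → substAt 0 2 (substAt 1 2 T) ![u, b, c] =
      if 0 ≤ u then if 0 ≤ b then ∑ m ∈ I, ∑ n ∈ I,
        (Ring.choose m u.toNat * Ring.choose n b.toNat : ℤ) • T ![m, n, K - m - n]
          else 0 else 0 := by
    intro u b c hubc
    have hc : ∀ m : ℤ, m + b + (c + u - m) = K := fun m => by lia
    rw [substAt_zero_two, finsum_smul_eq_sum (I := I) fun s hs => h12' _ _ _ (hc s) hs]
    simp only [h12 _ _ _ (hc _)]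
    by_cases hb : 0 ≤ b
    · simp only [if_pos hb, Finset.smul_sum, smul_smul]
    · simp only [if_neg hb, smul_zero, Finset.sum_const_zero]
  have hL : substAt 0 1 (substAt 0 2 (substAt 1 2 T)) ![i, j, k] =
      if 0 ≤ i then ∑ u ∈ Finset.Icc 0 (i + j), ∑ m ∈ I, ∑ n ∈ I,
        (Ring.choose u i.toNat * (Ring.choose m u.toNat * Ring.choose n (j + i - u).toNat) : ℤ) •
          T ![m, n, K - m - n] else 0 := by
    have hc : ∀ u : ℤ, u + (j + i - u) + k = K := fun m => by lia
    rw [substAt_zero_one, finsum_smul_eq_sum (I := Finset.Icc 0 (i + j)) fun s hs => ?_]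
    · by_cases hi : 0 ≤ i
      · rw [if_pos hi, if_pos hi]
        refine Finset.sum_congr rfl fun u hu => ?_
        obtain ⟨hu0, hu1⟩ := Finset.mem_Icc.1 hu
        rw [h02 _ _ _ (hc u), if_pos hu0, if_pos (by lia)]
        simp only [Finset.smul_sum, smul_smul]
      · rw [if_neg hi, if_neg hi]
    · rw [h02 _ _ _ (hc s)] at hs
      rw [Finset.mem_Icc]
      by_contra hcon
      refine hs ?_
      by_cases h0 : 0 ≤ s
      · rw [if_pos h0, if_neg (fun h1 => hcon ⟨h0, by lia⟩)]
      · rw [if_neg h0]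
  have h01 : ∀ v : ℤ, substAt 0 1 T ![i, v, k + j - v] =
      if 0 ≤ i then ∑ m ∈ I, (Ring.choose m i.toNat : ℤ) • T ![m, v + i - m, k + j - v]
        else 0 := by
    intro v
    rw [substAt_zero_one, finsum_smul_eq_sum (I := I) fun s hs => ?_]
    obtain ⟨h1, h2, h3⟩ := hN' _ _ _ hs
    rw [hmem]
    constructor <;> lia
  have hR : substAt 1 2 (substAt 0 1 T) ![i, j, k] =
      if 0 ≤ j then if 0 ≤ i then ∑ m ∈ I, ∑ n ∈ I,
        (Ring.choose (n + m - i) j.toNat * Ring.choose m i.toNat : ℤ) • T ![m, n, K - m - n]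
          else 0 else 0 := by
    rw [substAt_one_two]
    simp only [h01]
    by_cases hi : 0 ≤ i
    · simp only [if_pos hi]
      have hfin : ∀ m ∈ I, (Function.support fun v : ℤ => (Ring.choose v j.toNat : ℤ) •
            ((Ring.choose m i.toNat : ℤ) • T ![m, v + i - m, k + j - v])).Finite := fun m _ => by
        refine (Set.finite_Icc (N + m - i) (k + j - N)).subset fun v hv => ?_
        obtain ⟨h1, h2, h3⟩ := hN' m (v + i - m) (k + j - v)
          fun h0 => hv (by simp only [h0, smul_zero])
        constructor <;> lia
      simp only [Finset.smul_sum]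
      rw [finsum_sum_comm _ _ hfin]
      congr 1
      refine Finset.sum_congr rfl fun m _ => ?_
      rw [← finsum_comp_equiv (Equiv.addRight (m - i))]
      have a1 : ∀ s, s + m - i + i - m = s := fun s => by ring
      have a2 : ∀ s, k + j - (s + m - i) = K - m - s := fun s => by lia
      have a3 : ∀ s, s + (m - i) = s + m - i := fun s => by ring
      simp only [Equiv.coe_addRight, a1, a2, a3, smul_smul]
      refine finsum_smul_eq_sum (W := W) (c := fun s => Ring.choose (s + m - i) j.toNat *
        Ring.choose m i.toNat) (F := fun s => T ![m, s, K - m - s]) fun s hs => ?_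
      obtain ⟨h1, h2, h3⟩ := hN' _ _ _ hs
      rw [hmem]
      constructor <;> lia
    · simp only [if_neg hi, smul_zero, finsum_zero]
  rw [hL, hR]
  by_cases hi : 0 ≤ i
  · obtain ⟨i, rfl⟩ := Int.eq_ofNat_of_zero_le hi
    rw [if_pos hi, if_pos hi]
    by_cases hj : 0 ≤ j
    · obtain ⟨j, rfl⟩ := Int.eq_ofNat_of_zero_le hj
      rw [if_pos hj, Finset.sum_comm]
      refine Finset.sum_congr rfl fun m _ => ?_
      rw [Finset.sum_comm]
      refine Finset.sum_congr rfl fun n _ => ?_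
      rw [← Finset.sum_smul]
      congr 1
      simp only [Int.toNat_natCast]
      rw [choose_add_sub_mul_choose]
      symm
      -- The sum over the exponent of the intermediate variable x_0' effectively begins at i, since
      -- binom(u,i) vanishes for 0 ≤ u < i.
      refine Finset.sum_of_injOn (fun u : ℕ => ((i + u : ℕ) : ℤ)) (fun a _ b _ h => by simpa using h)
        (fun u hu => ?_) (fun u hu hnot => ?_) (fun u hu => ?_)
      · simp only [Finset.coe_range, Set.mem_Iio] at hu
        simp only [Finset.coe_Icc, Set.mem_Icc]
        constructor <;> lia
      · obtain ⟨hu0, hu1⟩ := Finset.mem_Icc.1 hu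
        obtain ⟨u, rfl⟩ := Int.eq_ofNat_of_zero_le hu0
        have hlt : u < i := by
          by_contra hle
          refine hnot ⟨u - i, ?_, ?_⟩
          · simp only [Finset.coe_range, Set.mem_Iio]; lia
          · simp only; lia
        rw [Ring.choose_natCast, Nat.choose_eq_zero_of_lt hlt]
        simp
      · have b1 : ((j : ℤ) + i - ((i + u : ℕ) : ℤ)).toNat = j - u := by lia
        simp only [b1, Int.toNat_natCast]
    · rw [if_neg hj]
      refine Finset.sum_eq_zero fun u hu => ?_
      obtain ⟨hu0, hu1⟩ := Finset.mem_Icc.1 hu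
      obtain ⟨u, rfl⟩ := Int.eq_ofNat_of_zero_le hu0
      simp only [Int.toNat_natCast]
      rw [Ring.choose_natCast, Nat.choose_eq_zero_of_lt (by lia)]
      simp
  · rw [if_neg hi, if_neg hi]
    simp

end Composition

/-! ### The polynomial factor for three fields. -/

section Polynomials

theorem pairProduct_three (p : MvPolynomial (Fin 2) ℂ) :
    pairProduct p 3 = rename ![0, 1] p * rename ![0, 2] p * rename ![1, 2] p := by
  have h : (Finset.univ : Finset (Fin 3 × Fin 3)).filter (fun ij => ij.1 < ij.2) =
      {(0, 1), (0, 2), (1, 2)} := by decide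
  rw [pairProduct, h, Finset.prod_insert (by decide), Finset.prod_insert (by decide),
    Finset.prod_singleton, mul_assoc]

theorem shiftVar_comp_three (f : MvPolynomial (Fin 3) ℂ) :
    shiftVar 1 0 1 (shiftVar 1 0 2 (shiftVar 1 1 2 f)) = shiftVar 1 1 2 (shiftVar 1 0 1 f) := by
  have h : (shiftVar 1 0 1).comp ((shiftVar 1 0 2).comp (shiftVar 1 1 2)) =
      (shiftVar 1 1 2).comp (shiftVar (r := 3) 1 0 1) := by
    refine algHom_ext fun i => ?_
    simp only [AlgHom.comp_apply]
    fin_cases i <;> simp [shiftVar, Function.update, add_assoc]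
  exact AlgHom.congr_fun h f

/-- `p(x_1, y) p(x_1, x) p(y, x)` after the substitution `x_1 = y + x_0`, `y = x + x_2`, in terms
of `q(x_0, x) = p(x_0 + x, x)`. -/
theorem shiftVar_pairProduct_three (p : MvPolynomial (Fin 2) ℂ) :
    shiftVar 1 1 2 (shiftVar 1 0 1 (pairProduct p 3)) =
      aeval ![X 0, X 1 + X 2] (shiftVar 1 0 1 p) * aeval ![X 0 + X 1, X 2] (shiftVar 1 0 1 p) *
        aeval ![X 1, X 2] (shiftVar 1 0 1 p) := by
  have e : ∀ (i j : Fin 3) (u v : MvPolynomial (Fin 3) ℂ),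
      shiftVar 1 1 2 (shiftVar 1 0 1 (X i)) = u + v → shiftVar 1 1 2 (shiftVar 1 0 1 (X j)) = v →
      shiftVar 1 1 2 (shiftVar 1 0 1 (rename ![i, j] p)) = aeval ![u, v] (shiftVar 1 0 1 p) := by
    intro i j u v hi hj
    refine DFunLike.congr_fun (f := (shiftVar 1 1 2).comp ((shiftVar 1 0 1).comp (rename ![i, j])))
      (g := (aeval ![u, v]).comp (shiftVar 1 0 1)) (algHom_ext fun t => ?_) p
    fin_cases t
    · simpa [shiftVar_X_self] using hi
    · simpa [shiftVar_X_of_ne] using hj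
  rw [pairProduct_three, map_mul, map_mul, map_mul, map_mul,
    e 0 1 (X 0) (X 1 + X 2) (by simp [shiftVar, Function.update])
      (by simp [shiftVar, Function.update]),
    e 0 2 (X 0 + X 1) (X 2) (by simp [shiftVar, Function.update, add_assoc])
      (by simp [shiftVar, Function.update]),
    e 1 2 (X 1) (X 2) (by simp [shiftVar, Function.update]) (by simp [shiftVar, Function.update])]

theorem aeval_zero_X_ne_zero {g : MvPolynomial (Fin 2) ℂ} (h : ¬ X 0 ∣ g) :
    aeval ![0, (Polynomial.X : Polynomial ℂ)] g ≠ 0 := by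
  obtain ⟨e, he, h0⟩ := exists_mem_support_of_not_X_dvd h
  intro hg
  refine mem_support_iff.1 he ?_
  have h1 := congrArg (fun q : Polynomial ℂ => q.coeff (e 1)) hg
  simp only [aeval_def, eval₂_eq', Fin.prod_univ_two, Polynomial.finsetSum_coeff,
    Polynomial.coeff_zero] at h1
  rw [Finset.sum_eq_single e] at h1
  · simpa [h0] using h1
  · intro d _ hd
    by_cases hd0 : d 0 = 0
    · have hd1 : e 1 ≠ d 1 := fun h1 => hd (by ext i; fin_cases i; exacts [hd0.trans h0.symm, h1.symm])
      simp [hd0, Polynomial.coeff_X_pow, hd1]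
    · simp [hd0]
  · exact fun h => absurd he h

theorem exists_mem_support_of_aeval_ne_zero {G : MvPolynomial (Fin 3) ℂ}
    (h : aeval ![0, 0, (Polynomial.X : Polynomial ℂ)] G ≠ 0) :
    ∃ d ∈ G.support, d 0 = 0 ∧ d 1 = 0 := by
  by_contra! hcon
  refine h ?_
  rw [aeval_def, eval₂_eq']
  refine Finset.sum_eq_zero fun d hd => ?_
  rw [Fin.prod_univ_three]
  by_cases h0 : d 0 = 0
  · simp [hcon d hd h0]
  · simp [h0]

/-- If p(x_0+x,x) = x_0^l g(x_0,x) with g(0,x) nonzero, the three factors contribute x_0^l,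
(x_0+x_2)^l and x_2^l. The cofactor G restricts to g(0,x)^3 at x_0 = x_2 = 0, and so has a monomial
in x alone. -/
theorem exists_shiftVar_pairProduct_three_eq {p : MvPolynomial (Fin 2) ℂ} (hp : p ≠ 0) :
    ∃ (l : ℕ) (G : MvPolynomial (Fin 3) ℂ),
      shiftVar 1 1 2 (shiftVar 1 0 1 (pairProduct p 3)) =
        G * (X 0 ^ l * (X 1 ^ l * (X 0 + X 1) ^ l)) ∧ ∃ d ∈ G.support, d 0 = 0 ∧ d 1 = 0 := by
  obtain ⟨l, g, hq, hg⟩ := exists_eq_X_pow_mul 0 (shiftVar_ne_zero 1 (by decide : (1 : Fin 2) ≠ 0) hp)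
  refine ⟨l, aeval ![X 0, X 1 + X 2] g * aeval ![X 0 + X 1, X 2] g * aeval ![X 1, X 2] g, ?_,
    exists_mem_support_of_aeval_ne_zero ?_⟩
  · rw [shiftVar_pairProduct_three, hq]
    simp only [map_mul, map_pow, aeval_X, Matrix.cons_val_zero]
    ring
  · have h0 := aeval_zero_X_ne_zero hg
    have e : ∀ u v : MvPolynomial (Fin 3) ℂ,
        aeval ![0, 0, (Polynomial.X : Polynomial ℂ)] u = 0 →
        aeval ![0, 0, (Polynomial.X : Polynomial ℂ)] v = Polynomial.X →
        aeval ![0, 0, (Polynomial.X : Polynomial ℂ)] (aeval ![u, v] g) =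
          aeval ![0, (Polynomial.X : Polynomial ℂ)] g := by
      intro u v hu hv
      refine DFunLike.congr_fun (f := (aeval ![0, 0, (Polynomial.X : Polynomial ℂ)]).comp
        (aeval ![u, v])) (g := aeval ![0, (Polynomial.X : Polynomial ℂ)])
        (algHom_ext fun i => ?_) g
      fin_cases i <;> simp [hu, hv]
    rw [map_mul, map_mul, e _ _ (by simp) (by simp), e _ _ (by simp) (by simp),
      e _ _ (by simp) (by simp)]
    exact mul_ne_zero (mul_ne_zero h0 h0) h0

end Polynomials

/-! ### Weak associativity. -/

section WeakAssociativity

variable {W : Type*} [AddCommGroup W] [Module ℂ W] {V : Submodule ℂ (calE W)} {a b c : calE W}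

theorem IsClosedQuasiCompatible.YE_mem (hV : IsClosedQuasiCompatible V) (ha : a ∈ V) (hb : b ∈ V)
    (j : ℤ) : YE 1 a b j ∈ V := by
  have := hV.2 a ha b hb (-j - 1)
  rwa [nthProduct, show -(-j - 1) - 1 = j by ring] at this

theorem IsClosedQuasiCompatible.exists_isAnnihilator (hV : IsClosedQuasiCompatible V)
    (ha : a ∈ V) (hb : b ∈ V) : ∃ p, IsAnnihilator p a b :=
  hV.1.exists_isAnnihilator ha hb

theorem fieldProduct_three (a b c : calE W) (w : W) : fieldProduct ![a, b, c] w =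
    fun m => coeffOp a (m 0) (coeffOp b (m 1) (coeffOp c (m 2) w)) := by
  funext m
  simp [fieldProduct]

/-- `Y(a, x_0) Y(b, x_2) c`, applied to `w`, in the variables `x_0, x_2, x`. -/
def leftNested (a b c : calE W) (w : W) : FormalSeries 3 W := fun m =>
  coeffOp (YE 1 a (YE 1 b c (m 1)) (m 0)) (m 2) w

/-- `Y(Y(a, x_0) b, x_2) c`, applied to `w`, in the variables `x_0, x_2, x`. -/
def rightNested (a b c : calE W) (w : W) : FormalSeries 3 W := fun m =>
  coeffOp (YE 1 (YE 1 a b (m 0)) c (m 1)) (m 2) w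

/-- Two successive substitutions: x_1 = y + x_0 forms Y_ℰ(a,x_0)b inside the product, and y = x +
x_2 then combines its coefficients with c. -/
theorem rightNested_eq (hV : IsClosedQuasiCompatible V) (ha : a ∈ V) (hb : b ∈ V) (hc : c ∈ V)
    (P : MvPolynomial (Fin 3) ℂ) (w : W)
    (hP : polyMul P (fieldProduct ![a, b, c] w) ∈ lowerTruncated 3 W) :
    polyMul (shiftVar 1 1 2 (shiftVar 1 0 1 P)) (rightNested a b c w) =
      substAt 1 2 (substAt 0 1 (polyMul P (fieldProduct ![a, b, c] w))) := by
  obtain ⟨M, hM⟩ : ∃ M : FormalSeries 3 W,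
      M = fun m => coeffOp (YE 1 a b (m 0)) (m 1) (coeffOp c (m 2) w) := ⟨_, rfl⟩
  have h1 : SubstRel 0 1 (fieldProduct ![a, b, c] w) M := fun n => by
    convert quasiSubst_YE 1 (hV.exists_isAnnihilator ha hb) (coeffOp c (n 2) w) using 1
    · rw [fieldProduct_pair, fieldProduct_three]
      funext u; simp [line]
    · rw [hM]
      funext u; simp [line, familySeries]
  have h2 : SubstRel 1 2 M (rightNested a b c w) := fun n => by
    convert quasiSubst_YE 1 (hV.exists_isAnnihilator (hV.YE_mem ha hb (n 0)) hc) w using 1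
    · rw [fieldProduct_pair, hM]
      funext u; simp [line]
    · funext u; simp [line, familySeries, rightNested]
  have h3 := (h1.polyMul (by decide) P).eq_substAt (line_mem_lowerTruncated (by decide) hP)
  have h4 := h2.polyMul (by decide) (shiftVar 1 0 1 P)
  rw [h3] at h4
  refine h4.eq_substAt fun n => ?_
  obtain ⟨N, hN⟩ := hP
  -- For a fixed exponent of x_0 the first substitution remains truncated in y and x, so the second
  -- one is an honest substitution.
  refine ⟨min N (2 * N - n 0), fun u hu j => ?_⟩
  obtain ⟨h0, s, hs⟩ := exists_of_substAt_ne_zero hu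
  have e0 := hN _ hs 0
  have e1 := hN _ hs 1
  have e2 := hN _ hs 2
  simp at e0 e1 e2
  fin_cases j
  · simp only [Fin.zero_eta]; lia
  · simp only [Fin.mk_one]; lia

/-- Here y = x + x_2 comes first, then x_1 = x + x_0'. The first variable of the nested series
stands for x_0' = x_0 + x_2 and is expanded only later. -/
theorem leftNested_eq (hV : IsClosedQuasiCompatible V) (ha : a ∈ V) (hb : b ∈ V) (hc : c ∈ V)
    (P : MvPolynomial (Fin 3) ℂ) (w : W)
    (hP : polyMul P (fieldProduct ![a, b, c] w) ∈ lowerTruncated 3 W) :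
    polyMul (shiftVar 1 0 2 (shiftVar 1 1 2 P)) (leftNested a b c w) =
      substAt 0 2 (substAt 1 2 (polyMul P (fieldProduct ![a, b, c] w))) := by
  obtain ⟨M, hM⟩ : ∃ M : FormalSeries 3 W,
      M = fun m => coeffOp a (m 0) (coeffOp (YE 1 b c (m 1)) (m 2) w) := ⟨_, rfl⟩
  have h1 : SubstRel 1 2 (fieldProduct ![a, b, c] w) M := fun n => by
    convert (quasiSubst_YE 1 (hV.exists_isAnnihilator hb hc) w).map (coeffOp a (n 0)) using 1
    · rw [fieldProduct_pair, fieldProduct_three]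
      funext u; simp [line]
    · rw [hM]
      funext u; simp [line, familySeries]
  have h2 : SubstRel 0 2 M (leftNested a b c w) := fun n => by
    convert quasiSubst_YE 1 (hV.exists_isAnnihilator ha (hV.YE_mem hb hc (n 1))) w using 1
    · rw [fieldProduct_pair, hM]
      funext u; simp [line]
    · funext u; simp [line, familySeries, leftNested]
  have h3 := (h1.polyMul (by decide) P).eq_substAt (line_mem_lowerTruncated (by decide) hP)
  have h4 := h2.polyMul (by decide) (shiftVar 1 1 2 P)
  rw [h3] at h4
  refine h4.eq_substAt fun n => ?_
  obtain ⟨N, hN⟩ := hP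
  refine ⟨min N (2 * N - n 1), fun u hu j => ?_⟩
  obtain ⟨h0, s, hs⟩ := exists_of_substAt_ne_zero hu
  have e0 := hN _ hs 0
  have e1 := hN _ hs 1
  have e2 := hN _ hs 2
  simp at e0 e1 e2
  fin_cases j
  · simp only [Fin.zero_eta]; lia
  · simp only [Fin.mk_one]; lia

theorem IsClosedQuasiCompatible.YE_zero_right (hV : IsClosedQuasiCompatible V) (ha : a ∈ V) :
    YE 1 a 0 = 0 := by
  have h := hV.exists_isAnnihilator ha V.zero_mem
  simpa using YE_smul_right (α := 1) (0 : ℂ) h (by simpa using h)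

theorem IsClosedQuasiCompatible.YE_zero_left (hV : IsClosedQuasiCompatible V) (hb : b ∈ V) :
    YE 1 0 b = 0 := by
  have h := hV.exists_isAnnihilator V.zero_mem hb
  simpa using YE_smul_left (α := 1) (0 : ℂ) h (by simpa using h)

theorem exists_forall_YE_ne_zero_le (hV : IsClosedQuasiCompatible V) (ha : a ∈ V) (hb : b ∈ V) :
    ∃ N : ℤ, ∀ j, YE 1 a b j ≠ 0 → N ≤ j := by
  obtain ⟨l, hl⟩ := exists_YE_eq_zero 1 (hV.exists_isAnnihilator ha hb)
  exact ⟨-l, fun j hj => not_lt.1 fun h => hj (hl j h)⟩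

theorem exists_forall_coeffOp_ne_zero_le (a : calE W) (w : W) :
    ∃ N : ℤ, ∀ k, coeffOp a k w ≠ 0 → N ≤ k := by
  obtain ⟨N, hN⟩ := exists_coeffOp_eq_zero a w
  exact ⟨N, fun j hj => not_lt.1 fun h => hj (hN j h)⟩

/-- Exchange of the first two variables. -/
def swapVars (A : FormalSeries 3 W) : FormalSeries 3 W := fun m => A ![m 1, m 0, m 2]

theorem swapVars_swapVars (A : FormalSeries 3 W) : swapVars (swapVars A) = A := by
  funext m
  refine congrArg A ?_
  funext i; fin_cases i <;> rfl

theorem polyMul_swapVars (f : MvPolynomial (Fin 3) ℂ) (A : FormalSeries 3 W) :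
    polyMul (rename (Equiv.swap 0 1) f) (swapVars A) = swapVars (polyMul f A) := by
  funext m
  rw [polyMul_rename (Equiv.swap (0 : Fin 3) 1).injective]
  have h1 : (fun u => swapVars A (Function.extend (Equiv.swap (0 : Fin 3) 1) u m)) = A := by
    funext u
    refine congrArg A ?_
    have h := (Equiv.swap (0 : Fin 3) 1).injective.extend_apply u m
    have h0 := h 0
    have h1 := h 1
    have h2 := h 2
    funext i; fin_cases i
    exacts [h0, h1, h2]
  rw [h1]
  refine congrArg (polyMul f A) ?_
  funext i; fin_cases i <;> rfl

theorem lexBdd_three {A : FormalSeries 3 W} (h0 : ∃ N : ℤ, ∀ m, A m ≠ 0 → N ≤ m 0)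
    (h1 : ∀ i, ∃ N : ℤ, ∀ m, A m ≠ 0 → m 0 = i → N ≤ m 1)
    (h2 : ∀ i j, ∃ N : ℤ, ∀ m, A m ≠ 0 → m 0 = i → m 1 = j → N ≤ m 2) : LexBdd A := by
  intro s m
  fin_cases s
  · obtain ⟨N, hN⟩ := h0
    exact ⟨N, fun m' h _ => hN m' h⟩
  · obtain ⟨N, hN⟩ := h1 (m 0)
    exact ⟨N, fun m' h ht => hN m' h (ht 0 (by decide))⟩
  · obtain ⟨N, hN⟩ := h2 (m 0) (m 1)
    exact ⟨N, fun m' h ht => hN m' h (ht 0 (by decide)) (ht 1 (by decide))⟩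

theorem LexBdd.three {A : FormalSeries 3 W} (h : LexBdd A) : (∃ N : ℤ, ∀ m, A m ≠ 0 → N ≤ m 0) ∧
    (∀ i, ∃ N : ℤ, ∀ m, A m ≠ 0 → m 0 = i → N ≤ m 1) ∧
    ∀ i j, ∃ N : ℤ, ∀ m, A m ≠ 0 → m 0 = i → m 1 = j → N ≤ m 2 := by
  refine ⟨?_, fun i => ?_, fun i j => ?_⟩
  · obtain ⟨N, hN⟩ := h 0 0
    exact ⟨N, fun m hm => hN m hm fun t ht => absurd ht (by simp)⟩
  · obtain ⟨N, hN⟩ := h 1 ![i, 0, 0]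
    refine ⟨N, fun m hm hi => hN m hm fun t ht => ?_⟩
    obtain rfl : t = 0 := by lia
    exact hi
  · obtain ⟨N, hN⟩ := h 2 ![i, j, 0]
    refine ⟨N, fun m hm hi hj => hN m hm fun t ht => ?_⟩
    obtain rfl | rfl : t = 0 ∨ t = 1 := by lia
    exacts [hi, hj]

/-- The expansion moves degree from x_0 to x_2, whose exponents are at least N. So the coefficient
of x_2^i draws only on the finitely many exponents t in [N,i], and the bounds for these can be
combined. -/
theorem lexBdd_swapVars_expandAt {A : FormalSeries 3 W} (hA : LexBdd (swapVars A)) :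
    LexBdd (swapVars (expandAt 0 1 A)) := by
  obtain ⟨⟨N, hN⟩, h1, h2⟩ := hA.three
  choose f hf using h1
  choose g hg using h2
  have key : ∀ m, swapVars (expandAt 0 1 A) m ≠ 0 → ∃ t ∈ Set.Icc N (m 0),
      swapVars A ![t, m 1 + (m 0 - t), m 2] ≠ 0 := by
    intro m hm
    by_contra! hcon
    refine hm (finsum_eq_zero_of_forall_eq_zero fun s => ?_)
    by_contra h0
    have h3 : swapVars A ![m 0 - s, m 1 + s, m 2] ≠ 0 := fun h3 => h0 (by
      refine (congrArg _ (Eq.trans (congrArg A ?_) h3)).trans (smul_zero _)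
      funext i; fin_cases i <;> rfl)
    refine h3 ?_
    have h4 := hcon (m 0 - s) ⟨hN _ h3, by lia⟩
    rwa [sub_sub_cancel] at h4
  refine lexBdd_three ⟨N, fun m hm => ?_⟩ (fun i => ?_) fun i j => ?_
  · obtain ⟨t, ht, -⟩ := key m hm
    exact ht.1.trans ht.2
  · obtain ⟨M, hM⟩ := ((Set.finite_Icc N i).image f).bddBelow
    refine ⟨M - (i - N), fun m hm hi => ?_⟩
    obtain ⟨t, ht, h⟩ := key m hm
    rw [hi] at ht h
    have h3 := hf t _ h rfl
    have h4 := hM ⟨t, ht, rfl⟩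
    have h5 := ht.1
    simp only [Matrix.cons_val_one, Matrix.cons_val_zero] at h3
    lia
  · obtain ⟨M, hM⟩ := ((Set.finite_Icc N i).image fun t => g t (j + (i - t))).bddBelow
    refine ⟨M, fun m hm hi hj => ?_⟩
    obtain ⟨t, ht, h⟩ := key m hm
    rw [hi, hj] at h
    rw [hi] at ht
    exact (hM ⟨t, ht, rfl⟩).trans (hg t _ ![t, j + (i - t), m 2] h rfl rfl)

theorem lexBdd_swapVars_leftNested (hV : IsClosedQuasiCompatible V) (ha : a ∈ V) (hb : b ∈ V)
    (hc : c ∈ V) (w : W) : LexBdd (swapVars (leftNested a b c w)) := by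
  refine lexBdd_three ?_ (fun i => ?_) fun i j => ?_
  · obtain ⟨N, hN⟩ := exists_forall_YE_ne_zero_le hV hb hc
    refine ⟨N, fun m hm => hN _ fun h => hm ?_⟩
    change coeffOp (YE 1 a (YE 1 b c (m 0)) (m 1)) (m 2) w = 0
    rw [h, hV.YE_zero_right ha, Pi.zero_apply, coeffOp_zero, LinearMap.zero_apply]
  · obtain ⟨N, hN⟩ := exists_forall_YE_ne_zero_le hV ha (hV.YE_mem hb hc i)
    refine ⟨N, fun m hm hi => hN _ fun h => hm ?_⟩
    change coeffOp (YE 1 a (YE 1 b c (m 0)) (m 1)) (m 2) w = 0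
    rw [hi, h, coeffOp_zero, LinearMap.zero_apply]
  · obtain ⟨N, hN⟩ := exists_forall_coeffOp_ne_zero_le (YE 1 a (YE 1 b c i) j) w
    refine ⟨N, fun m hm hi hj => hN _ fun h => hm ?_⟩
    rwa [← hi, ← hj] at h

theorem lexBdd_rightNested (hV : IsClosedQuasiCompatible V) (ha : a ∈ V) (hb : b ∈ V)
    (hc : c ∈ V) (w : W) : LexBdd (rightNested a b c w) := by
  refine lexBdd_three ?_ (fun i => ?_) fun i j => ?_
  · obtain ⟨N, hN⟩ := exists_forall_YE_ne_zero_le hV ha hb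
    refine ⟨N, fun m hm => hN _ fun h => hm ?_⟩
    rw [rightNested, h, hV.YE_zero_left hc, Pi.zero_apply, coeffOp_zero, LinearMap.zero_apply]
  · obtain ⟨N, hN⟩ := exists_forall_YE_ne_zero_le hV (hV.YE_mem ha hb i) hc
    refine ⟨N, fun m hm hi => hN _ fun h => hm ?_⟩
    rw [rightNested, hi, h, coeffOp_zero, LinearMap.zero_apply]
  · obtain ⟨N, hN⟩ := exists_forall_coeffOp_ne_zero_le (YE 1 (YE 1 a b i) c j) w
    refine ⟨N, fun m hm hi hj => hN _ fun h => hm ?_⟩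
    rwa [← hi, ← hj] at h

/-- Cancellation of a polynomial between two series which satisfy the boundedness conditions for
different orders of the variables, if the product involves only nonnegative powers of the first
variable. -/
theorem eq_of_polyMul_eq_of_swapVars {G : MvPolynomial (Fin 3) ℂ}
    (hG : ∃ d ∈ G.support, d 0 = 0 ∧ d 1 = 0) {A B : FormalSeries 3 W}
    (hA : LexBdd (swapVars A)) (hB : LexBdd B) (h : polyMul G A = polyMul G B)
    (h0 : ∀ m, polyMul G A m ≠ 0 → 0 ≤ m 0) : A = B := by
  obtain ⟨d, hd, hd0, hd1⟩ := hG
  have hG0 : G ≠ 0 := by rintro rfl; simp at hd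
  have hinj := (Equiv.swap (0 : Fin 3) 1).injective
  have hd' : d.mapDomain (Equiv.swap 0 1) ∈ (rename (Equiv.swap 0 1) G).support := by
    rw [mem_support_iff, coeff_rename_mapDomain _ hinj]
    exact mem_support_iff.1 hd
  obtain ⟨e, he, hmin⟩ := exists_lexMin_support
    ((map_ne_zero_iff _ (rename_injective _ hinj)).2 hG0)
  have h10 : d.mapDomain (Equiv.swap (0 : Fin 3) 1) 1 = 0 :=
    (Finsupp.mapDomain_apply hinj d 0).trans hd0
  have h01 : d.mapDomain (Equiv.swap (0 : Fin 3) 1) 0 = 0 :=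
    (Finsupp.mapDomain_apply hinj d 1).trans hd1
  -- After the exchange, place 1 is the exponent of x_0. It is zero in the least monomial of G
  -- because some monomial of G involves x alone.
  have he1 : e 1 = 0 := by
    rcases (hmin _ hd').eq_or_lt with h | ⟨i, hi, hlt⟩
    · have := congrFun (toLex.injective h) 1
      simp only [h10] at this
      exact_mod_cast this
    · simp only [Pi.toLex_apply] at hi hlt
      fin_cases i
      · simp only [Fin.zero_eta, h01] at hlt; lia
      · simp only [Fin.mk_one, h10] at hlt; lia
      · have := hi 1 (by decide)
        rw [h10] at this
        exact_mod_cast this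
  -- The absence of negative powers of x_0 passes from G A to A, since the least monomial of G does
  -- not move the exponent of x_0.
  have hA0 : ∀ m, A m ≠ 0 → 0 ≤ m 0 := by
    intro m hm
    by_contra hlt
    refine hm ?_
    rw [← swapVars_swapVars A]
    refine hA.eq_zero_on {m | m 1 < 0} he hmin (fun m hm t => ?_) (fun m hm => ?_) _ ?_
    · simp only [Set.mem_ofPred_eq, he1] at hm ⊢
      lia
    · rw [polyMul_swapVars]
      by_contra hne
      have := h0 _ hne
      simp only [Matrix.cons_val_zero, he1] at this
      simp only [Set.mem_ofPred_eq] at hm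
      lia
    · simpa using hlt
  -- With x_0 bounded below, and x_2 bounded below uniformly by the original order, A is also
  -- bounded for the order x_0, x_2, x used for B.
  have hA' : LexBdd A := by
    obtain ⟨⟨N, hN⟩, h1, h2⟩ := hA.three
    have e : ∀ m, swapVars A ![m 1, m 0, m 2] = A m := fun m => by
      refine congrArg A ?_
      funext i; fin_cases i <;> rfl
    refine lexBdd_three ⟨0, hA0⟩ (fun i => ⟨N, fun m hm _ => ?_⟩) fun i j => ?_
    · exact hN ![m 1, m 0, m 2] (by rwa [e])
    · obtain ⟨M, hM⟩ := h2 j i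
      exact ⟨M, fun m hm hi hj => hM ![m 1, m 0, m 2] (by rwa [e]) hj hi⟩
  exact hA'.polyMul_cancel hG0 hB h

theorem polyMul_X_pow_injective {r : ℕ} (i : Fin r) (l : ℕ) {A B : FormalSeries r W}
    (h : polyMul (X i ^ l) A = polyMul (X i ^ l) B) : A = B := by
  rw [polyMul_X_pow, polyMul_X_pow] at h
  funext m
  have h1 := congrFun h (m + (Pi.single i (l : ℤ) : Fin r → ℤ))
  simp only [add_sub_cancel_right] at h1
  exact h1

/-- Weak associativity for fields in a closed quasi compatible subspace. -/
theorem exists_polyMul_expandAt_leftNested_eq (hV : IsClosedQuasiCompatible V) (ha : a ∈ V)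
    (hb : b ∈ V) (hc : c ∈ V) : ∃ l : ℕ, ∀ w,
      polyMul ((X 0 + X 1) ^ l) (expandAt 0 1 (leftNested a b c w)) =
        polyMul ((X 0 + X 1) ^ l) (rightNested a b c w) := by
  obtain ⟨p, hp, hT⟩ := hV.1 3 ![a, b, c] fun i => by fin_cases i <;> assumption
  obtain ⟨l, G, hG, hd⟩ := exists_shiftVar_pairProduct_three_eq hp
  -- Powers of x_0 and x_2 merely shift exponents and may be restored; l comes from p alone and is
  -- the same for all w.
  refine ⟨l, fun w => polyMul_X_pow_injective 1 l (polyMul_X_pow_injective 0 l ?_)⟩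
  have hlex := lexBdd_swapVars_leftNested hV ha hb hc w
  have hbdd : BddBelowAt 1 (leftNested a b c w) := by
    obtain ⟨⟨N, hN⟩, -⟩ := hlex.three
    refine ⟨N, fun m hm => hN ![m 1, m 0, m 2] ?_⟩
    rwa [show swapVars (leftNested a b c w) ![m 1, m 0, m 2] = leftNested a b c w m from rfl]
  have hL := congrArg (expandAt 0 1) (leftNested_eq hV ha hb hc _ w (hT w))
  -- The multiplied left side has only nonnegative powers of x_0', so the expansion of x_0' = x_0 +
  -- x_2 may be switched to nonnegative powers of x_0, where `substAt_comp` applies.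
  rw [expandAt_polyMul (by decide) _ hbdd, shiftVar_comp_three,
    expandAt_eq_substAt (fun m hm => (exists_of_substAt_ne_zero hm).1) (by decide),
    substAt_comp (hT w), hG, polyMul_mul] at hL
  have hR := rightNested_eq hV ha hb hc _ w (hT w)
  rw [hG, polyMul_mul] at hR
  have key := eq_of_polyMul_eq_of_swapVars (A := polyMul (X 0 ^ l * (X 1 ^ l * (X 0 + X 1) ^ l))
      (expandAt 0 1 (leftNested a b c w))) hd ?_
    ((lexBdd_rightNested hV ha hb hc w).polyMul_left (X 0 ^ l * (X 1 ^ l * (X 0 + X 1) ^ l)))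
    (hL.trans hR.symm) fun m hm => ?_
  · rwa [polyMul_mul, polyMul_mul, polyMul_mul, polyMul_mul] at key
  · rw [← polyMul_swapVars]
    exact (lexBdd_swapVars_expandAt hlex).polyMul_left _
  · rw [hL] at hm
    obtain ⟨-, s, hs⟩ := exists_of_substAt_ne_zero hm
    simpa using (exists_of_substAt_ne_zero hs).1

end WeakAssociativity

/-! ### Existence of the generated subspace. -/

section Generation

variable {W : Type*} [AddCommGroup W] [Module ℂ W] {S : Set (calE W)}

/-- The fields which can be adjoined to every quasi compatible set containing `S`. -/
def adjoinable (S : Set (calE W)) : Set (calE W) :=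
  {c | ∀ K, QuasiCompatible K → S ⊆ K → QuasiCompatible (insert c K)}

theorem subset_adjoinable : S ⊆ adjoinable S := fun c hc K hK hS => by
  rwa [Set.insert_eq_of_mem (hS hc)]

/-- Because K is arbitrary in `adjoinable`, a and b may be adjoined to K before c. This gives
closure without any maximality argument. -/
theorem mem_adjoinable_of_pair {a b c : calE W} (ha : a ∈ adjoinable S) (hb : b ∈ adjoinable S)
    (h : ∀ K, QuasiCompatible K → a ∈ K → b ∈ K → QuasiCompatible (insert c K)) :
    c ∈ adjoinable S := fun K hK hS => by
  have h1 := hb _ (ha K hK hS) (hS.trans (Set.subset_insert a K))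
  refine (h _ h1 (Set.mem_insert_of_mem b (Set.mem_insert a K)) (Set.mem_insert b _)).mono ?_
  exact Set.insert_subset_insert ((Set.subset_insert a K).trans (Set.subset_insert b _))

theorem idField_mem_adjoinable : idField W ∈ adjoinable S := fun _ hK _ => hK.insert_idField

/-- The adjoinable fields as a subspace. -/
def adjoinableSubmodule (S : Set (calE W)) : Submodule ℂ (calE W) where
  carrier := adjoinable S
  zero_mem' := by
    rw [← zero_smul ℂ (idField W)]
    exact mem_adjoinable_of_pair idField_mem_adjoinable idField_mem_adjoinable
      fun K hK h _ => hK.insert_smul h 0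
  add_mem' ha hb := mem_adjoinable_of_pair ha hb fun K hK h h' => hK.insert_add h h'
  smul_mem' z _ ha := mem_adjoinable_of_pair ha ha fun K hK h _ => hK.insert_smul h z

/-- A sequence involves only finitely many fields, which are adjoined to S one at a time. -/
theorem quasiCompatible_adjoinable (hS : QuasiCompatible S) : QuasiCompatible (adjoinable S) := by
  classical
  have key : ∀ F : Finset (calE W), (F : Set (calE W)) ⊆ adjoinable S →
      QuasiCompatible ((F : Set (calE W)) ∪ S) := by
    intro F
    induction F using Finset.induction_on with
    | empty => intro _; simpa using hS
    | insert c F _ ih =>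
      intro hF
      rw [Finset.coe_insert] at hF ⊢
      rw [Set.insert_union]
      exact hF (Set.mem_insert c _) _ (ih ((Set.subset_insert c _).trans hF))
        Set.subset_union_right
  intro r ψ hψ
  refine key (Finset.univ.image ψ) ?_ r ψ fun i => Or.inl ?_
  · intro c hc
    obtain ⟨i, -, rfl⟩ := Finset.mem_image.1 (Finset.mem_coe.1 hc)
    exact hψ i
  · exact Finset.mem_coe.2 (Finset.mem_image_of_mem ψ (Finset.mem_univ i))

theorem rescale_mem_adjoinable (α : ℂˣ) {a : calE W} (ha : a ∈ adjoinable S) :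
    rescale α a ∈ adjoinable S := fun K hK hS => by
  refine (ha K hK hS).rescale.mono (Set.insert_subset ?_ fun c hc => ?_)
  · exact ⟨α, a, Set.mem_insert a K, rfl⟩
  · exact ⟨1, c, Set.mem_insert_of_mem a hc, (rescale_one c).symm⟩

theorem isClosedQuasiCompatible_adjoinableSubmodule (hS : QuasiCompatible S) :
    IsClosedQuasiCompatible (adjoinableSubmodule S) :=
  ⟨quasiCompatible_adjoinable hS, fun _ ha _ hb _ =>
    mem_adjoinable_of_pair ha hb fun _ hK h h' => hK.insert_YE h h' _⟩

/-- The adjoinable fields show that the family of candidates is nonempty. The intersection inherits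
quasi compatibility from them, and the closure properties pass to intersections. -/
theorem exists_isGeneratedBy (hS : QuasiCompatible S) (Γ : Subgroup ℂˣ) :
    ∃ V : Submodule ℂ (calE W), IsGeneratedBy S Γ V := by
  refine ⟨sInf {U : Submodule ℂ (calE W) | IsClosedQuasiCompatible U ∧
    S ∪ {idField W} ⊆ (U : Set (calE W)) ∧ ∀ α ∈ Γ, ∀ a ∈ U, rescale α a ∈ U},
    ⟨⟨?_, ?_⟩, ?_, ?_⟩, fun U hU => sInf_le hU⟩
  · refine (isClosedQuasiCompatible_adjoinableSubmodule hS).1.mono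
      (sInf_le (a := adjoinableSubmodule S) ⟨isClosedQuasiCompatible_adjoinableSubmodule hS,
        Set.union_subset subset_adjoinable
          (Set.singleton_subset_iff.2 idField_mem_adjoinable),
        fun α _ a ha => rescale_mem_adjoinable α ha⟩)
  · intro a ha b hb n
    rw [Submodule.mem_sInf] at ha hb ⊢
    exact fun U hU => hU.1.2 a (ha U hU) b (hb U hU) n
  · intro a ha
    rw [SetLike.mem_coe, Submodule.mem_sInf]
    exact fun U hU => hU.2.1 ha
  · intro α hα a ha
    rw [Submodule.mem_sInf] at ha ⊢
    exact fun U hU => hU.2.2 α hα a (ha U hU)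

end Generation

/-! ### Products with the identity field. -/

section Identity

variable {W : Type*} [AddCommGroup W] [Module ℂ W] {V : Submodule ℂ (calE W)} {a b c : calE W}

theorem YE_idField_left (hV : IsClosedQuasiCompatible V) (h1 : idField W ∈ V) (hb : b ∈ V) :
    YE 1 (idField W) b = fun j => if j = 0 then b else 0 := by
  refine YE_unique (hV.exists_isAnnihilator h1 hb) fun w => ?_
  have hF : fieldProduct ![idField W, b] w =
      fun m => if m 0 = 0 then coeffOp b (m 1) w else 0 := by
    rw [fieldProduct_pair]; funext m; rw [coeffOp_idField]
  have hmem : fieldProduct ![idField W, b] w ∈ lowerTruncated 2 W := by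
    obtain ⟨N, hN⟩ := exists_forall_coeffOp_ne_zero_le b w
    rw [hF]
    refine ⟨min N 0, fun m hm i => ?_⟩
    have h0 : m 0 = 0 := by by_contra h0; simp [h0] at hm
    simp only [h0, if_true] at hm
    have := hN _ hm
    fin_cases i
    · simp [h0]
    · simp only [Fin.mk_one]; lia
  convert QuasiSubst.of_mem 1 hmem using 1
  funext m
  rw [hF, substFn]
  by_cases h0 : 0 ≤ m 0
  · obtain ⟨i, hi⟩ := Int.eq_ofNat_of_zero_le h0
    rw [if_pos h0, substCoeff, finsum_eq_single _ 0 fun s hs => by simp [hs]]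
    rcases i with _ | i
    · simp [familySeries, hi]
    · have : ((i : ℤ) + 1) ≠ 0 := by lia
      simp [familySeries, hi, coeffOp_zero, this, Ring.choose_zero_succ]
  · have : m 0 ≠ 0 := by lia
    simp [familySeries, this, h0, coeffOp_zero]

/-- Here a(x_1)1_W already lies in W((x_1,x)), so Y_ℰ(a,x_0)1_W is the Taylor expansion of a(x+x_0).
Its regularity and constant term give the creation property. -/
theorem coeffOp_YE_idField_right (hV : IsClosedQuasiCompatible V) (h1 : idField W ∈ V)
    (ha : a ∈ V) (j k : ℤ) (w : W) : coeffOp (YE 1 a (idField W) j) k w =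
      if 0 ≤ j then (Ring.choose (k + j) j.toNat : ℤ) • coeffOp a (k + j) w else 0 := by
  have hF : fieldProduct ![a, idField W] w =
      fun m => if m 1 = 0 then coeffOp a (m 0) w else 0 := by
    rw [fieldProduct_pair]; funext m; rw [coeffOp_idField]; split_ifs <;> simp
  have hmem : fieldProduct ![a, idField W] w ∈ lowerTruncated 2 W := by
    obtain ⟨N, hN⟩ := exists_forall_coeffOp_ne_zero_le a w
    rw [hF]
    refine ⟨min N 0, fun m hm i => ?_⟩
    have h0 : m 1 = 0 := by by_contra h0; simp [h0] at hm
    simp only [h0, if_true] at hm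
    have := hN _ hm
    fin_cases i
    · simp only [Fin.zero_eta]; lia
    · simp [h0]
  have h := congrFun ((quasiSubst_YE 1 (hV.exists_isAnnihilator ha h1) w).eq_substFn hmem) ![j, k]
  refine h.trans ?_
  rw [hF, substFn]
  by_cases h0 : 0 ≤ j
  · obtain ⟨i, rfl⟩ := Int.eq_ofNat_of_zero_le h0
    rw [if_pos h0, if_pos (by simp), substCoeff, finsum_eq_single _ (k + i) fun s hs => ?_]
    · simp [Int.cast_smul_eq_zsmul]
    · have : k + i - s ≠ 0 := by lia
      simp [this]
  · simp [h0]

theorem YE_idField_right_of_neg (hV : IsClosedQuasiCompatible V) (h1 : idField W ∈ V)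
    (ha : a ∈ V) {j : ℤ} (hj : j < 0) : YE 1 a (idField W) j = 0 :=
  calE_ext fun k w => by
    rw [coeffOp_YE_idField_right hV h1 ha, if_neg (by lia), coeffOp_zero, LinearMap.zero_apply]

theorem YE_idField_right_zero (hV : IsClosedQuasiCompatible V) (h1 : idField W ∈ V)
    (ha : a ∈ V) : YE 1 a (idField W) 0 = a :=
  calE_ext fun k w => by
    rw [coeffOp_YE_idField_right hV h1 ha, if_pos le_rfl]
    simp

end Identity

/-! ### The nonlocal vertex algebra and its quasi module. -/

section VertexOperator

variable {W : Type*} [AddCommGroup W] [Module ℂ W] {V : Submodule ℂ (calE W)}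

/-- The vertex operator map `Y_ℰ` of a closed quasi compatible subspace. -/
def vertexOperator (hV : IsClosedQuasiCompatible V) : V →ₗ[ℂ] calE V where
  toFun a :=
    { toFun b := HahnSeries.ofSuppBddBelow (fun j => ⟨YE 1 a b j, hV.YE_mem a.2 b.2 j⟩) (by
        obtain ⟨N, hN⟩ := exists_forall_YE_ne_zero_le hV a.2 b.2
        exact ⟨N, fun j hj => hN j fun h0 => hj (Subtype.ext h0)⟩)
      map_add' b b' := by
        ext j : 2
        exact Subtype.ext (congrFun (YE_add_right (hV.exists_isAnnihilator a.2 b.2)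
          (hV.exists_isAnnihilator a.2 b'.2) (hV.exists_isAnnihilator a.2 (b + b').2)) j)
      map_smul' z b := by
        ext j : 2
        exact Subtype.ext (congrFun (YE_smul_right z (hV.exists_isAnnihilator a.2 b.2)
          (hV.exists_isAnnihilator a.2 (z • b).2)) j) }
  map_add' a a' := by
    ext b j : 3
    exact Subtype.ext (congrFun (YE_add_left (hV.exists_isAnnihilator a.2 b.2)
      (hV.exists_isAnnihilator a'.2 b.2) (hV.exists_isAnnihilator (a + a').2 b.2)) j)
  map_smul' z a := by
    ext b j : 3
    exact Subtype.ext (congrFun (YE_smul_left z (hV.exists_isAnnihilator a.2 b.2)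
      (hV.exists_isAnnihilator (z • a).2 b.2)) j)

theorem coe_coeffOp_vertexOperator (hV : IsClosedQuasiCompatible V) (a b : V) (j : ℤ) :
    (coeffOp (vertexOperator hV a) j b : calE W) = YE 1 (a : calE W) b j := rfl

/-- The coefficient at `x ^ k` of the value of a field at `w`. -/
def evalCoeff (k : ℤ) (w : W) : calE W →ₗ[ℂ] W where
  toFun a := coeffOp a k w
  map_add' a b := by rw [coeffOp_add]; rfl
  map_smul' z a := by rw [coeffOp_smul]; rfl

theorem exists_forall_coeffOp_eq_zero_of_le (a : calE W) (w : W) (n : ℤ) :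
    ∃ M : ℕ, ∀ s : ℕ, M ≤ s → coeffOp a (n - s) w = 0 := by
  obtain ⟨N, hN⟩ := exists_coeffOp_eq_zero a w
  exact ⟨(n - N + 1).toNat, fun s hs => hN _ (by lia)⟩

theorem support_shiftedProduct_finite (a b : calE W) (w : W) (m : Fin 2 → ℤ) :
    (Function.support fun i : ℕ => (Ring.choose (m 0 + i) i : ℤ) •
      coeffOp a (m 0 + i) (coeffOp b (m 1 - i) w)).Finite := by
  obtain ⟨M, hM⟩ := exists_forall_coeffOp_eq_zero_of_le b w (m 1)
  refine (Set.finite_lt_nat M).subset fun s hs => ?_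
  by_contra h
  exact hs (by simp only [hM s (not_lt.1 h), map_zero, smul_zero])

theorem evalCoeff_shiftedProduct (hV : IsClosedQuasiCompatible V) (a b c : V) (k : ℤ) (w : W)
    (m : Fin 2 → ℤ) :
    evalCoeff k w (shiftedProduct (vertexOperator hV a) (vertexOperator hV b) c m : V) =
      expandAt 0 1 (leftNested (a : calE W) b c w) ![m 0, m 1, k] := by
  have h := (LinearMap.toAddMonoidHom (evalCoeff k w ∘ₗ V.subtype)).map_finsum
    (support_shiftedProduct_finite (vertexOperator hV a) (vertexOperator hV b) c m)
  refine h.trans (finsum_congr fun s => ?_)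
  rw [map_zsmul]
  refine congrArg _ ?_
  rfl

/-- Fields are compared through their coefficients at each w. Since (x_0+x_2)^l does not involve x,
the three-variable identity splits by powers of x, and one l works for all coefficients because it
is independent of w. -/
theorem weak_assoc_vertexOperator (hV : IsClosedQuasiCompatible V) (a b c : V) : ∃ l : ℕ,
    polyMul ((X 0 + X 1) ^ l) (shiftedProduct (vertexOperator hV a) (vertexOperator hV b) c) =
      polyMul ((X 0 + X 1) ^ l)
        (iterateSeries (vertexOperator hV) (vertexOperator hV) a b c) := by
  obtain ⟨l, hl⟩ := exists_polyMul_expandAt_leftNested_eq hV a.2 b.2 c.2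
  refine ⟨l, funext fun m => Subtype.ext (calE_ext fun k w => ?_)⟩
  have h := congrFun (hl w) ![m 0, m 1, k]
  have hr : ((X 0 + X 1) ^ l : MvPolynomial (Fin 3) ℂ) =
      rename Fin.castSucc ((X 0 + X 1) ^ l) := by simp
  have hm : (![m 0, m 1, k] : Fin 3 → ℤ) ∘ Fin.castSucc = m := by
    funext i; fin_cases i <;> rfl
  have he : ∀ u, Function.extend Fin.castSucc u ![m 0, m 1, k] = ![u 0, u 1, k] := by
    intro u
    have h0 := (Fin.castSucc_injective 2).extend_apply u ![m 0, m 1, k]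
    have h2 : Function.extend Fin.castSucc u ![m 0, m 1, k] 2 = k :=
      Function.extend_apply' _ _ _ (by rintro ⟨t, ht⟩; exact absurd ht (Fin.castSucc_lt_last t).ne)
    funext i; fin_cases i
    exacts [h0 0, h0 1, h2]
  rw [hr, polyMul_rename (Fin.castSucc_injective 2), polyMul_rename (Fin.castSucc_injective 2),
    hm] at h
  simp only [he] at h
  have key : ∀ A : FormalSeries 2 V,
      coeffOp ((polyMul ((X 0 + X 1) ^ l) A m : V) : calE W) k w =
      polyMul ((X 0 + X 1) ^ l) (fun u => evalCoeff k w (A u)) m := fun A =>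
    (congrFun (polyMul_map ((X 0 + X 1) ^ l) (evalCoeff k w ∘ₗ V.subtype) A) m).symm
  rw [key, key]
  simp only [evalCoeff_shiftedProduct]
  exact h

theorem isNonlocalVertexAlgebra_vertexOperator (hV : IsClosedQuasiCompatible V)
    (h1 : idField W ∈ V) : IsNonlocalVertexAlgebra (vertexOperator hV) ⟨idField W, h1⟩ where
  vacuum := calE_ext fun j b => by
    refine Subtype.ext ?_
    rw [coe_coeffOp_vertexOperator, YE_idField_left hV h1 b.2, coeffOp_idField]
    by_cases h : j = 0 <;> simp [h]
  creation_regular a j hj := Subtype.ext (YE_idField_right_of_neg hV h1 a.2 hj)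
  creation_limit a := Subtype.ext (YE_idField_right_zero hV h1 a.2)
  weak_assoc := weak_assoc_vertexOperator hV

theorem aeval_add_eq_shiftVar (f : MvPolynomial (Fin 2) ℂ) :
    aeval ![X 0 + X 1, X 1] f = shiftVar 1 0 1 f := by
  have h : aeval ![X 0 + X 1, X 1] = shiftVar (r := 2) 1 0 1 := by
    refine algHom_ext fun i => ?_
    fin_cases i <;> simp [shiftVar]
  rw [h]

theorem substAt_eq_substFn (A : FormalSeries 2 W) : substAt 0 1 A = substFn 1 A := by
  funext n
  have h : ∀ m : Fin 2 → ℤ, ![m 0, m 1] = m := fun m => by funext i; fin_cases i <;> rfl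
  have h1 : line 0 1 n A = A := by
    funext u
    refine congrArg A ?_
    funext i; fin_cases i <;> rfl
  rw [substAt, h1, h]

theorem expandAt_fieldProduct (a b : calE W) (w : W) :
    expandAt 0 1 (fieldProduct ![a, b] w) = shiftedProduct a b w := by
  rw [fieldProduct_pair]
  rfl

theorem isQuasiModule_vertexOperator (hV : IsClosedQuasiCompatible V) (h1 : idField W ∈ V) :
    IsQuasiModule (vertexOperator hV) ⟨idField W, h1⟩ V.subtype where
  vacuum := rfl
  quasi_assoc a b w := by
    obtain ⟨p, hp, ⟨N, hN⟩, h, -⟩ := quasiSubst_YE 1 (hV.exists_isAnnihilator a.2 b.2) w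
    -- The extra factor x_1^l clears the negative powers of x_1, so that the expansions of x_1 = x_0
    -- + x_2 in x_0 and in x_2 agree. The multiplier x_1^l p may depend on w.
    obtain ⟨l, hl⟩ : ∃ l : ℕ, 0 ≤ N + l := ⟨(-N).toNat, by lia⟩
    refine ⟨X 0 ^ l * p, mul_ne_zero (pow_ne_zero l (X_ne_zero 0)) hp, ?_⟩
    have hbdd : BddBelowAt 1 (fieldProduct ![(a : calE W), b] w) := by
      obtain ⟨M, hM⟩ := exists_forall_coeffOp_ne_zero_le (b : calE W) w
      refine ⟨M, fun m hm => hM _ fun h0 => hm ?_⟩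
      rw [fieldProduct_pair]
      simp only [h0, map_zero]
    have hpos : ∀ m, polyMul (X 0 ^ l * p) (fieldProduct ![(a : calE W), b] w) m ≠ 0 →
        0 ≤ m 0 := by
      intro m hm
      rw [polyMul_mul, polyMul_X_pow] at hm
      have := hN _ hm 0
      simp at this
      lia
    rw [aeval_add_eq_shiftVar, ← expandAt_fieldProduct]
    change polyMul _ (expandAt 0 1 (fieldProduct ![(a : calE W), b] w)) = _
    rw [← expandAt_polyMul (by decide) _ hbdd, expandAt_eq_substAt hpos (by decide), substAt_eq_substFn,
      polyMul_mul, substFn_polyMul 1 _ ⟨N, hN⟩, ← h, ← polyMul_mul]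
    simp only [Units.val_one, map_mul]
    rfl

end VertexOperator

/-! ### The spanning set. -/

section Spanning

variable {W : Type*} [AddCommGroup W] [Module ℂ W] {V : Submodule ℂ (calE W)} {a b c : calE W}

theorem IsClosedQuasiCompatible.YE_add_left (hV : IsClosedQuasiCompatible V) {a' : calE W}
    (ha : a ∈ V) (ha' : a' ∈ V) (hb : b ∈ V) : YE 1 (a + a') b = YE 1 a b + YE 1 a' b :=
  FormalCalculus.YE_add_left (hV.exists_isAnnihilator ha hb) (hV.exists_isAnnihilator ha' hb)
    (hV.exists_isAnnihilator (V.add_mem ha ha') hb)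

theorem IsClosedQuasiCompatible.YE_add_right (hV : IsClosedQuasiCompatible V) {b' : calE W}
    (ha : a ∈ V) (hb : b ∈ V) (hb' : b' ∈ V) : YE 1 a (b + b') = YE 1 a b + YE 1 a b' :=
  FormalCalculus.YE_add_right (hV.exists_isAnnihilator ha hb) (hV.exists_isAnnihilator ha hb')
    (hV.exists_isAnnihilator ha (V.add_mem hb hb'))

theorem IsClosedQuasiCompatible.YE_smul_left (hV : IsClosedQuasiCompatible V) (z : ℂ)
    (ha : a ∈ V) (hb : b ∈ V) : YE 1 (z • a) b = z • YE 1 a b :=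
  FormalCalculus.YE_smul_left z (hV.exists_isAnnihilator ha hb)
    (hV.exists_isAnnihilator (V.smul_mem z ha) hb)

theorem IsClosedQuasiCompatible.YE_smul_right (hV : IsClosedQuasiCompatible V) (z : ℂ)
    (ha : a ∈ V) (hb : b ∈ V) : YE 1 a (z • b) = z • YE 1 a b :=
  FormalCalculus.YE_smul_right z (hV.exists_isAnnihilator ha hb)
    (hV.exists_isAnnihilator ha (V.smul_mem z hb))

/-- The coefficients of `Y(Y(a, x_0) b, x_2) c` lie in every subspace which contains those of
`Y(a, x_0) Y(b, x_2) c`. -/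
theorem YE_YE_mem (hV : IsClosedQuasiCompatible V) (ha : a ∈ V) (hb : b ∈ V) (hc : c ∈ V)
    (U : Submodule ℂ (calE W)) (h : ∀ i j, YE 1 a (YE 1 b c j) i ∈ U) (i j : ℤ) :
    YE 1 (YE 1 a b i) c j ∈ U := by
  obtain ⟨l, hl⟩ := weak_assoc_vertexOperator hV ⟨a, ha⟩ ⟨b, hb⟩ ⟨c, hc⟩
  obtain ⟨φ, hφ⟩ : ∃ φ : V →ₗ[ℂ] calE W ⧸ U, φ = U.mkQ ∘ₗ V.subtype := ⟨_, rfl⟩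
  have hφ0 : ∀ v : V, φ v = 0 ↔ (v : calE W) ∈ U := fun v => by
    rw [hφ]; exact Submodule.Quotient.mk_eq_zero U
  have hleft : ∀ m, φ (shiftedProduct (vertexOperator hV ⟨a, ha⟩) (vertexOperator hV ⟨b, hb⟩)
      ⟨c, hc⟩ m) = 0 := by
    intro m
    refine finsum_induction (fun v : V => φ v = 0) (map_zero φ)
      (fun x y hx hy => by rw [map_add, hx, hy, add_zero]) fun s => ?_
    rw [map_zsmul, (hφ0 _).2 (h _ _), smul_zero]
  -- Modulo U the iterate is annihilated by (x_0+x_2)^l and is still bounded below in the order x_0,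
  -- x_2. Hence it vanishes there, by cancellation over the quotient space.
  have hlex : LexBdd fun m => φ (iterateSeries (vertexOperator hV) (vertexOperator hV)
      ⟨a, ha⟩ ⟨b, hb⟩ ⟨c, hc⟩ m) := by
    intro s m
    fin_cases s
    · obtain ⟨N, hN⟩ := exists_forall_YE_ne_zero_le hV ha hb
      refine ⟨N, fun m' hm' _ => hN _ fun (h0 : YE 1 a b (m' 0) = 0) => hm' ((hφ0 _).2 ?_)⟩
      change YE 1 (YE 1 a b (m' 0)) c (m' 1) ∈ U
      rw [h0, hV.YE_zero_left hc]
      exact U.zero_mem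
    · obtain ⟨N, hN⟩ := exists_forall_YE_ne_zero_le hV (hV.YE_mem ha hb (m 0)) hc
      refine ⟨N, fun m' hm' ht =>
        hN _ fun (h0 : YE 1 (YE 1 a b (m 0)) c (m' 1) = 0) => hm' ((hφ0 _).2 ?_)⟩
      change YE 1 (YE 1 a b (m' 0)) c (m' 1) ∈ U
      rw [ht 0 (by decide), h0]
      exact U.zero_mem
  have hne : ((X 0 + X 1) ^ l : MvPolynomial (Fin 2) ℂ) ≠ 0 := by
    refine pow_ne_zero l ?_
    have := shiftVar_ne_zero 1 (i := (0 : Fin 2)) (k := 1) (by decide) (X_ne_zero (R := ℂ) 0)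
    rwa [shiftVar_X_self, C_1, one_mul] at this
  have hzero := hlex.eq_zero_of_polyMul hne <| by
    refine (polyMul_map (W := V) (W' := calE W ⧸ U) _ φ _).trans ?_
    rw [← hl]
    refine (polyMul_map (W := V) (W' := calE W ⧸ U) _ φ _).symm.trans ?_
    simp only [hleft]
    exact polyMul_zero _
  exact (hφ0 _).1 (congrFun hzero ![i, j])

/-- The span of the iterated products of elements of `T` applied to `1_W`. -/
def iteratedSpan (T : Set (calE W)) : Submodule ℂ (calE W) :=
  Submodule.span ℂ {c | ∃ L : List (calE W × ℤ), (∀ an ∈ L, an.1 ∈ T) ∧ c = iteratedProduct L}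

variable {T : Set (calE W)}

theorem iteratedProduct_mem_iteratedSpan {L : List (calE W × ℤ)} (hL : ∀ an ∈ L, an.1 ∈ T) :
    iteratedProduct L ∈ iteratedSpan T := Submodule.subset_span ⟨L, hL, rfl⟩

theorem iteratedSpan_le (hV : IsClosedQuasiCompatible V) (h1 : idField W ∈ V) (hT : T ⊆ V) :
    iteratedSpan T ≤ V := by
  refine Submodule.span_le.2 ?_
  rintro c ⟨L, hL, rfl⟩
  induction L with
  | nil => exact h1
  | cons an L ih =>
    exact hV.2 _ (hT (hL an List.mem_cons_self)) _
      (ih fun bn hb => hL bn (List.mem_cons_of_mem an hb)) _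

theorem YE_mem_iteratedSpan_of_mem (hV : IsClosedQuasiCompatible V) (h1 : idField W ∈ V)
    (hT : T ⊆ V) (ha : a ∈ T) (hb : b ∈ iteratedSpan T) (j : ℤ) :
    YE 1 a b j ∈ iteratedSpan T := by
  refine Submodule.span_induction (p := fun b _ => YE 1 a b j ∈ iteratedSpan T)
    ?_ ?_ (fun x y hx hy h h' => ?_) (fun z x hx h => ?_) hb
  · rintro c ⟨L, hL, rfl⟩
    have := iteratedProduct_mem_iteratedSpan (T := T) (L := (a, -j - 1) :: L) (by
      rintro bn (_ | ⟨_, hbn⟩)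
      exacts [ha, hL _ hbn])
    rwa [iteratedProduct, List.foldr_cons, nthProduct,
      show -(-j - 1) - 1 = j by ring] at this
  · rw [hV.YE_zero_right (hT ha)]
    exact zero_mem _
  · rw [hV.YE_add_right (hT ha) (iteratedSpan_le hV h1 hT hx) (iteratedSpan_le hV h1 hT hy)]
    exact add_mem h h'
  · rw [hV.YE_smul_right z (hT ha) (iteratedSpan_le hV h1 hT hx)]
    exact Submodule.smul_mem _ z h

/-- Induction on the length of the left factor: for a_n u with a in T, `YE_YE_mem` reduces products
with a_n u to those of a with products of the shorter u. -/
theorem YE_mem_iteratedSpan (hV : IsClosedQuasiCompatible V) (h1 : idField W ∈ V)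
    (hT : T ⊆ V) (ha : a ∈ iteratedSpan T) (hb : b ∈ iteratedSpan T) (j : ℤ) :
    YE 1 a b j ∈ iteratedSpan T := by
  have hle := iteratedSpan_le hV h1 hT
  refine Submodule.span_induction
    (p := fun a _ => ∀ b ∈ iteratedSpan T, ∀ j, YE 1 a b j ∈ iteratedSpan T)
    ?_ ?_ (fun x y hx hy h h' b hb j => ?_) (fun z x hx h b hb j => ?_) ha b hb j
  · rintro c ⟨L, hL, rfl⟩
    induction L with
    | nil =>
      intro b hb j
      change YE 1 (idField W) b j ∈ _
      rw [YE_idField_left hV h1 (hle hb)]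
      by_cases hj : j = 0 <;> simp [hj, hb]
    | cons an L ih =>
      intro b hb j
      have hL' : ∀ bn ∈ L, bn.1 ∈ T := fun bn hb => hL bn (List.mem_cons_of_mem an hb)
      have han := hL an List.mem_cons_self
      exact YE_YE_mem hV (hT han) (hle (iteratedProduct_mem_iteratedSpan hL')) (hle hb) _
        (fun i j => YE_mem_iteratedSpan_of_mem hV h1 hT han (ih hL' b hb j) i) _ j
  · intro b hb j
    rw [hV.YE_zero_left (hle hb)]
    exact zero_mem _
  · rw [hV.YE_add_left (hle hx) (hle hy) (hle hb)]
    exact add_mem (h b hb j) (h' b hb j)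
  · rw [hV.YE_smul_left z (hle hx) (hle hb)]
    exact Submodule.smul_mem _ z (h b hb j)

theorem subset_iteratedSpan (hV : IsClosedQuasiCompatible V) (h1 : idField W ∈ V) (hT : T ⊆ V) :
    T ⊆ iteratedSpan T := fun a ha => by
  have h := YE_mem_iteratedSpan_of_mem hV h1 hT ha
    (iteratedProduct_mem_iteratedSpan (L := []) (by simp)) 0
  rwa [show iteratedProduct [] = idField W from rfl,
    YE_idField_right_zero hV h1 (hT ha)] at h

theorem isClosedQuasiCompatible_iteratedSpan (hV : IsClosedQuasiCompatible V)
    (h1 : idField W ∈ V) (hT : T ⊆ V) : IsClosedQuasiCompatible (iteratedSpan T) :=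
  ⟨hV.1.mono (iteratedSpan_le hV h1 hT), fun _ ha _ hb _ => YE_mem_iteratedSpan hV h1 hT ha hb _⟩

theorem rescale_add (α : ℂˣ) (a b : calE W) : rescale α (a + b) = rescale α a + rescale α b :=
  calE_ext fun k w => by simp [coeffOp_rescale, coeffOp_add]

theorem rescale_smul (α : ℂˣ) (z : ℂ) (a : calE W) : rescale α (z • a) = z • rescale α a :=
  calE_ext fun k w => by simp [coeffOp_rescale, coeffOp_smul, smul_comm z]

theorem rescale_zero (α : ℂˣ) : rescale α (0 : calE W) = 0 := by
  simpa using rescale_smul α 0 (0 : calE W)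

theorem rescale_YE (α : ℂˣ) (h : ∃ p, IsAnnihilator p (rescale α a) b)
    (h' : ∃ p, IsAnnihilator p a (rescale α⁻¹ b)) (j : ℤ) :
    rescale α (YE 1 a (rescale α⁻¹ b) j) =
      ((α⁻¹ : ℂˣ) : ℂ) ^ j • YE 1 (rescale α a) b j := by
  rw [YE_rescale α h h', smul_smul, ← mul_zpow, Units.inv_mul, one_zpow, one_smul]

/-- By the conjugation formula R_α(a_n u) is a scalar multiple of (R_α a)_n (R_α u), so R_α acts on
iterated products factor by factor. -/
theorem rescale_mem_iteratedSpan (hV : IsClosedQuasiCompatible V) (h1 : idField W ∈ V)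
    (hT : T ⊆ V) {α : ℂˣ} (hα : ∀ a ∈ T, rescale α a ∈ T) (hb : b ∈ iteratedSpan T) :
    rescale α b ∈ iteratedSpan T := by
  refine Submodule.span_induction (p := fun b _ => rescale α b ∈ iteratedSpan T)
    ?_ ?_ (fun x y hx hy h h' => ?_) (fun z x hx h => ?_) hb
  · rintro c ⟨L, hL, rfl⟩
    induction L with
    | nil =>
      change rescale α (idField W) ∈ _
      rw [rescale_idField]
      exact iteratedProduct_mem_iteratedSpan (L := []) (by simp)
    | cons an L ih =>
      have hL' : ∀ bn ∈ L, bn.1 ∈ T := fun bn hb => hL bn (List.mem_cons_of_mem an hb)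
      have han := hL an List.mem_cons_self
      have hle := iteratedSpan_le hV h1 hT
      have e : rescale α⁻¹ (rescale α (iteratedProduct L)) = iteratedProduct L := by
        rw [rescale_rescale, inv_mul_cancel, rescale_one]
      change rescale α (YE 1 an.1 (iteratedProduct L) _) ∈ _
      rw [← e, rescale_YE α (hV.exists_isAnnihilator (hT (hα _ han)) (hle (ih hL')))]
      · exact Submodule.smul_mem _ _
          (YE_mem_iteratedSpan_of_mem hV h1 hT (hα _ han) (ih hL') _)
      · rw [e]
        exact hV.exists_isAnnihilator (hT han) (hle (iteratedProduct_mem_iteratedSpan hL'))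
  · rw [rescale_zero]; exact zero_mem _
  · rw [rescale_add]; exact add_mem h h'
  · rw [rescale_smul]; exact Submodule.smul_mem _ z h

/-- The span is itself a candidate in the minimality property: R_Γ(S) is Γ-stable because Γ is a
group, and contains S because 1 ∈ Γ. -/
theorem IsGeneratedBy.eq_iteratedSpan {S : Set (calE W)} {Γ : Subgroup ℂˣ}
    (hV : IsGeneratedBy S Γ V) : V = iteratedSpan (rescaleSet Γ S) := by
  obtain ⟨⟨hcl, hS, hΓ⟩, hmin⟩ := hV
  have h1 : idField W ∈ V := hS (Or.inr rfl)
  have hT : rescaleSet Γ S ⊆ (V : Set (calE W)) := by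
    rintro c ⟨α, hα, a, ha, rfl⟩
    exact hΓ α hα a (hS (Or.inl ha))
  refine le_antisymm (hmin ⟨isClosedQuasiCompatible_iteratedSpan hcl h1 hT, ?_, ?_⟩)
    (iteratedSpan_le hcl h1 hT)
  · rintro a (ha | rfl)
    · exact subset_iteratedSpan hcl h1 hT ⟨1, Γ.one_mem, a, ha, (rescale_one a).symm⟩
    · exact iteratedProduct_mem_iteratedSpan (L := []) (by simp)
  · intro α hα a ha
    refine rescale_mem_iteratedSpan hcl h1 hT ?_ ha
    rintro c ⟨β, hβ, d, hd, rfl⟩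
    exact ⟨α * β, Γ.mul_mem hα hβ, d, hd, rescale_rescale α β d⟩

end Spanning

end

end FormalCalculus

/-! ### The main theorem. -/

theorem theorem2p20 {W : Type*} [AddCommGroup W] [Module ℂ W]
    (S : Set (calE W)) (hS : QuasiCompatible S) (Γ : Subgroup ℂˣ) :
    (∃! V : Submodule ℂ (calE W), IsGeneratedBy S Γ V) ∧
    ∀ V : Submodule ℂ (calE W), IsGeneratedBy S Γ V →
      -- `(V, Y_ℰ, 1_W)` is a nonlocal vertex algebra with `W` as a faithful quasi module,
      -- where `Y_W` is the inclusion of `V` into `ℰ(W)`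
      (∃ (Y : V →ₗ[ℂ] calE V) (vac : V),
        (∀ (a b : V) (j : ℤ), (((Y a b).coeff j : V) : calE W) = YE 1 (a : calE W) b j) ∧
        (vac : calE W) = idField W ∧
        IsNonlocalVertexAlgebra Y vac ∧
        IsQuasiModule Y vac V.subtype ∧
        Function.Injective V.subtype) ∧
      -- the spanning set
      V = Submodule.span ℂ {c | ∃ L : List (calE W × ℤ),
        (∀ an ∈ L, an.1 ∈ rescaleSet Γ S) ∧ c = iteratedProduct L} ∧
      -- closure under the products with parameter in `Γ`, and the conjugation formulas,
      -- as identities between the coefficients of the powers of `x_0`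
      ∀ a ∈ V, ∀ b ∈ V, ∀ α ∈ Γ,
        (∀ n : ℤ, nthProduct α a n b ∈ V) ∧
        (∀ j : ℤ, YE α a b j = rescale α (YE 1 a (rescale α⁻¹ b) j)) ∧
        (∀ j : ℤ, rescale α (YE 1 a (rescale α⁻¹ b) j) =
          ((α⁻¹ : ℂˣ) : ℂ) ^ j • YE 1 (rescale α a) b j) := by
  refine ⟨?_, fun V hgen => ?_⟩
  · obtain ⟨V, hV⟩ := exists_isGeneratedBy hS Γ
    exact ⟨V, hV, fun U hU => hU.unique hV⟩
  obtain ⟨⟨hV, hSV, hΓ⟩, -⟩ := id hgen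
  have h1 : idField W ∈ V := hSV (Or.inr rfl)
  refine ⟨⟨vertexOperator hV, ⟨idField W, h1⟩, fun _ _ _ => rfl, rfl,
    isNonlocalVertexAlgebra_vertexOperator hV h1, isQuasiModule_vertexOperator hV h1,
    V.injective_subtype⟩, hgen.eq_iteratedSpan, fun a ha b hb α hα => ?_⟩
  have hb' : rescale α⁻¹ b ∈ V := hΓ _ (Γ.inv_mem hα) b hb
  have hY : ∀ j, YE α a b j = rescale α (YE 1 a (rescale α⁻¹ b) j) := congrFun
    (YE_eq_rescale α (hV.exists_isAnnihilator ha hb) (hV.exists_isAnnihilator ha hb'))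
  refine ⟨fun n => ?_, hY, rescale_YE α (hV.exists_isAnnihilator (hΓ α hα a ha) hb)
    (hV.exists_isAnnihilator ha hb')⟩
  -- The products with parameter α reduce, by conjugation with R_α, to those with parameter 1, and V
  -- is stable under R_α and its inverse.
  rw [nthProduct, hY]
  exact hΓ α hα _ (hV.YE_mem ha hb' _)
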